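/- For a finite simple graph $G=(V,E)$, a \emph{bisection} is a partition $(X,Y)$ of $V$ with $|X|\le|Y|\le|X|+1$; its \emph{size} is the number of edges between $X$ and $Y$. The parameterized problem Max-Bisec-ATLB asks, given $G$ with $m$ edges and a parameter $k\in\mathbb{N}$, whether $G$ has a bisection of size at least $\lceil m/2\rceil+k$. (Graphs are given by their adjacency matrices, $k$ is written in binary, and algorithms are multi-stack Turing machines with finite control; $|G|$ denotes the length of the encoding of $G$.) \textbf{Theorem.} Max-Bisec-ATLB has a kernel with $O(k^2)$ vertices and $O(k^3)$ edges. More precisely, there are a map $(G,k)\mapsto(G',k')$ computable in polynomial time, a constant $C$, and functions $g,h:\mathbb{N}\to\mathbb{N}$ such that for every finite simple graph $G$ and every $k\in\mathbb{N}$: (i) $(G,k)$ is a yes-instance if and only if $(G',k')$ is a yes-instance; (ii) $k'\le g(k)$ and $|G'|\le h(k)$; (iii) $G'$ has at most $4k(k+1)$ vertices and at most $Ck^3$ edges. Consequently Max-Bisec-ATLB is fixed-parameter tractable: there are a computable function $f:\mathbb{N}\to\mathbb{N}$, a polynomial $p$, and an algorithm that decides every instance $(G,k)$ in at most $f(k)\cdot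 p(|G|)$ steps. -/

import Mathlib

/-! ### Parameterized problems, kernelizations, fixed-parameter tractability -/

/-- A parameterized problem: instances are pairs `(x, k)` where `x : Inst` is written as a string
over the finite alphabet `Γ` by the injective map `encode`, and `k : ℕ` is the parameter.
`Yes x k` says that `(x, k)` belongs to the problem. -/
structure ParamProblem where
  Inst : Type
  Γ : Type
  [finΓ : Fintype Γ]
  encode : Inst → List Γ
  encode_injective : Function.Injective encode
  Yes : Inst → ℕ → Prop

namespace ParamProblem

/-- The length `|x|` of an instance. -/
def size (P : ParamProblem) (x : P.Inst) : ℕ := (P.encode x).length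

/-- The string given to (or returned by) a machine for the pair `(x, k)`: the binary expansion
of `k` followed by the encoding of `x`, the two parts being written in disjoint alphabets. -/
def encodePair (P : ParamProblem) (q : P.Inst × ℕ) : List (Bool ⊕ P.Γ) :=
  (Computability.encodeNat q.2).map Sum.inl ++ (P.encode q.1).map Sum.inr

/-- A kernelization: a map on pairs `(x, k)` computed by a polynomial-time Turing machine that
preserves membership, and whose output `(x', k')` satisfies `k' ≤ g k` and `|x'| ≤ h k`. -/
structure IsKernelization (P : ParamProblem) (φ : P.Inst × ℕ → P.Inst × ℕ) : Prop where
  polyTime : Nonempty (Turing.TM2ComputableInPolyTime P.encodePair P.encodePair φ)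
  yes_iff : ∀ x k, P.Yes x k ↔ P.Yes (φ (x, k)).1 (φ (x, k)).2
  bounded : ∃ g h : ℕ → ℕ, ∀ x k, (φ (x, k)).2 ≤ g k ∧ P.size (φ (x, k)).1 ≤ h k

open Classical in
/-- Fixed-parameter tractability: a single Turing machine decides membership of `(x, k)` within
`f k * p |x|` steps, with `f` computable and `p` a polynomial. (A polynomial is used rather than
a bare power `|x| ^ c`, which would be zero at the empty string.) -/
def FixedParameterTractable (P : ParamProblem) : Prop :=
  ∃ (f : ℕ → ℕ) (p : Polynomial ℕ) (M : Turing.TM2ComputableAux (Bool ⊕ P.Γ) Bool),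
    Computable f ∧
    ∀ x k, Nonempty (Turing.TM2OutputsInTime M.tm
      ((P.encodePair (x, k)).map M.inputAlphabet.symm)
      (some ((Computability.encodeBool (decide (P.Yes x k))).map M.outputAlphabet.symm))
      (f k * p.eval (P.size x)))

end ParamProblem

/-! ### Bisections -/

/-- `(X, Y)` is a bisection of the vertex set `V`. -/
def IsBisection {V : Type*} [Fintype V] [DecidableEq V] (X Y : Finset V) : Prop :=
  Disjoint X Y ∧ X ∪ Y = Finset.univ ∧ X.card ≤ Y.card ∧ Y.card ≤ X.card + 1

open Classical in
/-- The size of `(X, Y)`: the number of edges of `G` between the disjoint sets `X` and `Y`. -/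
noncomputable def cutSize {V : Type*} (G : SimpleGraph V) (X Y : Finset V) : ℕ :=
  (G.interedges X Y).card

/-- `G` has a bisection of size at least `⌈m / 2⌉ + k`, where `m` is its number of edges. -/
def HasBisectionATLB {V : Type*} [Fintype V] [DecidableEq V] (G : SimpleGraph V) (k : ℕ) : Prop :=
  ∃ X Y : Finset V, IsBisection X Y ∧ ⌈(G.edgeSet.ncard : ℚ) / 2⌉₊ + k ≤ cutSize G X Y

/-! ### The problem Max-Bisec-ATLB -/

/-- Finite graphs, as inputs of an algorithm: a number of vertices and a graph on `Fin n`. -/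
structure FinGraph where
  n : ℕ
  graph : SimpleGraph (Fin n)

namespace FinGraph

/-- The number of edges. -/
noncomputable def numEdges (G : FinGraph) : ℕ := G.graph.edgeSet.ncard

open Classical in
/-- The adjacency matrix, row by row; each row is followed by the separator `none`. -/
noncomputable def encode (G : FinGraph) : List (Option Bool) :=
  (List.finRange G.n).flatMap fun i =>
    ((List.finRange G.n).map fun j => some (decide (G.graph.Adj i j))) ++ [none]

theorem encode_injective : Function.Injective encode := by
  classical
  have key : ∀ {α β : Type} (l : List α) (f g : α → List β),
      (∀ i, (f i).length = (g i).length) → l.flatMap f = l.flatMap g → ∀ i ∈ l, f i = g i := by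
    intro α β l f g hlen
    induction l with
    | nil => intro _ i hi; simp at hi
    | cons a t ih =>
      intro h i hi
      rw [List.flatMap_cons, List.flatMap_cons] at h
      obtain ⟨h1, h2⟩ := List.append_inj h (hlen a)
      rcases List.mem_cons.mp hi with rfl | hi
      · exact h1
      · exact ih h2 i hi
  have hlen : ∀ G : FinGraph, G.encode.length = G.n * (G.n + 1) := by
    intro G
    simp [encode, List.length_flatMap]
  rintro ⟨n, G⟩ ⟨n', G'⟩ h
  have hn : n = n' := by
    have h1 : n * (n + 1) = n' * (n' + 1) := by
      have := congrArg List.length h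
      rwa [hlen, hlen] at this
    rcases lt_trichotomy n n' with hlt | heq | hgt
    · nlinarith
    · exact heq
    · nlinarith
  subst hn
  congr 1
  ext i j
  have h1 := key (List.finRange n) _ _ (by intro i; simp) h i (List.mem_finRange i)
  have h2 := List.append_cancel_right h1
  have h3 := List.map_inj_left.mp h2 j (List.mem_finRange j)
  simpa using h3

end FinGraph

/-- Max Bisection above Tight Lower Bound. -/
noncomputable def maxBisecATLB : ParamProblem where
  Inst := FinGraph
  Γ := Option Bool
  encode := FinGraph.encode
  encode_injective := FinGraph.encode_injective
  Yes G k := HasBisectionATLB G.graph k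

/-! Make the order even by an isolated vertex if necessary, and describe a bisection by a balanced
signing `s` with values ±1. The number of cut edges minus the number of uncut ones is minus the sum
of `s i * s j` over the edges. Since `pairSum` runs over ordered pairs, a bisection of size at least
⌈m/2⌉ + k is a signing with `-pairSum ≥ 4k` (`hasBisectionATLB_iff`,
`hasBisectionATLB_iff_hasSigning`). Signings are superadditive (`HasSigning.union`): of two balanced
signings on disjoint sets, one can be negated so that the cross term does not hurt. Hence local
gains add up, and left-over vertices cost nothing when their number is even.

A matching with m edges gains 2m; a star with q + 1 leaves, completed by q non-neighbours of the
centre, gains 2(q + 1) if leaves and non-neighbours together are independent. Suppose that 4k is not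
attained. A maximal matching then has m < 2k edges, and its vertex set W has independent complement.
If some v in W had more than d = 2k - m neighbours and more than d non-neighbours outside W,
exchanging the matching edge at v for a star would gain 2(m - 1) + 2(d + 1) = 4k. So each v in W
sees all vertices outside W alike, with at most d exceptions. Without the exceptions a set of twins
remains, whose complement has at most 2m(2k - m + 1) ≤ 2k(k + 1) vertices
(`exists_twins_of_not_hasSigning`).

A class of twins with more than half of the vertices may be cut down to the number of the others:
balance prescribes the sum of the signs on it, and only this sum enters the value
(`hasSigning_union_twins_iff`). What remains has at most 4k(k + 1) vertices, and at most 4k of them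
cover all edges (`card_trim_le`). If the trimmed graph exceeds the resulting bounds, the answer is
yes, and the kernel is the empty graph with parameter 0.

The machines come from a small compiler: register programs with bounded loops, over arithmetic
expressions with bounded sums, become structured stack programs, and these become multi-stack
machines (`Exec.reaches`). Registers are unary, so running times reduce to bounds of values
(`Exp.exists_polynomial`, `Prog.Tame`, `Prog.PolyTime`). The decision procedure answers yes when the
trimmed graph is too large, and otherwise tries all subsets of its vertices. A subset is coded by a
number, membership being divisibility by one of several pairwise coprime numbers
(`exists_code_dvd_iff`). The codes are bounded in terms of k alone, and `Polynomial.eval_add_le`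
turns the time bound, a polynomial in f(k) + |G|, into a product. -/

/-! ### Structured programs on stacks, and their compilation to multi-stack machines -/

namespace StackProg

open Turing Function

/-- Structured programs acting on stacks indexed by `K` with alphabet `A`, and on an output stack
with alphabet `B` on which one can only push. -/
inductive Cmd (K A B : Type) : Type
  | skip : Cmd K A B
  | push (k : K) (a : A) : Cmd K A B
  | pop (k : K) : Cmd K A B
  | move (k k' : K) : Cmd K A B
  | emit (b : B) : Cmd K A B
  | seq (c d : Cmd K A B) : Cmd K A B
  | ite (k : K) (p : Option A → Bool) (c d : Cmd K A B) : Cmd K A B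
  | repeatWhile (k : K) (p : Option A → Bool) (c : Cmd K A B) : Cmd K A B

namespace Cmd

variable {K A B : Type}

/-- The labels of the machine fragment that executes a program. -/
def Label : Cmd K A B → Type
  | seq c d => c.Label ⊕ d.Label
  | ite _ _ c d => Option (c.Label ⊕ d.Label)
  | repeatWhile _ _ c => Option c.Label
  | _ => Unit

/-- The label at which execution starts. -/
def entry : (c : Cmd K A B) → c.Label
  | seq c _ => Sum.inl c.entry
  | ite _ _ _ _ => none
  | repeatWhile _ _ _ => none
  | skip => ()
  | push _ _ => ()
  | pop _ => ()
  | move _ _ => ()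
  | emit _ => ()

instance labelFintype : (c : Cmd K A B) → Fintype c.Label
  | seq c d => @instFintypeSum _ _ (labelFintype c) (labelFintype d)
  | ite _ _ c d => @instFintypeOption _ (@instFintypeSum _ _ (labelFintype c) (labelFintype d))
  | repeatWhile _ _ c => @instFintypeOption _ (labelFintype c)
  | skip => inferInstanceAs (Fintype Unit)
  | push _ _ => inferInstanceAs (Fintype Unit)
  | pop _ => inferInstanceAs (Fintype Unit)
  | move _ _ => inferInstanceAs (Fintype Unit)
  | emit _ => inferInstanceAs (Fintype Unit)

/-- The alphabets of the compiled machine: `none` is the output stack. -/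
abbrev Alph (K A B : Type) : Option K → Type
  | none => B
  | some _ => A

/-- The statements of the fragment executing `c`, placed among the labels `Λ` by `emb` and leaving
to the label `ex`. The internal state holds a symbol during a move and is `none` otherwise. -/
def code [Inhabited A] : (c : Cmd K A B) → {Λ : Type} → (c.Label → Λ) → Λ → c.Label →
    TM2.Stmt (Alph K A B) Λ (Option A)
  | skip, _, _, ex, _ => .goto fun _ => ex
  | push k a, _, _, ex, _ => .push (some k) (fun _ => a) (.goto fun _ => ex)
  | pop k, _, _, ex, _ => .pop (some k) (fun v _ => v) (.goto fun _ => ex)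
  -- The default symbol is never pushed in a run described by `Exec`, where a move requires a
  -- nonempty source.
  | move k k', _, _, ex, _ => .pop (some k) (fun _ a => a)
      (.push (some k') (fun v => v.getD default) (.load (fun _ => none) (.goto fun _ => ex)))
  | emit b, _, _, ex, _ => .push none (fun _ => b) (.goto fun _ => ex)
  | seq c d, _, emb, _, Sum.inl l => c.code (fun l => emb (Sum.inl l)) (emb (Sum.inr d.entry)) l
  | seq _ d, _, emb, ex, Sum.inr l => d.code (fun l => emb (Sum.inr l)) ex l
  | ite k p c d, _, emb, _, none => .peek (some k) (fun _ a => a)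
      (.branch p (.load (fun _ => none) (.goto fun _ => emb (some (Sum.inl c.entry))))
        (.load (fun _ => none) (.goto fun _ => emb (some (Sum.inr d.entry)))))
  | ite _ _ c _, _, emb, ex, some (Sum.inl l) => c.code (fun l => emb (some (Sum.inl l))) ex l
  | ite _ _ _ d, _, emb, ex, some (Sum.inr l) => d.code (fun l => emb (some (Sum.inr l))) ex l
  | repeatWhile k p c, _, emb, ex, none => .peek (some k) (fun _ a => a)
      (.branch p (.load (fun _ => none) (.goto fun _ => emb (some c.entry)))
        (.load (fun _ => none) (.goto fun _ => ex)))
  | repeatWhile _ _ c, _, emb, _, some l => c.code (fun l => emb (some l)) (emb none) l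

/-- `Exec c s o s' o' t`: run on the stacks `s` and the output `o`, the program `c` ends after
`t` steps with the stacks `s'` and the output `o'`. -/
inductive Exec [DecidableEq K] : Cmd K A B → (K → List A) → List B → (K → List A) → List B →
    ℕ → Prop
  | skip {s o} : Exec skip s o s o 1
  | push {k a s o} : Exec (push k a) s o (update s k (a :: s k)) o 1
  | pop {k s o} : Exec (pop k) s o (update s k (s k).tail) o 1
  | move {k k' s o a l} (h : s k = a :: l) :
      Exec (move k k') s o (update (update s k l) k' (a :: update s k l k')) o 1
  | emit {b s o} : Exec (emit b) s o s (b :: o) 1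
  | seq {c d s o s' o' s'' o'' t t'} : Exec c s o s' o' t → Exec d s' o' s'' o'' t' →
      Exec (seq c d) s o s'' o'' (t + t')
  | ite_true {k p c d s o s' o' t} : p (s k).head? = true → Exec c s o s' o' t →
      Exec (ite k p c d) s o s' o' (1 + t)
  | ite_false {k p c d s o s' o' t} : p (s k).head? = false → Exec d s o s' o' t →
      Exec (ite k p c d) s o s' o' (1 + t)
  | while_done {k p c s o} : p (s k).head? = false → Exec (repeatWhile k p c) s o s o 1
  | while_step {k p c s o s' o' s'' o'' t t'} : p (s k).head? = true → Exec c s o s' o' t →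
      Exec (repeatWhile k p c) s' o' s'' o'' t' →
      Exec (repeatWhile k p c) s o s'' o'' (1 + (t + t'))

/-- The contents of all stacks of the compiled machine. -/
def contents (s : K → List A) (o : List B) : ∀ k, List (Alph K A B k)
  | none => o
  | some k => s k

variable [DecidableEq K]

theorem update_contents_some (s : K → List A) (o : List B) (k : K) (l : List A) :
    update (contents s o) (some k) l = contents (update s k l) o := by
  funext j
  rcases j with _ | j
  · simp [contents]
  · by_cases h : j = k
    · subst h; simp [contents]
    · simp [contents, h]

theorem update_contents_none (s : K → List A) (o o' : List B) :
    update (contents s o) none o' = contents s o' := by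
  funext j
  rcases j with _ | j <;> simp [contents]

/-- A compiled fragment does what its program says. -/
theorem Exec.reaches [Inhabited A] {c : Cmd K A B} {s s' : K → List A} {o o' : List B} {t : ℕ}
    (h : Exec c s o s' o' t) {Λ : Type} (M : Λ → TM2.Stmt (Alph K A B) Λ (Option A))
    (emb : c.Label → Λ) (ex : Λ) (hM : ∀ l, M (emb l) = c.code emb ex l) :
    (flip bind (TM2.step M))^[t] (some ⟨some (emb c.entry), none, contents s o⟩) =
      some ⟨some ex, none, contents s' o'⟩ := by
  have one : ∀ (l : Λ) (S), (flip bind (TM2.step M))^[1] (some ⟨some l, none, S⟩) =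
      some (TM2.stepAux (M l) none S) := fun l S => rfl
  induction h generalizing Λ with
  | skip => rw [one, hM]; rfl
  | push => rw [one, hM]; simp [code, ← update_contents_some]; rfl
  | pop => rw [one, hM]; simp [code, ← update_contents_some]; rfl
  | @move k k' s o a l h =>
    rw [one, hM]
    have h' : contents s o (some k) = a :: l := h
    simp only [code, TM2.stepAux, h', List.head?_cons, List.tail_cons, update_contents_some,
      Option.getD_some]
    rfl
  | emit => rw [one, hM]; simp [code, update_contents_none]; rfl
  | seq _ _ ih1 ih2 =>
    rw [add_comm, iterate_add_apply]
    have h1 := ih1 M (fun l => emb (Sum.inl l)) (emb (Sum.inr (entry _))) (fun l => hM (Sum.inl l))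
      one
    have h2 := ih2 M (fun l => emb (Sum.inr l)) ex (fun l => hM (Sum.inr l)) one
    rw [entry, h1, h2]
  | @ite_true k p c d s o s' o' t h _ ih =>
    rw [add_comm, iterate_add_apply, one, hM]
    have h' : p (contents s o (some k)).head? = true := h
    simp only [code, entry, TM2.stepAux, h', cond_true]
    exact ih M (fun l => emb (some (Sum.inl l))) ex (fun l => hM (some (Sum.inl l))) one
  | @ite_false k p c d s o s' o' t h _ ih =>
    rw [add_comm, iterate_add_apply, one, hM]
    have h' : p (contents s o (some k)).head? = false := h
    simp only [code, entry, TM2.stepAux, h', cond_false]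
    exact ih M (fun l => emb (some (Sum.inr l))) ex (fun l => hM (some (Sum.inr l))) one
  | @while_done k p c s o h =>
    rw [one, hM]
    have h' : p (contents s o (some k)).head? = false := h
    simp only [code, entry, TM2.stepAux, h', cond_false]
  | @while_step k p c s o s' o' s'' o'' t t' h _ _ ih1 ih2 =>
    rw [add_comm, iterate_add_apply, one, hM]
    have h' : p (contents s o (some k)).head? = true := h
    simp only [code, entry, TM2.stepAux, h', cond_true]
    rw [add_comm, iterate_add_apply]
    have h1 := ih1 M (fun l => emb (some l)) (emb none) (fun l => hM (some l)) one
    have h2 := ih2 M emb ex hM one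
    rw [h1]
    exact h2

/-- The machine executing `c`, with input stack `k₀`. -/
def machine [Inhabited A] [Fintype A] [Fintype K] (c : Cmd K A B) (k₀ : K) : FinTM2 where
  K := Option K
  k₀ := some k₀
  k₁ := none
  Γ := Alph K A B
  Λ := Option c.Label
  main := some c.entry
  σ := Option A
  initialState := none
  Γk₀Fin := inferInstanceAs (Fintype A)
  m l := match l with
    | some l => c.code some none l
    | none => .halt

/-- The machine executing `c`, with its alphabets. -/
def computer [Inhabited A] [Fintype A] [Fintype K] (c : Cmd K A B) (k₀ : K) :
    TM2ComputableAux A B where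
  tm := c.machine k₀
  inputAlphabet := Equiv.refl A
  outputAlphabet := Equiv.refl B

/-- A halting configuration in the sense of `haltList` has nothing but the output on its stacks,
which is why the run must end with all stacks `[]`. -/
theorem Exec.outputsInTime [Inhabited A] [Fintype A] [Fintype K] {c : Cmd K A B} {k₀ : K}
    {w : List A} {o : List B} {t n : ℕ}
    (h : Exec c (update (fun _ => []) k₀ w) [] (fun _ => []) o t) (hn : t + 1 ≤ n) :
    Nonempty (TM2OutputsInTime (c.machine k₀) w (some o) n) := by
  -- The additional step executes the halt statement at the exit label.
  refine ⟨⟨⟨t + 1, ?_⟩, hn⟩⟩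
  have hr := h.reaches (c.machine k₀).m some none (fun l => rfl)
  have hinit : initList (c.machine k₀) w =
      ⟨some (some c.entry), none, contents (update (fun _ => []) k₀ w) []⟩ := by
    unfold initList
    congr 1
    funext j
    rcases j with _ | j
    · rfl
    · by_cases hj : j = k₀
      · subst hj
        have : (some j : Option K) = (c.machine j).k₀ := rfl
        refine (dif_pos this).trans ?_
        simp [contents]
        rfl
      · have : ¬ (some j : Option K) = (c.machine k₀).k₀ := fun e => hj (Option.some.inj e)
        refine (dif_neg this).trans ?_
        simp [contents, hj]
        rfl
  have hhalt : haltList (c.machine k₀) o = ⟨none, none, contents (fun _ => []) o⟩ := by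
    unfold haltList
    congr 1
    funext j
    rcases j with _ | j
    · rfl
    · rfl
  refine (congrArg (fun x => (flip bind (c.machine k₀).step)^[t + 1] (some x)) hinit).trans ?_
  refine Eq.trans ?_ (congrArg some hhalt).symm
  rw [add_comm, iterate_add_apply]
  refine Eq.trans (congrArg _ hr) ?_
  rfl

end Cmd

end StackProg

/-! ### Arithmetic expressions evaluated by stack programs -/

namespace StackProg

open Turing Function

/-- The common alphabet of all stacks but the output. -/
abbrev Sym := Bool ⊕ Option Bool

/-- The unit of unary numbers. -/
abbrev one : Sym := Sum.inl true

/-- The separator of unary numbers. -/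
abbrev sep : Sym := Sum.inl false

/-- The unary expansion of a number. -/
abbrev ones (n : ℕ) : List Sym := List.replicate n one

/-- The test whether a symbol is a unit. -/
def isOne (a : Option Sym) : Bool := decide (a = some one)

/-- The contents of the memory: unary registers, an evaluation stack, a scratch stack, the input,
a scratch stack for the input, and the output. -/
structure Mem (V B : Type) where
  env : V → ℕ
  ev : List Sym
  tmp : List Sym
  inp : List Sym
  aux : List Sym
  out : List B

variable {V B : Type}

/-- The stacks that hold the memory. -/
def Mem.lay (m : Mem V B) : V ⊕ Fin 4 → List Sym :=
  Sum.elim (fun x => ones (m.env x)) ![m.ev, m.tmp, m.inp, m.aux]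

/-- Stack programs with registers named by `V`. -/
abbrev Code (V B : Type) := Cmd (V ⊕ Fin 4) Sym B

@[simp] theorem lay_reg (m : Mem V B) (x : V) : m.lay (Sum.inl x) = ones (m.env x) := rfl
@[simp] theorem lay_ev (m : Mem V B) : m.lay (Sum.inr 0) = m.ev := rfl
@[simp] theorem lay_tmp (m : Mem V B) : m.lay (Sum.inr 1) = m.tmp := rfl
@[simp] theorem lay_inp (m : Mem V B) : m.lay (Sum.inr 2) = m.inp := rfl
@[simp] theorem lay_aux (m : Mem V B) : m.lay (Sum.inr 3) = m.aux := rfl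

/-! ### Memory layout and time bounds for stack programs -/

section

variable [DecidableEq V]

theorem update_lay_reg (m : Mem V B) (x : V) (n : ℕ) :
    update m.lay (Sum.inl x) (ones n) = Mem.lay { m with env := update m.env x n } := by
  funext k
  rcases k with y | i
  · by_cases h : y = x
    · subst h; simp [Mem.lay]
    · simp [Mem.lay, h]
  · simp [Mem.lay]

theorem update_lay_ev (m : Mem V B) (l : List Sym) :
    update m.lay (Sum.inr 0) l = Mem.lay { m with ev := l } := by
  funext k
  rcases k with y | i
  · simp [Mem.lay]
  · fin_cases i <;> simp [Mem.lay]

theorem update_lay_tmp (m : Mem V B) (l : List Sym) :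
    update m.lay (Sum.inr 1) l = Mem.lay { m with tmp := l } := by
  funext k
  rcases k with y | i
  · simp [Mem.lay]
  · fin_cases i <;> simp [Mem.lay]

theorem update_lay_inp (m : Mem V B) (l : List Sym) :
    update m.lay (Sum.inr 2) l = Mem.lay { m with inp := l } := by
  funext k
  rcases k with y | i
  · simp [Mem.lay]
  · fin_cases i <;> simp [Mem.lay]

theorem update_lay_aux (m : Mem V B) (l : List Sym) :
    update m.lay (Sum.inr 3) l = Mem.lay { m with aux := l } := by
  funext k
  rcases k with y | i
  · simp [Mem.lay]
  · fin_cases i <;> simp [Mem.lay]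

/-- `c` leads from the memory `m` to the memory `m'` in at most `T` steps. -/
def Runs (c : Code V B) (m m' : Mem V B) (T : ℕ) : Prop :=
  ∃ t ≤ T, Cmd.Exec c m.lay m.out m'.lay m'.out t

namespace Runs

variable {c d : Code V B} {m m' m'' : Mem V B} {T T' : ℕ}

theorem mono (h : Runs c m m' T) (hT : T ≤ T') : Runs c m m' T' :=
  let ⟨t, ht, hx⟩ := h
  ⟨t, ht.trans hT, hx⟩

theorem weaken (h : Runs c m m' T) (hm : m' = m'') (hT : T ≤ T') : Runs c m m'' T' :=
  hm ▸ h.mono hT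

theorem seq (h : Runs c m m' T) (h' : Runs d m' m'' T') : Runs (.seq c d) m m'' (T + T') :=
  let ⟨t, ht, hx⟩ := h
  let ⟨t', ht', hx'⟩ := h'
  ⟨t + t', Nat.add_le_add ht ht', .seq hx hx'⟩

theorem skip : Runs (.skip : Code V B) m m 1 := ⟨1, le_rfl, .skip⟩

theorem emit (b : B) : Runs (.emit b) m { m with out := b :: m.out } 1 := ⟨1, le_rfl, .emit⟩

theorem ite_true {k p} (hp : p (m.lay k).head? = true) (h : Runs c m m' T) :
    Runs (.ite k p c d) m m' (1 + T) :=
  let ⟨t, ht, hx⟩ := h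
  ⟨1 + t, Nat.add_le_add_left ht 1, .ite_true hp hx⟩

theorem ite_false {k p} (hp : p (m.lay k).head? = false) (h : Runs d m m' T) :
    Runs (.ite k p c d) m m' (1 + T) :=
  let ⟨t, ht, hx⟩ := h
  ⟨1 + t, Nat.add_le_add_left ht 1, .ite_false hp hx⟩

theorem while_done {k p} (hp : p (m.lay k).head? = false) : Runs (.repeatWhile k p c) m m 1 :=
  ⟨1, le_rfl, .while_done hp⟩

theorem while_step {k p} (hp : p (m.lay k).head? = true) (h : Runs c m m' T)
    (h' : Runs (.repeatWhile k p c) m' m'' T') :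
    Runs (.repeatWhile k p c) m m'' (1 + (T + T')) :=
  let ⟨t, ht, hx⟩ := h
  let ⟨t', ht', hx'⟩ := h'
  ⟨1 + (t + t'), by omega, .while_step hp hx hx'⟩

theorem push {k a} (h : m'.lay = update m.lay k (a :: m.lay k)) (ho : m'.out = m.out) :
    Runs (.push k a) m m' 1 :=
  ⟨1, le_rfl, by rw [h, ho]; exact .push⟩

theorem pop {k} (h : m'.lay = update m.lay k (m.lay k).tail) (ho : m'.out = m.out) :
    Runs (.pop k) m m' 1 :=
  ⟨1, le_rfl, by rw [h, ho]; exact .pop⟩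

theorem move {k k' a l} (hk : m.lay k = a :: l)
    (h : m'.lay = update (update m.lay k l) k' (a :: update m.lay k l k')) (ho : m'.out = m.out) :
    Runs (.move k k') m m' 1 :=
  ⟨1, le_rfl, by rw [h, ho]; exact .move hk⟩

end Runs

end

theorem isOne_ones_succ (n : ℕ) (l : List Sym) : isOne (ones (n + 1) ++ l).head? = true := by
  simp [isOne, List.replicate_succ]

theorem isOne_sep (l : List Sym) : isOne (sep :: l).head? = false := by
  simp [isOne]

theorem isOne_nil : isOne ([] : List Sym).head? = false := by
  simp [isOne]

/-! ### Unary arithmetic on the evaluation stack -/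

section

variable [DecidableEq V]

theorem pop_ev (env : V → ℕ) (a : Sym) (l r i j : List Sym) (o : List B) :
    Runs (.pop (Sum.inr 0)) ⟨env, a :: l, r, i, j, o⟩ ⟨env, l, r, i, j, o⟩ 1 :=
  .pop (by rw [update_lay_ev]; rfl) rfl

theorem push_ev (env : V → ℕ) (a : Sym) (l r i j : List Sym) (o : List B) :
    Runs (.push (Sum.inr 0) a) ⟨env, l, r, i, j, o⟩ ⟨env, a :: l, r, i, j, o⟩ 1 :=
  .push (by rw [update_lay_ev]; rfl) rfl

theorem pop_reg (env : V → ℕ) (x : V) (n : ℕ) (l r i j : List Sym) (o : List B) :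
    Runs (.pop (Sum.inl x)) ⟨update env x (n + 1), l, r, i, j, o⟩
      ⟨update env x n, l, r, i, j, o⟩ 1 := by
  refine .pop ?_ rfl
  simp only [lay_reg, update_self, List.tail_replicate]
  rw [update_lay_reg]
  simp

/-- Moves the number on top of the evaluation stack to the scratch stack. -/
def evToTmp : Code V B := .repeatWhile (Sum.inr 0) isOne (.move (Sum.inr 0) (Sum.inr 1))

theorem evToTmp_runs (env : V → ℕ) (n k : ℕ) (l i j : List Sym) (o : List B)
    (hl : isOne l.head? = false) :
    Runs evToTmp ⟨env, ones n ++ l, ones k, i, j, o⟩ ⟨env, l, ones (k + n), i, j, o⟩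
      (2 * n + 1) := by
  induction n generalizing k with
  | zero => exact Runs.while_done hl
  | succ n ih =>
    have h1 : Runs (.move (Sum.inr 0) (Sum.inr 1)) (⟨env, ones (n + 1) ++ l, ones k, i, j, o⟩ :
        Mem V B) ⟨env, ones n ++ l, ones (k + 1), i, j, o⟩ 1 := by
      refine .move (a := one) (l := ones n ++ l) rfl ?_ rfl
      rw [update_lay_ev, update_lay_tmp]
      rfl
    refine Runs.weaken (Runs.while_step (isOne_ones_succ n l) h1 (ih (k + 1))) ?_ (by omega)
    rw [show k + 1 + n = k + (n + 1) by omega]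

/-- Moves the number on the scratch stack to the evaluation stack. -/
def tmpToEv : Code V B := .repeatWhile (Sum.inr 1) isOne (.move (Sum.inr 1) (Sum.inr 0))

theorem tmpToEv_runs (env : V → ℕ) (n k : ℕ) (l i j : List Sym) (o : List B) :
    Runs tmpToEv ⟨env, ones k ++ l, ones n, i, j, o⟩ ⟨env, ones (k + n) ++ l, [], i, j, o⟩
      (2 * n + 1) := by
  induction n generalizing k with
  | zero => exact Runs.while_done isOne_nil
  | succ n ih =>
    have h1 : Runs (.move (Sum.inr 1) (Sum.inr 0)) (⟨env, ones k ++ l, ones (n + 1), i, j, o⟩ :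
        Mem V B) ⟨env, ones (k + 1) ++ l, ones n, i, j, o⟩ 1 := by
      refine .move (a := one) (l := ones n) rfl ?_ rfl
      rw [update_lay_tmp, update_lay_ev]
      rfl
    refine Runs.weaken (Runs.while_step ?_ h1 (ih (k + 1))) ?_ (by omega)
    · simpa using isOne_ones_succ n []
    · rw [show k + 1 + n = k + (n + 1) by omega]

/-- Moves the number on top of the evaluation stack to a register. -/
def evToReg (x : V) : Code V B := .repeatWhile (Sum.inr 0) isOne (.move (Sum.inr 0) (Sum.inl x))

theorem evToReg_runs (env : V → ℕ) (x : V) (n k : ℕ) (l r i j : List Sym) (o : List B)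
    (hl : isOne l.head? = false) :
    Runs (evToReg x) ⟨update env x k, ones n ++ l, r, i, j, o⟩
      ⟨update env x (k + n), l, r, i, j, o⟩ (2 * n + 1) := by
  induction n generalizing k with
  | zero => exact Runs.while_done hl
  | succ n ih =>
    have h1 : Runs (.move (Sum.inr 0) (Sum.inl x)) (⟨update env x k, ones (n + 1) ++ l, r, i, j, o⟩ :
        Mem V B) ⟨update env x (k + 1), ones n ++ l, r, i, j, o⟩ 1 := by
      refine .move (a := one) (l := ones n ++ l) rfl ?_ rfl
      rw [update_lay_ev]
      simp only [lay_reg, update_self]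
      refine Eq.symm (Eq.trans (update_lay_reg _ x (k + 1)) ?_)
      simp
    refine Runs.weaken (Runs.while_step (isOne_ones_succ n l) h1 (ih (k + 1))) ?_ (by omega)
    rw [show k + 1 + n = k + (n + 1) by omega]

/-- Moves the contents of a register to the evaluation stack. -/
def regToEv (x : V) : Code V B := .repeatWhile (Sum.inl x) isOne (.move (Sum.inl x) (Sum.inr 0))

theorem regToEv_runs (env : V → ℕ) (x : V) (n k : ℕ) (l r i j : List Sym) (o : List B) :
    Runs (regToEv x) ⟨update env x n, ones k ++ l, r, i, j, o⟩
      ⟨update env x 0, ones (k + n) ++ l, r, i, j, o⟩ (2 * n + 1) := by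
  induction n generalizing k with
  | zero => exact Runs.while_done (by simp [isOne])
  | succ n ih =>
    have h1 : Runs (.move (Sum.inl x) (Sum.inr 0)) (⟨update env x (n + 1), ones k ++ l, r, i, j, o⟩ :
        Mem V B) ⟨update env x n, ones (k + 1) ++ l, r, i, j, o⟩ 1 := by
      refine .move (a := one) (l := ones n) (by simp; rfl) ?_ rfl
      rw [update_lay_reg]
      simp only [lay_ev]
      rw [update_lay_ev]
      simp
      rfl
    refine Runs.weaken (Runs.while_step ?_ h1 (ih (k + 1))) ?_ (by omega)
    · simpa using isOne_ones_succ n []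
    · rw [show k + 1 + n = k + (n + 1) by omega]

/-- Moves the number on the scratch stack to a register. -/
def tmpToReg (x : V) : Code V B := .repeatWhile (Sum.inr 1) isOne (.move (Sum.inr 1) (Sum.inl x))

theorem tmpToReg_runs (env : V → ℕ) (x : V) (n k : ℕ) (l i j : List Sym) (o : List B) :
    Runs (tmpToReg x) ⟨update env x k, l, ones n, i, j, o⟩
      ⟨update env x (k + n), l, [], i, j, o⟩ (2 * n + 1) := by
  induction n generalizing k with
  | zero => exact Runs.while_done isOne_nil
  | succ n ih =>
    have h1 : Runs (.move (Sum.inr 1) (Sum.inl x)) (⟨update env x k, l, ones (n + 1), i, j, o⟩ :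
        Mem V B) ⟨update env x (k + 1), l, ones n, i, j, o⟩ 1 := by
      refine .move (a := one) (l := ones n) rfl ?_ rfl
      rw [update_lay_tmp]
      simp only [lay_reg, update_self]
      refine Eq.symm (Eq.trans (update_lay_reg _ x (k + 1)) ?_)
      simp
    refine Runs.weaken (Runs.while_step ?_ h1 (ih (k + 1))) ?_ (by omega)
    · simpa using isOne_ones_succ n []
    · rw [show k + 1 + n = k + (n + 1) by omega]

/-- Empties the scratch stack onto a register and the evaluation stack. -/
def tmpToBoth (x : V) : Code V B := .repeatWhile (Sum.inr 1) isOne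
  (.seq (.move (Sum.inr 1) (Sum.inr 0)) (.push (Sum.inl x) one))

theorem tmpToBoth_runs (env : V → ℕ) (x : V) (n k k' : ℕ) (l i j : List Sym) (o : List B) :
    Runs (tmpToBoth x) ⟨update env x k, ones k' ++ l, ones n, i, j, o⟩
      ⟨update env x (k + n), ones (k' + n) ++ l, [], i, j, o⟩ (3 * n + 1) := by
  induction n generalizing k k' with
  | zero => exact Runs.while_done isOne_nil
  | succ n ih =>
    have h1 : Runs (.move (Sum.inr 1) (Sum.inr 0)) (⟨update env x k, ones k' ++ l, ones (n + 1), i, j,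
        o⟩ : Mem V B) ⟨update env x k, ones (k' + 1) ++ l, ones n, i, j, o⟩ 1 := by
      refine .move (a := one) (l := ones n) rfl ?_ rfl
      rw [update_lay_tmp, update_lay_ev]
      rfl
    have h2 : Runs (.push (Sum.inl x) one) (⟨update env x k, ones (k' + 1) ++ l, ones n, i, j,
        o⟩ : Mem V B) ⟨update env x (k + 1), ones (k' + 1) ++ l, ones n, i, j, o⟩ 1 := by
      refine .push ?_ rfl
      simp only [lay_reg, update_self]
      refine Eq.symm (Eq.trans (update_lay_reg _ x (k + 1)) ?_)
      simp
    refine Runs.weaken (Runs.while_step ?_ (h1.seq h2) (ih (k + 1) (k' + 1))) ?_ (by omega)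
    · simpa using isOne_ones_succ n []
    · rw [show k + 1 + n = k + (n + 1) by omega, show k' + 1 + n = k' + (n + 1) by omega]

/-- Empties a register. -/
def clearReg (x : V) : Code V B := .repeatWhile (Sum.inl x) isOne (.pop (Sum.inl x))

theorem clearReg_runs (env : V → ℕ) (x : V) (n : ℕ) (l r i j : List Sym) (o : List B) :
    Runs (clearReg x) ⟨update env x n, l, r, i, j, o⟩ ⟨update env x 0, l, r, i, j, o⟩
      (2 * n + 1) := by
  induction n with
  | zero => exact Runs.while_done (by simp [isOne])
  | succ n ih =>
    refine (Runs.while_step ?_ (pop_reg env x n l r i j o) ih).mono (by omega)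
    simpa using isOne_ones_succ n []

/-- Removes the number on top of the evaluation stack. -/
def clearEv : Code V B := .seq (.repeatWhile (Sum.inr 0) isOne (.pop (Sum.inr 0))) (.pop (Sum.inr 0))

theorem clearEv_runs (env : V → ℕ) (n : ℕ) (l r i j : List Sym) (o : List B) :
    Runs clearEv ⟨env, ones n ++ sep :: l, r, i, j, o⟩ ⟨env, l, r, i, j, o⟩ (2 * n + 2) := by
  have : Runs (.repeatWhile (Sum.inr 0) isOne (.pop (Sum.inr 0)))
      (⟨env, ones n ++ sep :: l, r, i, j, o⟩ : Mem V B) ⟨env, sep :: l, r, i, j, o⟩ (2 * n + 1) := by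
    induction n with
    | zero => exact Runs.while_done (isOne_sep l)
    | succ n ih =>
      exact (Runs.while_step (isOne_ones_succ n _) (pop_ev env one _ r i j o) ih).mono (by omega)
  exact this.seq (pop_ev env sep l r i j o)

/-- Adds the number on top of the evaluation stack to the one below. -/
def addTop : Code V B := .seq evToTmp (.seq (.pop (Sum.inr 0)) tmpToEv)

theorem addTop_runs (env : V → ℕ) (n k : ℕ) (l i j : List Sym) (o : List B) :
    Runs addTop ⟨env, ones n ++ sep :: (ones k ++ l), [], i, j, o⟩
      ⟨env, ones (k + n) ++ l, [], i, j, o⟩ (4 * n + 3) := by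
  have h1 := evToTmp_runs env n 0 (sep :: (ones k ++ l)) i j o (isOne_sep _)
  rw [zero_add] at h1
  exact (h1.seq ((pop_ev env sep _ _ i j o).seq (tmpToEv_runs env n k l i j o))).mono (by omega)

/-- Subtracts the number on top of the evaluation stack from the one below. -/
def subTop : Code V B := .seq evToTmp (.seq (.pop (Sum.inr 0))
  (.repeatWhile (Sum.inr 1) isOne
    (.seq (.pop (Sum.inr 1)) (.ite (Sum.inr 0) isOne (.pop (Sum.inr 0)) .skip))))

theorem subTop_runs (env : V → ℕ) (n k : ℕ) (l i j : List Sym) (o : List B) :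
    Runs subTop ⟨env, ones n ++ sep :: (ones k ++ sep :: l), [], i, j, o⟩
      ⟨env, ones (k - n) ++ sep :: l, [], i, j, o⟩ (6 * n + 3) := by
  have h1 := evToTmp_runs env n 0 (sep :: (ones k ++ sep :: l)) i j o (isOne_sep _)
  rw [zero_add] at h1
  have h2 : Runs (.repeatWhile (Sum.inr 1) isOne
      (.seq (.pop (Sum.inr 1)) (.ite (Sum.inr 0) isOne (.pop (Sum.inr 0)) .skip)))
      (⟨env, ones k ++ sep :: l, ones n, i, j, o⟩ : Mem V B)
      ⟨env, ones (k - n) ++ sep :: l, [], i, j, o⟩ (4 * n + 1) := by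
    clear h1
    induction n generalizing k with
    | zero => exact Runs.while_done isOne_nil
    | succ n ih =>
      have h1 : Runs (.pop (Sum.inr 1)) (⟨env, ones k ++ sep :: l, ones (n + 1), i, j, o⟩ : Mem V B)
          ⟨env, ones k ++ sep :: l, ones n, i, j, o⟩ 1 :=
        .pop (by rw [update_lay_tmp]; rfl) rfl
      have hp : isOne (ones (n + 1)).head? = true := by simpa using isOne_ones_succ n []
      -- An exhausted minuend stays empty while the subtrahend is consumed: this is truncated
      -- subtraction.
      rcases k with _ | k
      · refine Runs.weaken (Runs.while_step hp (h1.seq (Runs.ite_false (isOne_sep l) Runs.skip))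
          (ih 0)) ?_ (by omega)
        simp
      · refine Runs.weaken (Runs.while_step hp (h1.seq (Runs.ite_true (isOne_ones_succ k _)
          (pop_ev env one _ _ i j o))) (ih k)) ?_ (by omega)
        rw [show k + 1 - (n + 1) = k - n by omega]
  exact (h1.seq ((pop_ev env sep _ _ i j o).seq h2)).mono (by omega)

/-- Pushes a number to the evaluation stack. -/
def pushConst : ℕ → Code V B
  | 0 => .push (Sum.inr 0) sep
  | n + 1 => .seq (pushConst n) (.push (Sum.inr 0) one)

theorem pushConst_runs (env : V → ℕ) (n : ℕ) (l r i j : List Sym) (o : List B) :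
    Runs (pushConst n) ⟨env, l, r, i, j, o⟩ ⟨env, ones n ++ sep :: l, r, i, j, o⟩ (n + 1) := by
  induction n with
  | zero => exact push_ev env sep l r i j o
  | succ n ih => exact ih.seq (push_ev env one _ r i j o)

/-- Copies a register to the evaluation stack. -/
def pushReg (x : V) : Code V B :=
  .seq (.push (Sum.inr 0) sep) (.seq (regToEv x) (.seq evToTmp (tmpToBoth x)))

theorem pushReg_runs (env : V → ℕ) (x : V) (l i j : List Sym) (o : List B) :
    Runs (pushReg x) ⟨env, l, [], i, j, o⟩ ⟨env, ones (env x) ++ sep :: l, [], i, j, o⟩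
      (7 * env x + 4) := by
  have h1 := regToEv_runs env x (env x) 0 (sep :: l) [] i j o
  have h2 := evToTmp_runs (update env x 0) (0 + env x) 0 (sep :: l) i j o (isOne_sep _)
  have h3 := tmpToBoth_runs env x (env x) 0 0 (sep :: l) i j o
  simp only [zero_add, update_eq_self] at h1 h2 h3
  exact ((push_ev env sep l [] i j o).seq (h1.seq (h2.seq h3))).mono (by omega)

end

/-- Moves the rest of the input to the right place again. -/
def auxToInp : Code V B :=
  .repeatWhile (Sum.inr 3) Option.isSome (.move (Sum.inr 3) (Sum.inr 2))

/-- Skips as many symbols of the input as the number on top of the evaluation stack says. -/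
def skipInp : Code V B := .repeatWhile (Sum.inr 0) isOne
  (.seq (.pop (Sum.inr 0)) (.ite (Sum.inr 2) Option.isSome (.move (Sum.inr 2) (Sum.inr 3)) .skip))

/-- Adds the length of the input to the number on top of the evaluation stack. -/
def countInp : Code V B := .repeatWhile (Sum.inr 2) Option.isSome
  (.seq (.move (Sum.inr 2) (Sum.inr 3)) (.push (Sum.inr 0) one))

section

variable [DecidableEq V]

theorem move_inp (env : V → ℕ) (a : Sym) (l r i j : List Sym) (o : List B) :
    Runs (.move (Sum.inr 2) (Sum.inr 3)) ⟨env, l, r, a :: i, j, o⟩ ⟨env, l, r, i, a :: j, o⟩ 1 := by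
  refine .move (a := a) (l := i) rfl ?_ rfl
  rw [update_lay_inp, update_lay_aux]
  rfl

theorem auxToInp_runs (env : V → ℕ) (l r i j : List Sym) (o : List B) :
    Runs auxToInp ⟨env, l, r, i, j, o⟩ ⟨env, l, r, j.reverse ++ i, [], o⟩ (2 * j.length + 1) := by
  induction j generalizing i with
  | nil => exact Runs.while_done rfl
  | cons a j ih =>
    have h1 : Runs (.move (Sum.inr 3) (Sum.inr 2)) (⟨env, l, r, i, a :: j, o⟩ : Mem V B)
        ⟨env, l, r, a :: i, j, o⟩ 1 := by
      refine .move (a := a) (l := j) rfl ?_ rfl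
      rw [update_lay_aux, update_lay_inp]
      rfl
    refine Runs.weaken (Runs.while_step rfl h1 (ih (a :: i))) ?_ (by simp; omega)
    simp

theorem skipInp_runs (env : V → ℕ) (n : ℕ) (l r i j : List Sym) (o : List B)
    (hl : isOne l.head? = false) :
    Runs skipInp ⟨env, ones n ++ l, r, i, j, o⟩
      ⟨env, l, r, i.drop n, (i.take n).reverse ++ j, o⟩ (4 * n + 1) := by
  induction n generalizing i j with
  | zero => exact Runs.while_done hl
  | succ n ih =>
    have h1 := pop_ev env one (ones n ++ l) r i j o
    rcases i with _ | ⟨a, i⟩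
    · refine Runs.weaken (Runs.while_step (isOne_ones_succ n l) (h1.seq (Runs.ite_false rfl Runs.skip))
        (ih [] j)) ?_ (by omega)
      simp
    · refine Runs.weaken (Runs.while_step (isOne_ones_succ n l) (h1.seq (Runs.ite_true rfl
        (move_inp env a _ r i j o))) (ih i (a :: j))) ?_ (by omega)
      simp

theorem countInp_runs (env : V → ℕ) (n : ℕ) (l r i j : List Sym) (o : List B) :
    Runs countInp ⟨env, ones n ++ l, r, i, j, o⟩
      ⟨env, ones (n + i.length) ++ l, r, [], i.reverse ++ j, o⟩ (3 * i.length + 1) := by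
  induction i generalizing n j with
  | nil => exact Runs.while_done rfl
  | cons a i ih =>
    refine Runs.weaken (Runs.while_step rfl ((move_inp env a _ r i j o).seq (push_ev env one _ r i (a :: j) o))
      (ih (n + 1) (a :: j))) ?_ (by simp; omega)
    simp [Nat.add_assoc, Nat.add_comm 1]

end

end StackProg

/-! ### Expressions with bounded sums: semantics, compilation, polynomial bounds -/

namespace StackProg

open Turing Function

variable {V B : Type}

/-- Arithmetic expressions: `inp p e` is the truth value of `p` at the `e`-th symbol of the input,
`len` is the length of the input, and `sum x e f` is the sum of `f` over all `x < e`. -/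
inductive Exp (V : Type) : Type
  | const (n : ℕ) : Exp V
  | var (x : V) : Exp V
  | add (e f : Exp V) : Exp V
  | sub (e f : Exp V) : Exp V
  | inp (p : Sym → Bool) (e : Exp V) : Exp V
  | len : Exp V
  | sum (x : V) (e f : Exp V) : Exp V

namespace Exp

section

variable [DecidableEq V]

/-- The value of an expression on the input `w`. -/
def eval (w : List Sym) : Exp V → (V → ℕ) → ℕ
  | const n, _ => n
  | var x, env => env x
  | add e f, env => e.eval w env + f.eval w env
  | sub e f, env => e.eval w env - f.eval w env
  | inp p e, env => if (w[e.eval w env]?).any p then 1 else 0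
  | len, _ => w.length
  | sum x e f, env => ∑ i ∈ Finset.range (e.eval w env), f.eval w (update env x i)

end

/-- The stack program that pushes the value of an expression to the evaluation stack. -/
def comp : Exp V → Code V B
  | const n => pushConst n
  | var x => pushReg x
  | add e f => .seq e.comp (.seq f.comp addTop)
  | sub e f => .seq e.comp (.seq f.comp subTop)
  | inp p e => .seq e.comp (.seq skipInp (.seq
      (.ite (Sum.inr 2) (fun a => a.any p) (.push (Sum.inr 0) one) .skip) auxToInp))
  | len => .seq (.push (Sum.inr 0) sep) (.seq countInp auxToInp)
  | sum x e f => .seq e.comp (.seq evToTmp (.seq (regToEv x) (.seq (tmpToReg x)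
      (.seq (.push (Sum.inr 0) sep)
      (.seq (.repeatWhile (Sum.inl x) isOne (.seq (.pop (Sum.inl x)) (.seq f.comp addTop)))
      (.seq evToTmp (.seq (.pop (Sum.inr 0)) (.seq (evToReg x) tmpToEv))))))))

variable [DecidableEq V]

/-- `e.comp` evaluates `e` within time `T`. -/
def Computes (B : Type) (w : List Sym) (e : Exp V) (env : V → ℕ) (T : ℕ) : Prop :=
  ∀ (l : List Sym) (o : List B), Runs (comp e) ⟨env, l, [], w, [], o⟩
    ⟨env, ones (e.eval w env) ++ sep :: l, [], w, [], o⟩ T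

variable {w : List Sym} {env : V → ℕ} {e f : Exp V} {T T' : ℕ}

theorem Computes.add (h : e.Computes B w env T) (h' : f.Computes B w env T') :
    (e.add f).Computes B w env (T + T' + (4 * f.eval w env + 3)) := fun l o =>
  ((h l o).seq ((h' _ o).seq (addTop_runs env _ _ _ w [] o))).mono (by omega)

theorem Computes.sub (h : e.Computes B w env T) (h' : f.Computes B w env T') :
    (e.sub f).Computes B w env (T + T' + (6 * f.eval w env + 3)) := fun l o =>
  ((h l o).seq ((h' _ o).seq (subTop_runs env _ _ _ w [] o))).mono (by omega)

/-- The symbols before the requested one are parked on the auxiliary stack and moved back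
afterwards, so the input survives. Beyond its end the stack is empty and the value is 0. -/
theorem Computes.inp {p : Sym → Bool} (h : e.Computes B w env T) :
    (e.inp p).Computes B w env (T + 6 * e.eval w env + 4) := fun l o => by
  set v := e.eval w env with hv
  have h2 := skipInp_runs env v (sep :: l) [] w [] o (isOne_sep _)
  have h4 := auxToInp_runs env (ones ((e.inp p).eval w env) ++ sep :: l) [] (w.drop v)
    ((w.take v).reverse ++ []) o
  have h3 : Runs (.ite (Sum.inr 2) (fun a => a.any p) (.push (Sum.inr 0) one) .skip)
      (⟨env, sep :: l, [], w.drop v, (w.take v).reverse ++ [], o⟩ : Mem V B)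
      ⟨env, ones ((e.inp p).eval w env) ++ sep :: l, [], w.drop v, (w.take v).reverse ++ [], o⟩
      2 := by
    have hd : (w.drop v).head? = w[v]? := List.head?_drop
    by_cases hp : (w[v]?).any p = true
    · refine Runs.weaken (Runs.ite_true (by simpa [hd] using hp) (push_ev env one _ _ _ _ o)) ?_
        le_rfl
      simp [eval, ← hv, hp]
    · refine Runs.weaken (Runs.ite_false (by simpa [hd] using hp) Runs.skip) ?_ le_rfl
      simp only [eval, ← hv, hp]
      simp
  refine Runs.weaken ((h l o).seq (h2.seq (h3.seq h4))) ?_ ?_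
  · simp
  · have : ((w.take v).reverse ++ []).length ≤ v := by simp
    omega

theorem Computes.len : (len : Exp V).Computes B w env (5 * w.length + 3) := fun l o => by
  have h1 := countInp_runs env 0 (sep :: l) [] w [] o
  have h2 := auxToInp_runs env (ones (0 + w.length) ++ sep :: l) [] [] (w.reverse ++ []) o
  refine Runs.weaken ((push_ev env sep l [] w [] o).seq (h1.seq h2)) ?_ ?_
  · simp [eval]
  · simp; omega

/-- The old value of the register `x` is saved on the evaluation stack below the accumulator and
restored at the end; the separator left by the bound `e` becomes that of the result. In between `x`
itself is the loop counter, which is sound because evaluating `f` leaves the registers unchanged. -/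
theorem Computes.sum {x : V} {N : ℕ} (h : e.Computes B w env T)
    (h' : ∀ i < e.eval w env, f.Computes B w (update env x i) T' ∧ f.eval w (update env x i) ≤ N) :
    (e.sum x f).Computes B w env
      (T + (4 * e.eval w env + 4 * env x + 11) + 4 * (e.sum x f).eval w env +
        e.eval w env * (T' + 4 * N + 5)) := fun l o => by
  have key : ∀ n ≤ e.eval w env, ∀ (acc : ℕ) (l : List Sym),
      Runs (.repeatWhile (Sum.inl x) isOne (.seq (.pop (Sum.inl x)) (.seq f.comp addTop)))
        (⟨update env x n, ones acc ++ sep :: l, [], w, [], o⟩ : Mem V B)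
        ⟨update env x 0, ones (acc + ∑ i ∈ Finset.range n, f.eval w (update env x i)) ++ sep :: l,
          [], w, [], o⟩ (n * (T' + 4 * N + 5) + 1) := by
    intro n
    induction n with
    | zero => intro _ acc l; exact (Runs.while_done (by simp [isOne])).mono (by omega)
    | succ n ih =>
      intro hn acc l
      obtain ⟨h1, h2⟩ := h' n (by omega)
      refine Runs.weaken (Runs.while_step (by simpa using isOne_ones_succ n [])
        ((pop_reg env x n _ [] w [] o).seq ((h1 _ o).seq (addTop_runs _ _ _ _ w [] o)))
        (ih (by omega) _ l)) ?_ ?_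
      · rw [Finset.sum_range_succ, add_assoc, add_comm (f.eval w (update env x n))]
      · have := Nat.add_one_mul n (T' + 4 * N + 5)
        omega
  set v := e.eval w env with hv
  have h1 := evToTmp_runs env v 0 (sep :: l) w [] o (isOne_sep _)
  have h2 := regToEv_runs env x (env x) 0 (sep :: l) (ones (0 + v)) w [] o
  have h3 := tmpToReg_runs env x (0 + v) 0 (ones (0 + env x) ++ sep :: l) w [] o
  have h4 := push_ev (update env x v) sep (ones (env x) ++ sep :: l) [] w [] o
  have h5 := key v le_rfl 0 (ones (env x) ++ sep :: l)
  have h6 := evToTmp_runs (update env x 0) ((e.sum x f).eval w env) 0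
    (sep :: (ones (env x) ++ sep :: l)) w [] o (isOne_sep _)
  have h7 := pop_ev (update env x 0) sep (ones (env x) ++ sep :: l)
    (ones ((e.sum x f).eval w env)) w [] o
  have h8 := evToReg_runs env x (env x) 0 (sep :: l) (ones ((e.sum x f).eval w env)) w [] o
    (isOne_sep _)
  have h9 := tmpToEv_runs env ((e.sum x f).eval w env) 0 (sep :: l) w [] o
  simp only [zero_add, update_eq_self, eval, ← hv] at h1 h2 h3 h5 h6 h7 h8 h9
  refine Runs.weaken ((h l o).seq (h1.seq (h2.seq (h3.seq (h4.seq (h5.seq (h6.seq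
    (h7.seq (h8.seq h9))))))))) rfl ?_
  simp only [eval, ← hv]
  omega

end Exp

theorem _root_.Polynomial.eval_nat_mono (p : Polynomial ℕ) : Monotone fun n => p.eval n := by
  intro a b h
  simp only [Polynomial.eval_eq_sum, Polynomial.sum]
  gcongr

variable [DecidableEq V]

/-- Expressions are evaluated in polynomial time, and their values are polynomially bounded. -/
theorem Exp.exists_polynomial (B : Type) (e : Exp V) : ∃ p : Polynomial ℕ,
    ∀ (w : List Sym) (M : ℕ) (env : V → ℕ), w.length ≤ M → (∀ x, env x ≤ M) →
      e.eval w env ≤ p.eval M ∧ e.Computes B w env (p.eval M) := by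
  have mono : ∀ {e : Exp V} {w env T T'}, e.Computes B w env T → T ≤ T' →
      e.Computes B w env T' := fun h hT l o => (h l o).mono hT
  induction e with
  | const n =>
    refine ⟨Polynomial.C (n + 1), fun w M env _ _ => ⟨?_, fun l o => ?_⟩⟩
    · simp [eval]
    · rw [Polynomial.eval_C]
      exact pushConst_runs env n l [] w [] o
  | var x =>
    refine ⟨7 * Polynomial.X + 4, fun w M env _ h => ⟨?_, fun l o => ?_⟩⟩
    · have := h x
      simp [eval]; omega
    · refine (pushReg_runs env x l w [] o).mono ?_
      have := h x
      simp; omega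
  | add e f ihe ihf =>
    obtain ⟨p, hp⟩ := ihe
    obtain ⟨q, hq⟩ := ihf
    refine ⟨p + 5 * q + 3, fun w M env hw h => ?_⟩
    obtain ⟨h1, h2⟩ := hp w M env hw h
    obtain ⟨h3, h4⟩ := hq w M env hw h
    refine ⟨?_, mono (h2.add h4) ?_⟩
    · simp [eval]; omega
    · simp; omega
  | sub e f ihe ihf =>
    obtain ⟨p, hp⟩ := ihe
    obtain ⟨q, hq⟩ := ihf
    refine ⟨p + 7 * q + 3, fun w M env hw h => ?_⟩
    obtain ⟨h1, h2⟩ := hp w M env hw h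
    obtain ⟨h3, h4⟩ := hq w M env hw h
    refine ⟨?_, mono (h2.sub h4) ?_⟩
    · simp [eval]; omega
    · simp; omega
  | inp s e ihe =>
    obtain ⟨p, hp⟩ := ihe
    refine ⟨7 * p + 4, fun w M env hw h => ?_⟩
    obtain ⟨h1, h2⟩ := hp w M env hw h
    refine ⟨?_, mono h2.inp ?_⟩
    · simp only [eval]; simp; split_ifs <;> omega
    · simp; omega
  | len =>
    refine ⟨5 * Polynomial.X + 3, fun w M env hw _ => ⟨?_, mono .len ?_⟩⟩
    · simp [eval]; omega
    · simp; omega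
  | sum x e f ihe ihf =>
    obtain ⟨p, hp⟩ := ihe
    obtain ⟨q, hq⟩ := ihf
    -- The summation variable takes values up to the bound of the sum, so `f` is evaluated with
    -- registers bounded by `M + p.eval M`, whence the composition.
    refine ⟨p + (4 * p + 4 * Polynomial.X + 11) + 4 * (p * q.comp (Polynomial.X + p)) +
      p * (5 * q.comp (Polynomial.X + p) + 5), fun w M env hw h => ?_⟩
    obtain ⟨h1, h2⟩ := hp w M env hw h
    have h3 : ∀ i < e.eval w env, f.eval w (update env x i) ≤ q.eval (M + p.eval M) ∧
        f.Computes B w (update env x i) (q.eval (M + p.eval M)) := by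
      intro i hi
      refine hq w _ _ (by omega) fun y => ?_
      by_cases hy : y = x
      · subst hy; simp; omega
      · have := h y
        simp [hy]; omega
    have h4 : (e.sum x f).eval w env ≤ p.eval M * q.eval (M + p.eval M) := by
      simp only [eval]
      refine (Finset.sum_le_card_nsmul _ _ _ fun i hi => (h3 i (Finset.mem_range.1 hi)).1).trans ?_
      simpa using Nat.mul_le_mul_right _ h1
    refine ⟨h4.trans ?_, mono (h2.sum fun i hi => ⟨(h3 i hi).2, (h3 i hi).1⟩) ?_⟩
    · simp; omega
    · have := Nat.mul_le_mul_right (q.eval (M + p.eval M) + 4 * q.eval (M + p.eval M) + 5) h1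
      have h5 := h x
      simp
      have e1 : p.eval M * (5 * q.eval (M + p.eval M) + 5) =
        p.eval M * (q.eval (M + p.eval M) + 4 * q.eval (M + p.eval M) + 5) := by ring
      rw [e1]
      omega

end StackProg

/-! ### Register programs with bounded loops, and their running times -/

namespace StackProg

open Turing Function

variable {V B : Type}

/-- Applies `f (n - 1)`, ..., `f 0` in this order. -/
def iterDown {S : Type} (f : ℕ → S → S) : ℕ → S → S
  | 0, s => s
  | n + 1, s => iterDown f n (f n s)

/-- Programs with registers for natural numbers. `loop x e P` runs `P` for `x = e - 1, ..., 0`. -/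
inductive Prog (V B : Type) : Type
  | skip : Prog V B
  | assign (x : V) (e : Exp V) : Prog V B
  | emit (b : B) : Prog V B
  | seq (P Q : Prog V B) : Prog V B
  | ite (e : Exp V) (P Q : Prog V B) : Prog V B
  | loop (x : V) (e : Exp V) (P : Prog V B) : Prog V B

namespace Prog

/-- The stack program executing a program. -/
def comp : Prog V B → Code V B
  | skip => .skip
  | assign x e => .seq e.comp (.seq (clearReg x) (.seq (evToReg x) (.pop (Sum.inr 0))))
  | emit b => .emit b
  | seq P Q => .seq P.comp Q.comp
  | ite e P Q => .seq e.comp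
      (.ite (Sum.inr 0) isOne (.seq clearEv P.comp) (.seq (.pop (Sum.inr 0)) Q.comp))
  | loop x e P => .seq e.comp (.seq (.repeatWhile (Sum.inr 0) isOne
      (.seq (.pop (Sum.inr 0)) (.seq (clearReg x) (.seq evToTmp (.seq (tmpToBoth x) P.comp)))))
      (.pop (Sum.inr 0)))

variable [DecidableEq V]

/-- The effect of a program on the registers and the output. -/
def run (w : List Sym) : Prog V B → (V → ℕ) × List B → (V → ℕ) × List B
  | skip, s => s
  | assign x e, s => (update s.1 x (e.eval w s.1), s.2)
  | emit b, s => (s.1, b :: s.2)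
  | seq P Q, s => Q.run w (P.run w s)
  | ite e P Q, s => if e.eval w s.1 ≠ 0 then P.run w s else Q.run w s
  | loop x e P, s => iterDown (fun i s => P.run w (update s.1 x i, s.2)) (e.eval w s.1) s

/-- The program `P` ends within time `T` when it is started in the state `s`. -/
def Within (w : List Sym) (P : Prog V B) (s : (V → ℕ) × List B) (T : ℕ) : Prop :=
  ∀ l : List Sym, Runs P.comp ⟨s.1, l, [], w, [], s.2⟩
    ⟨(P.run w s).1, l, [], w, [], (P.run w s).2⟩ T

variable {w : List Sym} {P Q : Prog V B} {s : (V → ℕ) × List B} {T T' : ℕ} {e : Exp V} {x : V}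

theorem Within.mono (h : P.Within w s T) (hT : T ≤ T') : P.Within w s T' :=
  fun l => (h l).mono hT

theorem Within.skip : (skip : Prog V B).Within w s 1 := fun _ => Runs.skip

theorem Within.emit {b : B} : (emit b : Prog V B).Within w s 1 := fun _ => Runs.emit b

theorem Within.seq (h : P.Within w s T) (h' : Q.Within w (P.run w s) T') :
    (P.seq Q).Within w s (T + T') := fun l => (h l).seq (h' l)

theorem Within.assign (h : e.Computes B w s.1 T) :
    (assign x e : Prog V B).Within w s (T + 2 * s.1 x + 2 * e.eval w s.1 + 3) := fun l => by
  have h1 := clearReg_runs s.1 x (s.1 x) (ones (e.eval w s.1) ++ sep :: l) [] w [] s.2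
  have h2 := evToReg_runs s.1 x (e.eval w s.1) 0 (sep :: l) [] w [] s.2 (isOne_sep _)
  simp only [update_eq_self, zero_add] at h1 h2
  exact ((h l s.2).seq (h1.seq (h2.seq (pop_ev _ sep l _ _ _ _)))).mono (by omega)

/-- Time is required only for the branch taken. This is what lets an expensive search be bounded
under the condition that guards it. -/
theorem Within.ite (h : e.Computes B w s.1 T) (hP : e.eval w s.1 ≠ 0 → P.Within w s T')
    (hQ : e.eval w s.1 = 0 → Q.Within w s T') :
    (ite e P Q).Within w s (T + T' + 2 * e.eval w s.1 + 3) := fun l => by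
  by_cases h0 : e.eval w s.1 = 0
  · have hr : (Prog.ite e P Q).run w s = Q.run w s := by simp [run, h0]
    rw [hr]
    have h1 := h l s.2
    rw [h0] at h1
    exact (h1.seq (Runs.ite_false (isOne_sep l)
      ((pop_ev _ sep l _ _ _ _).seq (hQ h0 l)))).mono (by omega)
  · have hr : (Prog.ite e P Q).run w s = P.run w s := by simp [run, h0]
    rw [hr]
    obtain ⟨n, hn⟩ := Nat.exists_eq_succ_of_ne_zero h0
    refine ((h l s.2).seq (Runs.ite_true ?_ ((clearEv_runs _ _ l _ _ _ _).seq (hP h0 l)))).mono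
      (by omega)
    rw [hn]
    exact isOne_ones_succ n _

/-- The counter stays on the evaluation stack and is copied to `x` before each pass, so the body may
overwrite `x`. In the cost of a pass, `2 * M` pays for clearing `x` and `5 * e.eval w s.1` for the
copy. The invariant `I` carries the register bounds from pass to pass. -/
theorem Within.loop {M : ℕ} (I : ℕ → (V → ℕ) × List B → Prop) (h : e.Computes B w s.1 T)
    (hs : I (e.eval w s.1) s)
    (hI : ∀ i < e.eval w s.1, ∀ s, I (i + 1) s → s.1 x ≤ M ∧
      P.Within w (update s.1 x i, s.2) T' ∧ I i (P.run w (update s.1 x i, s.2))) :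
    (loop x e P).Within w s (T + e.eval w s.1 * (T' + 2 * M + 5 * e.eval w s.1 + 5) + 2) ∧
      I 0 ((loop x e P).run w s) := by
  have key : ∀ n ≤ e.eval w s.1, ∀ s' : (V → ℕ) × List B, I n s' →
      I 0 (iterDown (fun i s => P.run w (update s.1 x i, s.2)) n s') ∧
      ∀ l : List Sym, Runs (.repeatWhile (Sum.inr 0) isOne
      (.seq (.pop (Sum.inr 0)) (.seq (clearReg x) (.seq evToTmp (.seq (tmpToBoth x) P.comp)))))
      ⟨s'.1, ones n ++ sep :: l, [], w, [], s'.2⟩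
      ⟨(iterDown (fun i s => P.run w (update s.1 x i, s.2)) n s').1, sep :: l, [], w, [],
        (iterDown (fun i s => P.run w (update s.1 x i, s.2)) n s').2⟩
      (n * (T' + 2 * M + 5 * e.eval w s.1 + 5) + 1) := by
    intro n
    induction n with
    | zero => intro _ s' hs'; exact ⟨hs', fun l => (Runs.while_done (isOne_sep _)).mono (by omega)⟩
    | succ n ih =>
      intro hn s' hs'
      obtain ⟨h1, h2, h3⟩ := hI n (by omega) s' hs'
      obtain ⟨h4, h5⟩ := ih (by omega) _ h3
      refine ⟨h4, fun l => ?_⟩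
      have r1 := pop_ev s'.1 one (ones n ++ sep :: l) [] w [] s'.2
      have r2 := clearReg_runs s'.1 x (s'.1 x) (ones n ++ sep :: l) [] w [] s'.2
      have r3 := evToTmp_runs (update s'.1 x 0) n 0 (sep :: l) w [] s'.2 (isOne_sep _)
      have r4 := tmpToBoth_runs s'.1 x n 0 0 (sep :: l) w [] s'.2
      simp only [update_eq_self, zero_add] at r2 r3 r4
      refine Runs.weaken (Runs.while_step (isOne_ones_succ n _)
        (r1.seq (r2.seq (r3.seq (r4.seq (h2 (ones n ++ sep :: l)))))) (h5 l)) rfl ?_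
      have := Nat.add_one_mul n (T' + 2 * M + 5 * e.eval w s.1 + 5)
      omega
  obtain ⟨h1, h2⟩ := key _ le_rfl s hs
  exact ⟨fun l => ((h l s.2).seq ((h2 l).seq (pop_ev _ sep l _ _ _ _))).mono (by omega), h1⟩

/-- `P` runs in polynomial time, and the registers stay polynomially bounded. -/
def PolyTime (P : Prog V B) : Prop :=
  ∃ p : Polynomial ℕ, ∀ (w : List Sym) (M : ℕ) (s : (V → ℕ) × List B), 1 ≤ M → w.length ≤ M →
    (∀ x, s.1 x ≤ M) → (∀ x, (P.run w s).1 x ≤ p.eval M) ∧ P.Within w s (p.eval M)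

/-- `P` runs in polynomial time and preserves all bounds of the registers by numbers not less
than the length of the input. -/
def Tame (P : Prog V B) : Prop :=
  ∃ p : Polynomial ℕ, ∀ (w : List Sym) (M : ℕ) (s : (V → ℕ) × List B), 1 ≤ M → w.length ≤ M →
    (∀ x, s.1 x ≤ M) → (∀ x, (P.run w s).1 x ≤ M) ∧ P.Within w s (p.eval M)

theorem forall_update_le {env : V → ℕ} {M n : ℕ} (h : ∀ x, env x ≤ M) (hn : n ≤ M) (x y : V) :
    update env x n y ≤ M := by
  by_cases hy : y = x
  · subst hy; simpa
  · simpa [hy] using h y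

theorem Tame.skip : (skip : Prog V B).Tame :=
  ⟨1, fun _ _ _ _ _ h => ⟨h, by simpa using Within.skip⟩⟩

theorem Tame.emit (b : B) : (emit b : Prog V B).Tame :=
  ⟨1, fun _ _ _ _ _ h => ⟨h, by simpa using Within.emit⟩⟩

theorem Tame.seq (hP : P.Tame) (hQ : Q.Tame) : (P.seq Q).Tame := by
  obtain ⟨p, hp⟩ := hP
  obtain ⟨q, hq⟩ := hQ
  refine ⟨p + q, fun w M s h1 hw h => ?_⟩
  obtain ⟨a1, a2⟩ := hp w M s h1 hw h
  obtain ⟨b1, b2⟩ := hq w M _ h1 hw a1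
  exact ⟨b1, by simpa using a2.seq b2⟩

theorem Tame.ite (e : Exp V) (hP : P.Tame) (hQ : Q.Tame) : (ite e P Q).Tame := by
  obtain ⟨p, hp⟩ := hP
  obtain ⟨q, hq⟩ := hQ
  obtain ⟨r, hr⟩ := e.exists_polynomial B
  refine ⟨r + (p + q) + 2 * r + 3, fun w M s h1 hw h => ?_⟩
  obtain ⟨a1, a2⟩ := hp w M s h1 hw h
  obtain ⟨b1, b2⟩ := hq w M s h1 hw h
  obtain ⟨c1, c2⟩ := hr w M s.1 hw h
  refine ⟨fun x => ?_, (Within.ite (T' := p.eval M + q.eval M) c2 (fun _ => a2.mono (by omega))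
    (fun _ => b2.mono (by omega))).mono (by simp; omega)⟩
  simp only [run]
  split_ifs
  exacts [a1 x, b1 x]

/-- The body preserves the bound `M`, so a single `M` serves all passes and the times just add up.
The argument would fail for `PolyTime`, whose register bounds would be composed once per pass. -/
theorem Tame.loop (x y : V) (hP : P.Tame) : (loop x (.var y) P).Tame := by
  obtain ⟨p, hp⟩ := hP
  obtain ⟨r, hr⟩ := (Exp.var y).exists_polynomial B
  refine ⟨r + Polynomial.X * (p + 7 * Polynomial.X + 5) + 2, fun w M s h1 hw h => ?_⟩
  obtain ⟨c1, c2⟩ := hr w M s.1 hw h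
  have hy : (Exp.var y).eval w s.1 ≤ M := h y
  have := Within.loop (x := x) (P := P) (M := M) (T' := p.eval M) (fun _ s => ∀ x, s.1 x ≤ M) c2 h
    fun i hi s hs => by
      obtain ⟨a1, a2⟩ := hp w M (update s.1 x i, s.2) h1 hw
        (forall_update_le hs (by omega) x)
      exact ⟨hs x, a2, a1⟩
  refine ⟨this.2, this.1.mono ?_⟩
  have := Nat.mul_le_mul hy (show p.eval M + 2 * M + 5 * (Exp.var y).eval w s.1 + 5 ≤
    p.eval M + 7 * M + 5 by omega)
  simp
  omega

theorem Tame.assign (x : V) {e : Exp V} (he : ∀ (w : List Sym) (M : ℕ) (env : V → ℕ), 1 ≤ M →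
    w.length ≤ M → (∀ x, env x ≤ M) → e.eval w env ≤ M) : (assign x e : Prog V B).Tame := by
  obtain ⟨r, hr⟩ := e.exists_polynomial B
  refine ⟨r + 2 * Polynomial.X + 2 * Polynomial.X + 3, fun w M s h1 hw h => ?_⟩
  have hM := he w M s.1 h1 hw h
  refine ⟨forall_update_le h hM x, (Within.assign (hr w M s.1 hw h).2).mono ?_⟩
  have := h x
  simp
  omega

theorem Tame.polyTime (hP : P.Tame) : P.PolyTime := by
  obtain ⟨p, hp⟩ := hP
  refine ⟨p + Polynomial.X, fun w M s h1 hw h => ?_⟩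
  obtain ⟨a1, a2⟩ := hp w M s h1 hw h
  exact ⟨fun x => (a1 x).trans (by simp), a2.mono (by simp)⟩

theorem PolyTime.assign (x : V) (e : Exp V) : (assign x e : Prog V B).PolyTime := by
  obtain ⟨r, hr⟩ := e.exists_polynomial B
  refine ⟨r + 2 * Polynomial.X + 2 * r + 3, fun w M s h1 hw h => ?_⟩
  obtain ⟨c1, c2⟩ := hr w M s.1 hw h
  have hx := h x
  refine ⟨fun y => ?_, (Within.assign c2).mono (by simp; omega)⟩
  refine forall_update_le (fun y => (h y).trans ?_) (c1.trans ?_) x y <;> simp <;> omega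

/-- The second program starts with registers bounded by `M + p.eval M`; adding `M` keeps the input
length and 1 below the new bound. -/
theorem PolyTime.seq (hP : P.PolyTime) (hQ : Q.PolyTime) : (P.seq Q).PolyTime := by
  obtain ⟨p, hp⟩ := hP
  obtain ⟨q, hq⟩ := hQ
  refine ⟨p + q.comp (Polynomial.X + p), fun w M s h1 hw h => ?_⟩
  obtain ⟨a1, a2⟩ := hp w M s h1 hw h
  obtain ⟨b1, b2⟩ := hq w (M + p.eval M) _ (by omega) (by omega)
    (fun x => (a1 x).trans (by omega))
  exact ⟨fun x => (b1 x).trans (by simp), (a2.seq b2).mono (by simp)⟩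

/-- Empties all registers in a list. -/
def clearRegs : List V → Code V B
  | [] => .skip
  | x :: l => .seq (clearReg x) (clearRegs l)

theorem clearRegs_runs (M : ℕ) (L : List V) (env : V → ℕ) (h : ∀ x, env x ≤ M)
    (l r i j : List Sym) (o : List B) :
    Runs (clearRegs L) ⟨env, l, r, i, j, o⟩ ⟨fun x => if x ∈ L then 0 else env x, l, r, i, j, o⟩
      (L.length * (2 * M + 1) + 1) := by
  induction L generalizing env with
  | nil => exact Runs.weaken Runs.skip (by simp) (by simp)
  | cons x L ih =>
    have h1 := clearReg_runs env x (env x) l r i j o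
    rw [update_eq_self] at h1
    refine Runs.weaken (h1.seq (ih (update env x 0) (forall_update_le h (Nat.zero_le _) x))) ?_ ?_
    · congr 1
      funext y
      by_cases hy : y = x <;> simp [hy]
    · have := h x
      have := Nat.add_one_mul L.length (2 * M + 1)
      rw [List.length_cons]
      omega

/-- Empties the input. -/
def clearInp : Code V B := .repeatWhile (Sum.inr 2) Option.isSome (.pop (Sum.inr 2))

theorem clearInp_runs (env : V → ℕ) (l r i j : List Sym) (o : List B) :
    Runs clearInp ⟨env, l, r, i, j, o⟩ ⟨env, l, r, [], j, o⟩ (2 * i.length + 1) := by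
  induction i with
  | nil => exact Runs.while_done rfl
  | cons a i ih =>
    have h1 : Runs (.pop (Sum.inr 2)) (⟨env, l, r, a :: i, j, o⟩ : Mem V B)
        ⟨env, l, r, i, j, o⟩ 1 := .pop (by rw [update_lay_inp]; rfl) rfl
    exact (Runs.while_step rfl h1 ih).mono (by simp; omega)

variable [Fintype V]

/-- A program, followed by emptying all registers and the input. -/
noncomputable def full (P : Prog V B) : Code V B :=
  .seq P.comp (.seq (clearRegs Finset.univ.toList) clearInp)

/-- The machine executing a program. -/
noncomputable def computer (P : Prog V B) : TM2ComputableAux Sym B :=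
  P.full.computer (Sum.inr 2)

theorem Within.outputsInTime {M n : ℕ} (h : P.Within w (fun _ => 0, []) T)
    (hM : ∀ x, (P.run w (fun _ => 0, [])).1 x ≤ M)
    (hn : T + Fintype.card V * (2 * M + 1) + 2 * w.length + 3 ≤ n) :
    Nonempty (TM2OutputsInTime P.computer.tm w (some (P.run w (fun _ => 0, [])).2) n) := by
  have h2 := clearRegs_runs M (Finset.univ : Finset V).toList _ hM [] [] w []
    (P.run w (fun _ => 0, [])).2
  have h3 := clearInp_runs (fun x => if x ∈ (Finset.univ : Finset V).toList then 0 else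
    (P.run w (fun _ => 0, [])).1 x) [] [] w [] (P.run w (fun _ => 0, [])).2
  obtain ⟨t, ht, hx⟩ := (h []).seq (h2.seq h3)
  have e1 : (Mem.lay (B := B) ⟨fun _ => 0, [], [], w, [], []⟩ : V ⊕ Fin 4 → List Sym) =
      update (fun _ => []) (Sum.inr 2) w := by
    funext k
    rcases k with y | i
    · simp [Mem.lay]
    · fin_cases i <;> simp [Mem.lay]
  have e2 : (Mem.lay (B := B) ⟨fun x => if x ∈ (Finset.univ : Finset V).toList then 0 else
      (P.run w (fun _ => 0, [])).1 x, [], [], [], [], (P.run w (fun _ => 0, [])).2⟩ :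
      V ⊕ Fin 4 → List Sym) = fun _ => [] := by
    funext k
    rcases k with y | i
    · simp [Mem.lay]
    · fin_cases i <;> simp [Mem.lay]
  rw [e1, e2] at hx
  refine hx.outputsInTime ?_
  simp only [Finset.length_toList, Finset.card_univ] at ht
  omega

theorem Within.outputsInTime_map {M n : ℕ} (h : P.Within w (fun _ => 0, []) T)
    (hM : ∀ x, (P.run w (fun _ => 0, [])).1 x ≤ M)
    (hn : T + Fintype.card V * (2 * M + 1) + 2 * w.length + 3 ≤ n) :
    Nonempty (TM2OutputsInTime P.computer.tm (w.map P.computer.inputAlphabet.symm)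
      (some ((P.run w (fun _ => 0, [])).2.map P.computer.outputAlphabet.symm)) n) :=
  (congrArg₂ (fun a b => Nonempty (TM2OutputsInTime P.computer.tm a (some b) n))
    (List.map_id w) (List.map_id (P.run w (fun _ => 0, [])).2)).mpr (h.outputsInTime hM hn)

end Prog

end StackProg

/-! ### Balanced signings and bisections -/

namespace SimpleGraph

open Finset Classical

variable {V : Type*} (H : SimpleGraph V)

/-- The sum of `s i * t j` over all adjacent pairs of `i ∈ K` and `j ∈ L`. -/
noncomputable def pairSum (K L : Finset V) (s t : V → ℤ) : ℤ :=
  ∑ i ∈ K, ∑ j ∈ L, if H.Adj i j then s i * t j else 0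

/-- There is a balanced `±1`-signing of `K` in which the number of ordered adjacent pairs of opposite
signs exceeds the number of those of equal signs by at least `c`. -/
def HasSigning (K : Finset V) (c : ℤ) : Prop :=
  ∃ s : V → ℤ, (∀ i ∈ K, s i = 1 ∨ s i = -1) ∧ ∑ i ∈ K, s i = 0 ∧ c ≤ -H.pairSum K K s s

variable {H} {K L K' : Finset V} {s t s' t' : V → ℤ} {c c' : ℤ}

theorem pairSum_congr (h : ∀ i ∈ K, s i = s' i) (h' : ∀ i ∈ L, t i = t' i) :
    H.pairSum K L s t = H.pairSum K L s' t' :=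
  sum_congr rfl fun i hi => sum_congr rfl fun j hj => by rw [h i hi, h' j hj]

theorem pairSum_comm : H.pairSum K L s t = H.pairSum L K t s := by
  rw [pairSum, sum_comm, pairSum]
  exact sum_congr rfl fun i _ => sum_congr rfl fun j _ => by rw [H.adj_comm, mul_comm]

theorem pairSum_neg_right : H.pairSum K L s (fun i => -t i) = -H.pairSum K L s t := by
  simp only [pairSum, ← sum_neg_distrib]
  exact sum_congr rfl fun i _ => sum_congr rfl fun j _ => by split_ifs <;> simp

theorem pairSum_neg_left : H.pairSum K L (fun i => -s i) t = -H.pairSum K L s t := by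
  rw [pairSum_comm, pairSum_neg_right, pairSum_comm]

theorem pairSum_eq_zero (h : ∀ i ∈ K, ∀ j ∈ L, ¬H.Adj i j) : H.pairSum K L s t = 0 :=
  sum_eq_zero fun i hi => sum_eq_zero fun j hj => if_neg (h i hi j hj)

theorem HasSigning.mono (h : H.HasSigning K c) (hc : c' ≤ c) : H.HasSigning K c' :=
  let ⟨s, h1, h2, h3⟩ := h
  ⟨s, h1, h2, hc.trans h3⟩

theorem HasSigning.empty : H.HasSigning ∅ 0 := ⟨fun _ => 1, by simp, by simp, by simp [pairSum]⟩

variable [DecidableEq V]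

theorem pairSum_union_left (h : Disjoint K K') :
    H.pairSum (K ∪ K') L s t = H.pairSum K L s t + H.pairSum K' L s t := sum_union h

theorem pairSum_union_right (h : Disjoint L K') :
    H.pairSum K (L ∪ K') s t = H.pairSum K L s t + H.pairSum K K' s t := by
  rw [pairSum_comm, pairSum_union_left h, pairSum_comm, pairSum_comm (K := K')]

theorem pairSum_union_self (h : Disjoint K L) :
    H.pairSum (K ∪ L) (K ∪ L) s s =
      H.pairSum K K s s + H.pairSum L L s s + 2 * H.pairSum K L s s := by
  rw [pairSum_union_left h, pairSum_union_right h, pairSum_union_right h,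
    pairSum_comm (K := L) (L := K)]
  ring

/-- Negating `t` preserves balance and the value on `L` but changes the sign of the cross term,
which may therefore be assumed not to reduce the total. -/
theorem HasSigning.union (h : H.HasSigning K c) (h' : H.HasSigning L c') (hd : Disjoint K L) :
    H.HasSigning (K ∪ L) (c + c') := by
  obtain ⟨s, s1, s2, s3⟩ := h
  obtain ⟨t, t1, t2, t3⟩ := h'
  wlog hx : H.pairSum K L s t ≤ 0 generalizing t
  · refine this (fun i => -t i) (fun i hi => ?_) (by simp [t2]) ?_ ?_
    · rcases t1 i hi with h | h <;> simp [h]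
    · rwa [pairSum_neg_left, pairSum_neg_right, neg_neg]
    · rw [pairSum_neg_right]; omega
  have e1 : ∀ i ∈ K, (fun i => if i ∈ K then s i else t i) i = s i := fun i hi => by simp [hi]
  have e2 : ∀ i ∈ L, (fun i => if i ∈ K then s i else t i) i = t i := fun i hi =>
    if_neg (Finset.disjoint_right.1 hd hi)
  refine ⟨fun i => if i ∈ K then s i else t i, fun i hi => ?_, ?_, ?_⟩
  · rcases mem_union.1 hi with h | h
    · rw [e1 i h]; exact s1 i h
    · rw [e2 i h]; exact t1 i h
  · rw [sum_union hd, sum_congr rfl e1, sum_congr rfl e2, s2, t2, add_zero]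
  · rw [pairSum_union_self hd, pairSum_congr e1 e1, pairSum_congr e2 e2, pairSum_congr e1 e2]
    omega

theorem HasSigning.pair {i j : V} (hij : i ≠ j) :
    H.HasSigning {i, j} (if H.Adj i j then 2 else 0) := by
  refine ⟨fun x => if x = i then 1 else -1, fun x _ => ?_, ?_, ?_⟩
  · by_cases h : x = i <;> simp [h]
  · rw [sum_pair hij]; simp [hij.symm]
  · simp only [pairSum, sum_pair hij, H.irrefl, H.adj_comm j i]
    simp [hij.symm]
    split_ifs <;> simp

/-- Vertices are removed in pairs; a pair with opposite signs gains 2 or 0, and gains add up. -/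
theorem HasSigning.of_even (h : Even K.card) : H.HasSigning K 0 := by
  obtain ⟨n, hn⟩ := h
  induction n generalizing K with
  | zero => rw [card_eq_zero.1 (by omega : K.card = 0)]; exact .empty
  | succ n ih =>
    obtain ⟨i, hi, j, hj, hij⟩ := one_lt_card.1 (by omega : 1 < K.card)
    have hs : {i, j} ⊆ K := by simp [insert_subset_iff, hi, hj]
    have h1 : (K \ {i, j}).card = n + n := by rw [card_sdiff_of_subset hs, card_pair hij]; omega
    rw [← sdiff_union_of_subset hs]
    refine ((ih h1).union (.pair hij) sdiff_disjoint).mono ?_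
    split_ifs <;> simp

/-- A star, together with as many vertices but one that are not adjacent to its centre. -/
theorem HasSigning.star {v : V} {N Q : Finset V} (hvN : v ∉ N) (hvQ : v ∉ Q) (hNQ : Disjoint N Q)
    (hcard : N.card = Q.card + 1) (hN : ∀ j ∈ N, H.Adj v j) (hQ : ∀ j ∈ Q, ¬H.Adj v j)
    (hind : ∀ i ∈ N ∪ Q, ∀ j ∈ N ∪ Q, ¬H.Adj i j) :
    H.HasSigning ({v} ∪ (N ∪ Q)) (2 * N.card) := by
  have hd : Disjoint {v} (N ∪ Q) := by simp [hvN, hvQ]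
  -- The leaves get -1, the centre and the vertices of `Q` get 1. The only edges are those of the
  -- star, and all of them are cut.
  set s : V → ℤ := fun x => if x ∈ N then -1 else 1 with hs
  have sN : ∀ i ∈ N, s i = -1 := fun i hi => by simp [hs, hi]
  have sQ : ∀ i ∈ Q, s i = 1 := fun i hi =>
    if_neg (Finset.disjoint_right.1 hNQ hi)
  have sv : s v = 1 := by simp [hs, hvN]
  refine ⟨s, fun x _ => ?_, ?_, ?_⟩
  · by_cases h : x ∈ N <;> simp [hs, h]
  · rw [sum_union hd, sum_union hNQ, sum_congr rfl sN, sum_congr rfl sQ]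
    simp [sv, hcard]
  · have h1 : H.pairSum {v} N s s = -N.card := by
      simp only [pairSum, sum_singleton, sv, one_mul]
      rw [sum_congr rfl fun j hj => by rw [if_pos (hN j hj), sN j hj]]
      simp
    rw [pairSum_union_self hd, pairSum_eq_zero hind, pairSum_union_right hNQ, h1,
      pairSum_eq_zero (K := {v}) (L := {v}) (by simp),
      pairSum_eq_zero (K := {v}) (L := Q) (by simpa using hQ)]
    omega

variable (H) in
/-- `W` is the vertex set of a matching with `m` edges. -/
inductive MatchedBy : Finset V → ℕ → Prop
  | empty : MatchedBy ∅ 0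
  | insert {W : Finset V} {m : ℕ} {u v : V} (h : MatchedBy W m) (hu : u ∉ W) (hv : v ∉ W)
      (huv : H.Adj u v) : MatchedBy (W ∪ {u, v}) (m + 1)

theorem MatchedBy.card_eq {W : Finset V} {m : ℕ} (h : H.MatchedBy W m) : W.card = 2 * m := by
  induction h with
  | empty => rfl
  | insert _ hu hv huv ih =>
    rw [card_union_of_disjoint (by simp [hu, hv]), ih, card_pair huv.ne]; omega

theorem MatchedBy.hasSigning {W : Finset V} {m : ℕ} (h : H.MatchedBy W m) :
    H.HasSigning W (2 * m) := by
  induction h with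
  | empty => exact .empty
  | insert _ hu hv huv ih =>
    refine (ih.union (.pair huv.ne) (by simp [hu, hv])).mono ?_
    rw [if_pos huv]; push_cast; omega

/-- Removing the edge of a matching at a given vertex. -/
theorem MatchedBy.exists_erase {W : Finset V} {m : ℕ} (h : H.MatchedBy W m) {v : V} (hv : v ∈ W) :
    ∃ W' m', H.MatchedBy W' m' ∧ W' ⊆ W ∧ v ∉ W' ∧ m = m' + 1 := by
  induction h with
  | empty => simp at hv
  | @insert W m u w h hu hw huw ih =>
    by_cases hvW : v ∈ W
    · obtain ⟨W', m', h1, h2, h3, h4⟩ := ih hvW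
      have hvu : v ≠ u := fun e => hu (e ▸ hvW)
      have hvw : v ≠ w := fun e => hw (e ▸ hvW)
      exact ⟨W' ∪ {u, w}, m' + 1, h1.insert (fun h => hu (h2 h)) (fun h => hw (h2 h)) huw,
        union_subset_union_left h2, by simp [h3, hvu, hvw], by omega⟩
    · exact ⟨W, m, h, subset_union_left, hvW, rfl⟩

/-- An edge outside a largest matched set would extend the matching, so the complement is
independent. -/
theorem exists_maximal_matchedBy (H : SimpleGraph V) (K : Finset V) :
    ∃ W m, H.MatchedBy W m ∧ W ⊆ K ∧ ∀ i ∈ K \ W, ∀ j ∈ K \ W, ¬H.Adj i j := by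
  have hne : (K.powerset.filter fun W => ∃ m, H.MatchedBy W m).Nonempty :=
    ⟨∅, by simp; exact ⟨0, .empty⟩⟩
  obtain ⟨W, hW, hmax⟩ := exists_max_image _ Finset.card hne
  simp only [mem_filter, mem_powerset] at hW hmax
  obtain ⟨hWK, m, hm⟩ := hW
  refine ⟨W, m, hm, hWK, fun i hi j hj hij => ?_⟩
  rw [mem_sdiff] at hi hj
  have h1 := hm.insert hi.2 hj.2 hij
  have := hmax (W ∪ {i, j}) ⟨union_subset hWK (by simp [insert_subset_iff, hi, hj]), _, h1⟩
  rw [h1.card_eq, hm.card_eq] at this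
  omega

/-- Without a signing of large value, all but few vertices are twins, and few vertices cover
all edges. -/
theorem exists_twins_of_not_hasSigning {k : ℕ} (hK : Even K.card) (h : ¬H.HasSigning K (4 * k)) :
    ∃ W T, W ⊆ K ∧ W.card ≤ 4 * k ∧ (∀ i ∈ K \ W, ∀ j ∈ K \ W, ¬H.Adj i j) ∧ T ⊆ K ∧
      (∀ i ∈ T, ∀ j ∈ T, ∀ l ∈ K, H.Adj i l ↔ H.Adj j l) ∧
      (K \ T).card ≤ 2 * k * (k + 1) := by
  obtain ⟨W, m, hm, hWK, hind⟩ := H.exists_maximal_matchedBy K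
  have hcard := hm.card_eq
  -- A signing of an even subset suffices: the other vertices are even in number and can be signed
  -- without loss.
  have rest : ∀ L c, L ⊆ K → Even L.card → H.HasSigning L c → H.HasSigning K c := by
    intro L c hL he hs
    have h1 : Even (K \ L).card := by
      rw [card_sdiff_of_subset hL, Nat.even_sub (card_le_card hL)]; tauto
    rw [← sdiff_union_of_subset hL]
    simpa using (HasSigning.of_even h1).union hs sdiff_disjoint
  have hm2 : m < 2 * k := by
    by_contra hlt
    exact h ((rest W _ hWK ⟨m, by omega⟩ hm.hasSigning).mono (by omega))
  -- Chosen such that `2 * (m - 1) + 2 * (d + 1) = 4 * k`: trading one matching edge for a star with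
  -- `d + 1` leaves attains the target.
  set d := 2 * k - m with hd
  have hex : ∀ v ∈ W, ((K \ W).filter fun j => H.Adj v j).card ≤ d ∨
      ((K \ W).filter fun j => ¬H.Adj v j).card ≤ d := by
    intro v hv
    by_contra! hcon
    obtain ⟨N, hN, hNc⟩ := exists_subset_card_eq (Nat.succ_le_of_lt hcon.1)
    obtain ⟨Q, hQ, hQc⟩ := exists_subset_card_eq hcon.2.le
    -- Freeing `v` also frees its partner, which is simply left to `rest`; the star and its `d`
    -- extra vertices are even in number.
    obtain ⟨W', m', h1, h2, h3, h4⟩ := hm.exists_erase hv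
    have hN' : ∀ j ∈ N, (j ∈ K ∧ j ∉ W) ∧ H.Adj v j := fun j hj => by simpa using hN hj
    have hQ' : ∀ j ∈ Q, (j ∈ K ∧ j ∉ W) ∧ ¬H.Adj v j := fun j hj => by simpa using hQ hj
    have hNQ : ∀ j ∈ N ∪ Q, j ∈ K ∧ j ∉ W := fun j hj =>
      (mem_union.1 hj).elim (fun h => (hN' j h).1) (fun h => (hQ' j h).1)
    have hdis : Disjoint N Q := Finset.disjoint_left.2 fun j hj hj' => (hQ' j hj').2 (hN' j hj).2
    have hvN : v ∉ N := fun h => (hN' v h).1.2 hv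
    have hvQ : v ∉ Q := fun h => (hQ' v h).1.2 hv
    have hst := HasSigning.star hvN hvQ hdis (by omega) (fun j hj => (hN' j hj).2)
      (fun j hj => (hQ' j hj).2)
      (fun i hi j hj => hind i (mem_sdiff.2 (hNQ i hi)) j (mem_sdiff.2 (hNQ j hj)))
    have hdis2 : Disjoint W' ({v} ∪ (N ∪ Q)) := by
      refine Finset.disjoint_left.2 fun j hj hj' => ?_
      rcases mem_union.1 hj' with h | h
      · exact h3 (mem_singleton.1 h ▸ hj)
      · exact (hNQ j h).2 (h2 hj)
    refine h ((rest _ _ ?_ ?_ (h1.hasSigning.union hst hdis2)).mono ?_)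
    · refine union_subset (h2.trans hWK) (union_subset (by simpa using hWK hv) fun j hj => ?_)
      exact (hNQ j hj).1
    · rw [card_union_of_disjoint hdis2, card_union_of_disjoint (by simp [hvN, hvQ]),
        card_union_of_disjoint hdis, card_singleton, hNc, hQc, h1.card_eq]
      exact ⟨m' + d + 1, by omega⟩
    · rw [hNc]; push_cast; omega
  -- The exceptional vertices for `v`: its neighbours or its non-neighbours outside `W`, a kind of
  -- which there are at most `d`.
  set ex : V → Finset V := fun v => if ((K \ W).filter fun j => H.Adj v j).card ≤ d then
    (K \ W).filter fun j => H.Adj v j else (K \ W).filter fun j => ¬H.Adj v j with hexdef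
  have hexc : ∀ v ∈ W, (ex v).card ≤ d := by
    intro v hv
    simp only [hexdef]
    split_ifs with h1
    · exact h1
    · exact (hex v hv).resolve_left h1
  refine ⟨W, (K \ W) \ W.biUnion ex, hWK, by omega, hind, sdiff_subset.trans sdiff_subset, ?_, ?_⟩
  · have key : ∀ i ∈ (K \ W) \ W.biUnion ex, ∀ v ∈ W, H.Adj v i ↔
        ¬((K \ W).filter fun j => H.Adj v j).card ≤ d := by
      intro i hi v hv
      have hiKW := (mem_sdiff.1 hi).1
      have hni : i ∉ ex v := fun h => (mem_sdiff.1 hi).2 (mem_biUnion.2 ⟨v, hv, h⟩)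
      simp only [hexdef] at hni
      split_ifs at hni with h1
      · simp only [mem_filter, hiKW, true_and] at hni
        simp [hni, h1]
      · simp only [mem_filter, hiKW, true_and, not_not] at hni
        simp [hni, h1]
    intro i hi j hj l hl
    by_cases hlW : l ∈ W
    · rw [H.adj_comm i, H.adj_comm j, key i hi l hlW, key j hj l hlW]
    · have hl' := mem_sdiff.2 ⟨hl, hlW⟩
      simp [hind i (mem_sdiff.1 hi).1 l hl', hind j (mem_sdiff.1 hj).1 l hl']
  · have h1 : K \ ((K \ W) \ W.biUnion ex) ⊆ W ∪ W.biUnion ex := by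
      intro i hi
      simp only [mem_sdiff, mem_union] at hi ⊢
      tauto
    have h2 : (W.biUnion ex).card ≤ W.card * d := card_biUnion_le_card_mul _ _ _ hexc
    have h3 := (card_le_card h1).trans (card_union_le _ _)
    refine h3.trans ((Nat.add_le_add_left h2 _).trans ?_)
    rw [hcard, hd]
    -- The inequality is `(k - m) * (k - m + 1) ≥ 0`. It holds for integers, as no integer lies
    -- strictly between the two roots; hence the two cases.
    zify [hm2.le]
    rcases Nat.lt_or_ge k m with hkm | hkm
    · nlinarith [mul_nonneg (show (0 : ℤ) ≤ m - k by omega) (show (0 : ℤ) ≤ m - k - 1 by omega)]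
    · nlinarith [mul_nonneg (show (0 : ℤ) ≤ k - m by omega) (show (0 : ℤ) ≤ k - m + 1 by omega)]

end SimpleGraph

/-! ### Signings of a graph with a large class of twins -/

namespace SimpleGraph

open Finset Classical

variable {V : Type*} [DecidableEq V] {H : SimpleGraph V}

/-- A signing of a set of twins that is at least as large as the rest is determined by the rest. -/
theorem hasSigning_union_twins_iff {O T β : Finset V} {c : ℤ} (hd : Disjoint O T)
    (hadj : ∀ i ∈ T, ∀ j ∈ O, H.Adj i j ↔ j ∈ β) (hind : ∀ i ∈ T, ∀ j ∈ T, ¬H.Adj i j)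
    (heven : Even (O.card + T.card)) (hle : O.card ≤ T.card) :
    H.HasSigning (O ∪ T) c ↔ ∃ s : V → ℤ, (∀ i ∈ O, s i = 1 ∨ s i = -1) ∧
      c ≤ -H.pairSum O O s s + 2 * (∑ i ∈ O, s i) * ∑ i ∈ O with i ∈ β, s i := by
  have cross : ∀ s : V → ℤ, H.pairSum O T s s =
      (∑ i ∈ T, s i) * ∑ i ∈ O with i ∈ β, s i := by
    intro s
    rw [pairSum_comm, pairSum, sum_mul]
    refine sum_congr rfl fun i hi => ?_
    rw [mul_sum, sum_filter]
    refine sum_congr rfl fun j hj => ?_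
    simp only [hadj i hi j hj]
  constructor
  · rintro ⟨s, s1, s2, s3⟩
    refine ⟨s, fun i hi => s1 i (mem_union_left _ hi), ?_⟩
    rw [pairSum_union_self hd, cross, pairSum_eq_zero hind] at s3
    rw [sum_union hd] at s2
    -- Balance eliminates the signs on `T`, so that the criterion no longer involves `T`.
    rw [show ∑ i ∈ T, s i = -∑ i ∈ O, s i by omega] at s3
    linarith
  · rintro ⟨s, s1, s3⟩
    have hbound : ∀ O' : Finset V, O' ⊆ O → |∑ i ∈ O', s i| ≤ O'.card ∧
        Even (∑ i ∈ O', s i + O'.card) := by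
      intro O'
      induction O' using Finset.induction_on with
      | empty => simp
      | insert i O' hi ih =>
        intro hO
        obtain ⟨h1, n, h2⟩ := ih ((subset_insert _ _).trans hO)
        rw [sum_insert hi, card_insert_of_notMem hi]
        push_cast
        rw [abs_le] at h1 ⊢
        rcases s1 i (hO (mem_insert_self _ _)) with h | h <;> rw [h]
        · exact ⟨by omega, n + 1, by omega⟩
        · exact ⟨by omega, n, by omega⟩
    obtain ⟨h1, n, h2⟩ := hbound O Subset.rfl
    obtain ⟨m, hm⟩ := heven
    rw [abs_le] at h1
    -- Here `n` counts the positive signs on `O` and `m` is half the number of all vertices, so `m -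
    -- n` positive signs are missing. They fit into `T` because `O` is not larger than `T`.
    obtain ⟨Z, hZ, hZc⟩ := exists_subset_card_eq
      (show ((m : ℤ) - n).toNat ≤ T.card by omega)
    have hZc' : (Z.card : ℤ) = m - n := by omega
    set s' : V → ℤ := fun i => if i ∈ O then s i else if i ∈ Z then 1 else -1 with hs'
    have eO : ∀ i ∈ O, s' i = s i := fun i hi => if_pos hi
    have eT : ∀ i ∈ T, s' i = if i ∈ Z then 1 else -1 := fun i hi =>
      if_neg (Finset.disjoint_right.1 hd hi)
    have sumT : ∑ i ∈ T, s' i = -∑ i ∈ O, s i := by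
      rw [sum_congr rfl eT, sum_ite, sum_const, sum_const, filter_mem_eq_inter,
        inter_eq_right.2 hZ, ← sdiff_eq_filter, card_sdiff_of_subset hZ]
      have := card_le_card hZ
      rw [nsmul_eq_mul, nsmul_eq_mul, Nat.cast_sub this]
      omega
    refine ⟨s', fun i hi => ?_, ?_, ?_⟩
    · by_cases hiO : i ∈ O
      · rw [eO i hiO]; exact s1 i hiO
      · simp only [hs', hiO, if_false]; split_ifs <;> simp
    · rw [sum_union hd, sumT, sum_congr rfl eO]; ring
    · rw [pairSum_union_self hd, cross, pairSum_eq_zero hind, sumT, pairSum_congr eO eO,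
        sum_congr rfl fun i hi => eO i (mem_filter.1 hi).1]
      linarith

end SimpleGraph

open Finset Classical in
-- Adding a new maximum leaves the ranks of the other elements unchanged, and its own rank is the
-- number of these.
theorem Finset.card_filter_rank_lt (C : Finset ℕ) (o : ℕ) :
    #{j ∈ C | #{i ∈ C | i < j} < o} = min o #C := by
  induction C using Finset.induction_on_max with
  | empty => simp
  | insert m C hm ih =>
    have hmC : m ∉ C := fun h => lt_irrefl _ (hm m h)
    have h1 : {i ∈ insert m C | i < m} = C := by
      ext i
      simp only [mem_filter, mem_insert]
      exact ⟨fun ⟨h, h'⟩ => h.resolve_left h'.ne, fun h => ⟨Or.inr h, hm i h⟩⟩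
    have h2 : ∀ j ∈ C, {i ∈ insert m C | i < j} = {i ∈ C | i < j} := by
      intro j hj
      ext i
      simp only [mem_filter, mem_insert]
      exact ⟨fun ⟨h, h'⟩ => ⟨h.resolve_left fun e => (hm j hj).not_gt (e ▸ h'), h'⟩,
        fun ⟨h, h'⟩ => ⟨Or.inr h, h'⟩⟩
    rw [filter_insert, h1, filter_congr fun j hj => by rw [h2 j hj], card_insert_of_notMem hmC]
    split_ifs with h
    · rw [card_insert_of_notMem (by simp [hmC]), ih]; omega
    · rw [ih]; omega

/-! ### Trimming a large class of twins, and the size of what remains -/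

namespace SimpleGraph

open Finset Classical

/-- The vertices of `K` with the same neighbours in `K` as `j`. -/
noncomputable def twins (H : SimpleGraph ℕ) (K : Finset ℕ) (j : ℕ) : Finset ℕ :=
  {i ∈ K | ∀ l ∈ K, H.Adj i l ↔ H.Adj j l}

/-- The vertices of `K`, except that from a class of twins with more than half of the vertices only
as many are kept as there are other vertices. -/
noncomputable def trim (H : SimpleGraph ℕ) (K : Finset ℕ) : Finset ℕ :=
  {j ∈ K | #{i ∈ H.twins K j | i < j} < #(K \ H.twins K j)}

variable {H : SimpleGraph ℕ} {K : Finset ℕ}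

theorem twins_subset (j : ℕ) : H.twins K j ⊆ K := filter_subset _ _

theorem mem_twins_self {j : ℕ} (hj : j ∈ K) : j ∈ H.twins K j := by simp [twins, hj]

theorem twins_eq_of_mem {i j : ℕ} (h : i ∈ H.twins K j) : H.twins K i = H.twins K j := by
  ext x
  simp only [twins, mem_filter] at h ⊢
  refine and_congr_right fun _ => forall₂_congr fun l hl => ?_
  rw [h.2 l hl]

theorem trim_subset : H.trim K ⊆ K := filter_subset _ _

/-- Either nothing is trimmed, or a large class of twins is. -/
theorem trim_cases (H : SimpleGraph ℕ) (K : Finset ℕ) :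
    (H.trim K = K ∧ ∀ j ∈ K, #(H.twins K j) ≤ #(K \ H.twins K j)) ∨
    ∃ j ∈ K, ∃ T' ⊆ H.twins K j, H.trim K = (K \ H.twins K j) ∪ T' ∧
      #T' = #(K \ H.twins K j) ∧ #(K \ H.twins K j) < #(H.twins K j) := by
  by_cases h : ∀ j ∈ K, #(H.twins K j) ≤ #(K \ H.twins K j)
  · refine Or.inl ⟨filter_true_of_mem fun j hj => lt_of_lt_of_le (card_lt_card ?_) (h j hj), h⟩
    exact (filter_ssubset).2 ⟨j, mem_twins_self hj, lt_irrefl j⟩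
  · push Not at h
    obtain ⟨j, hj, hlt⟩ := h
    refine Or.inr ⟨j, hj, {i ∈ H.twins K j | #{l ∈ H.twins K j | l < i} < #(K \ H.twins K j)},
      filter_subset _ _, ?_, ?_, hlt⟩
    · ext i
      simp only [trim, mem_union, mem_filter, mem_sdiff]
      by_cases hi : i ∈ H.twins K j
      · simp [hi, twins_eq_of_mem hi, twins_subset j hi]
      · simp only [hi, not_false_eq_true, and_true, false_and, or_false, and_iff_left_iff_imp]
        intro hiK
        -- Classes are disjoint, so any other class lies in the complement of the large one, is
        -- smaller than half, and is not trimmed.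
        have hdis : H.twins K i ⊆ K \ H.twins K j := fun x hx => by
          refine mem_sdiff.2 ⟨twins_subset i hx, fun hx' => hi ?_⟩
          rw [← twins_eq_of_mem hx', twins_eq_of_mem hx]
          exact mem_twins_self hiK
        have h1 := card_le_card hdis
        have h2 : #{l ∈ H.twins K i | l < i} ≤ #(H.twins K i) := card_filter_le _ _
        have h3 := card_sdiff_of_subset (twins_subset (H := H) (K := K) i)
        have h4 := card_sdiff_of_subset (twins_subset (H := H) (K := K) j)
        have h5 := card_le_card (twins_subset (H := H) (K := K) j)
        omega
    · rw [card_filter_rank_lt]; omega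

theorem even_card_trim (hK : Even #K) : Even #(H.trim K) := by
  rcases H.trim_cases K with ⟨h, _⟩ | ⟨j, hj, T', hT', h, hc, _⟩
  · rwa [h]
  · rw [h, card_union_of_disjoint (disjoint_of_subset_right hT' sdiff_disjoint), hc]
    exact ⟨_, rfl⟩

/-- Before and after trimming, the twins form a class at least as large as the rest and with the
same neighbourhood in it. The criterion of `hasSigning_union_twins_iff` is then literally the same.
-/
theorem hasSigning_trim_iff (hK : Even #K) (c : ℤ) :
    H.HasSigning (H.trim K) c ↔ H.HasSigning K c := by
  rcases H.trim_cases K with ⟨h, _⟩ | ⟨j, hj, T', hT', h, hc, hlt⟩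
  · rw [h]
  · have hadj : ∀ i ∈ H.twins K j, ∀ l ∈ K \ H.twins K j,
        H.Adj i l ↔ l ∈ ({l ∈ K | H.Adj j l} : Finset ℕ) := by
      intro i hi l hl
      have hl := (mem_sdiff.1 hl).1
      simpa [hl] using (mem_filter.1 hi).2 l hl
    have hind : ∀ i ∈ H.twins K j, ∀ l ∈ H.twins K j, ¬H.Adj i l := by
      intro i hi l hl
      rw [(mem_filter.1 hi).2 l (twins_subset j hl),
        ← (mem_filter.1 hl).2 l (twins_subset j hl)]
      exact H.irrefl
    have hK' : K = (K \ H.twins K j) ∪ H.twins K j := (sdiff_union_of_subset (twins_subset j)).symm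
    have hcard := card_sdiff_add_card_eq_card (twins_subset (H := H) (K := K) j)
    rw [h]
    conv_rhs => rw [hK', hasSigning_union_twins_iff sdiff_disjoint hadj hind (by rwa [hcard]) hlt.le]
    rw [hasSigning_union_twins_iff (disjoint_of_subset_right hT' sdiff_disjoint)
      (fun i hi => hadj i (hT' hi)) (fun i hi l hl => hind i (hT' hi) l (hT' hl))
      ⟨_, by rw [hc]⟩ hc.ge]

/-- Without a signing of large value, trimming leaves few vertices and few edges. -/
theorem card_trim_le {k : ℕ} (hK : Even #K) (h : ¬H.HasSigning K (4 * k)) :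
    #(H.trim K) ≤ 4 * k * (k + 1) ∧
      #{p ∈ H.trim K ×ˢ H.trim K | H.Adj p.1 p.2} ≤ 64 * k ^ 3 := by
  have hn : #(H.trim K) ≤ 4 * k * (k + 1) := by
    obtain ⟨-, T, -, -, -, hTK, htw, hT⟩ := exists_twins_of_not_hasSigning hK h
    -- Trimming leaves at most twice the complement of any set of twins, whether or not this set
    -- lies in the class that is trimmed.
    suffices h2 : #(H.trim K) ≤ 2 * #(K \ T) by
      calc _ ≤ _ := h2
        _ ≤ 2 * (2 * k * (k + 1)) := Nat.mul_le_mul_left 2 hT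
        _ = _ := by ring
    rcases T.eq_empty_or_nonempty with rfl | ⟨i, hi⟩
    · have := card_le_card (trim_subset (H := H) (K := K))
      simp only [sdiff_empty]
      omega
    have hTi : T ⊆ H.twins K i := fun x hx => by
      simp only [twins, mem_filter]
      exact ⟨hTK hx, htw x hx i hi⟩
    have h1 := card_le_card (sdiff_subset_sdiff (Subset.refl K) hTi)
    have h3 := card_sdiff_add_card_eq_card (twins_subset (H := H) (K := K) i)
    rcases H.trim_cases K with ⟨h, h2⟩ | ⟨j, hj, T', hT', h, hc, hlt⟩
    · have := h2 i (hTK hi)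
      rw [h]
      omega
    · rw [h, card_union_of_disjoint (disjoint_of_subset_right hT' sdiff_disjoint), hc]
      by_cases hij : i ∈ H.twins K j
      · rw [twins_eq_of_mem hij] at h1
        omega
      -- The trimmed class is another one, hence disjoint from that of `i`. Its complement is
      -- smaller than the class itself, which is contained in the complement of the class of `i`.
      · have h4 : H.twins K j ⊆ K \ H.twins K i := fun x hx => by
          refine mem_sdiff.2 ⟨twins_subset j hx, fun hx' => hij ?_⟩
          rw [← twins_eq_of_mem hx, twins_eq_of_mem hx']
          exact mem_twins_self (hTK hi)
        have := card_le_card h4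
        omega
  refine ⟨hn, ?_⟩
  -- The twin argument is applied again, to the trimmed set, for its cover `W` of at most `4 * k`
  -- vertices. The count is `2 * (4 * k) * (4 * k * (k + 1)) ≤ 64 * k ^ 3`, each edge being counted
  -- twice.
  rw [← hasSigning_trim_iff hK] at h
  obtain ⟨W, _, hW, hWc, hind, _⟩ := exists_twins_of_not_hasSigning (even_card_trim hK) h
  have h1 : {p ∈ H.trim K ×ˢ H.trim K | H.Adj p.1 p.2} ⊆ W ×ˢ H.trim K ∪ H.trim K ×ˢ W := by
    rintro ⟨i, j⟩ hp
    simp only [mem_filter, mem_product, mem_union] at hp ⊢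
    by_contra hcon
    refine hind i (mem_sdiff.2 ⟨hp.1.1, fun hi => ?_⟩) j (mem_sdiff.2 ⟨hp.1.2, fun hj => ?_⟩) hp.2
    · exact hcon (Or.inl ⟨hi, hp.1.2⟩)
    · exact hcon (Or.inr ⟨hp.1.1, hj⟩)
  have h2 := (card_le_card h1).trans (card_union_le _ _)
  rw [card_product, card_product, mul_comm #(H.trim K)] at h2
  have h3 := Nat.mul_le_mul hWc hn
  have h4 : k * k ≤ k ^ 3 := by
    rcases Nat.eq_zero_or_pos k with rfl | hk
    · simp
    · nlinarith [Nat.mul_le_mul_left (k * k) hk]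
  nlinarith

end SimpleGraph

/-! ### Translation between bisections and balanced signings -/

namespace SimpleGraph

open Finset Classical

/-- Bisections in terms of signings. -/
theorem hasBisectionATLB_iff {U : Type*} [Fintype U] [DecidableEq U] (G : SimpleGraph U) (k : ℕ) :
    HasBisectionATLB G k ↔ ∃ s : U → ℤ, (∀ i, s i = 1 ∨ s i = -1) ∧
      |∑ i, s i| ≤ 1 ∧ 4 * (k : ℤ) ≤ -G.pairSum univ univ s s := by
  have htotal : (∑ i : U, ∑ j : U, if G.Adj i j then (1 : ℤ) else 0) = 2 * G.edgeSet.ncard := by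
    have h1 := G.sum_degrees_eq_twice_card_edges
    rw [← Set.ncard_coe_finset, coe_edgeFinset] at h1
    have h2 : (2 * G.edgeSet.ncard : ℤ) = ((2 * G.edgeSet.ncard : ℕ) : ℤ) := by push_cast; rfl
    rw [h2, ← h1, Nat.cast_sum]
    refine sum_congr rfl fun i _ => ?_
    rw [← card_neighborFinset_eq_degree, neighborFinset_eq_filter, sum_boole]
  -- Over ordered pairs, minus the pair sum is twice the cut edges minus twice the uncut ones, that
  -- is `4 * cut - 2 * m`.
  have hcut : ∀ X Y : Finset U, Disjoint X Y → X ∪ Y = univ → ∀ s : U → ℤ,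
      (∀ i ∈ X, s i = 1) → (∀ i ∈ Y, s i = -1) →
      -G.pairSum univ univ s s = 4 * cutSize G X Y - 2 * G.edgeSet.ncard := by
    intro X Y hd hu s hX hY
    have hc : (cutSize G X Y : ℤ) = G.pairSum X Y (fun _ => 1) fun _ => 1 := by
      simp only [cutSize, pairSum, interedges, Rel.interedges, mul_one]
      rw [card_filter, sum_product]
      push_cast
      rfl
    have h1 : G.pairSum X Y s s = -cutSize G X Y := by
      rw [hc, ← pairSum_neg_right]
      exact pairSum_congr hX hY
    have h2 : G.pairSum X X s s = G.pairSum X X (fun _ => 1) fun _ => 1 := pairSum_congr hX hX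
    have h3 : G.pairSum Y Y s s = G.pairSum Y Y (fun _ => 1) fun _ => 1 := by
      rw [pairSum_congr hY hY, pairSum_neg_right (t := fun _ => 1),
        pairSum_neg_left (s := fun _ => 1), neg_neg]
    have h4 : G.pairSum univ univ (fun _ => 1) (fun _ => 1) = 2 * G.edgeSet.ncard := by
      rw [← htotal]; simp [pairSum]
    rw [← hu, pairSum_union_self hd] at h4
    rw [← hu, pairSum_union_self hd]
    rw [h1, h2, h3]
    rw [← hc] at h4
    linarith
  -- The ceiling disappears because `c - k` is an integer.
  have hceil : ∀ m c : ℕ, ⌈(m : ℚ) / 2⌉₊ + k ≤ c ↔ 4 * (k : ℤ) ≤ 4 * c - 2 * m := by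
    intro m c
    constructor
    · intro h
      have h1 : (m : ℚ) / 2 ≤ ⌈(m : ℚ) / 2⌉₊ := Nat.le_ceil _
      have h2 : ((⌈(m : ℚ) / 2⌉₊ + k : ℕ) : ℚ) ≤ c := by exact_mod_cast h
      have h3 : (4 * k : ℚ) ≤ 4 * c - 2 * m := by push_cast at h2; linarith
      exact_mod_cast h3
    · intro h
      have h1 : ⌈(m : ℚ) / 2⌉₊ ≤ c - k := by
        rw [Nat.ceil_le, Nat.cast_sub (by omega)]
        have : (4 * k : ℚ) ≤ 4 * c - 2 * m := by exact_mod_cast h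
        linarith
      omega
  constructor
  · rintro ⟨X, Y, ⟨hd, hu, h1, h2⟩, h3⟩
    have eX : ∀ i ∈ X, (fun i => if i ∈ X then (1 : ℤ) else -1) i = 1 := fun i hi => by simp [hi]
    have eY : ∀ i ∈ Y, (fun i => if i ∈ X then (1 : ℤ) else -1) i = -1 := fun i hi => by
      simp [Finset.disjoint_right.1 hd hi]
    refine ⟨fun i => if i ∈ X then 1 else -1, fun i => by dsimp only; split_ifs <;> simp, ?_, ?_⟩
    · rw [← hu, sum_union hd, sum_congr rfl eX, sum_congr rfl eY, abs_le]
      simp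
      omega
    · rw [hcut X Y hd hu _ eX eY]
      exact (hceil _ _).1 (by convert h3)
  · rintro ⟨s, s1, s2, s3⟩
    -- Negating the signs exchanges the two sides; the first one must not be the larger.
    wlog hs : ∑ i, s i ≤ 0 generalizing s
    · refine this (fun i => -s i) (fun i => ?_) (by simpa using s2) ?_ (by simp; omega)
      · rcases s1 i with h | h <;> simp [h]
      · rwa [pairSum_neg_left, pairSum_neg_right, neg_neg]
    have hd : Disjoint ({i | s i = 1} : Finset U) ({i | s i = -1} : Finset U) :=
      disjoint_filter.2 fun i _ h h' => by omega
    have hu : ({i | s i = 1} : Finset U) ∪ ({i | s i = -1} : Finset U) = univ := by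
      ext i; simpa using s1 i
    have eX : ∀ i ∈ ({i | s i = 1} : Finset U), s i = 1 := by simp
    have eY : ∀ i ∈ ({i | s i = -1} : Finset U), s i = -1 := by simp
    have hsum : ∑ i, s i = #({i | s i = 1} : Finset U) - #({i | s i = -1} : Finset U) := by
      have h1 : ∑ i, s i = ∑ i ∈ ({i | s i = 1} : Finset U) ∪ ({i | s i = -1} : Finset U), s i := by
        rw [hu]
      rw [h1, sum_union hd, sum_congr rfl eX, sum_congr rfl eY]
      simp [sub_eq_add_neg]
    rw [abs_le] at s2
    refine ⟨({i | s i = 1} : Finset U), ({i | s i = -1} : Finset U), ⟨hd, ?_, ?_, ?_⟩, ?_⟩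
    · convert hu
    · omega
    · omega
    · rw [hcut _ _ hd hu s eX eY] at s3
      exact (hceil _ _).2 s3

/-- A graph has the same bisections as its image, where an isolated vertex is added if the number of
vertices is odd. -/
theorem hasBisectionATLB_iff_hasSigning {U V : Type*} [Fintype U] [DecidableEq U]
    [DecidableEq V] (G : SimpleGraph U) (H : SimpleGraph V) (f : U ↪ V) (hf : ∀ i j, H.Adj (f i) (f j) ↔ G.Adj i j)
    (K : Finset V) (hK : Even #K) (hKf : K = univ.map f ∨
      ∃ z ∉ univ.map f, (∀ i, ¬H.Adj z (f i)) ∧ K = {z} ∪ univ.map f) (k : ℕ) :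
    HasBisectionATLB G k ↔ H.HasSigning K (4 * k) := by
  rw [hasBisectionATLB_iff]
  have hpair : ∀ s : V → ℤ, H.pairSum (univ.map f) (univ.map f) s s =
      G.pairSum univ univ (fun i => s (f i)) fun i => s (f i) := by
    intro s
    simp only [pairSum, sum_map, hf]
  have hpar : ∀ s : U → ℤ, (∀ i, s i = 1 ∨ s i = -1) →
      ∀ X : Finset U, Even (∑ i ∈ X, s i + #X) := by
    intro s hs X
    induction X using Finset.induction_on with
    | empty => simp
    | insert i X hi ih =>
      obtain ⟨n, hn⟩ := ih
      rw [sum_insert hi, card_insert_of_notMem hi]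
      push_cast
      rcases hs i with h | h <;> rw [h]
      · exact ⟨n + 1, by omega⟩
      · exact ⟨n, by omega⟩
  -- A possible additional vertex gets minus the sum of the signs. For odd order that sum is odd and
  -- at most 1 in absolute value, so this is a sign and balances the total.
  have hext : ∀ s : U → ℤ, ∃ t : V → ℤ, (∀ i, t (f i) = s i) ∧
      ∀ z ∉ univ.map f, t z = -∑ i, s i := by
    intro s
    refine ⟨fun v => if h : ∃ i, f i = v then s h.choose else -∑ i, s i, fun i => ?_, fun z hz => ?_⟩
    · have h : ∃ j, f j = f i := ⟨i, rfl⟩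
      simp only [dif_pos h]
      rw [f.injective h.choose_spec]
    · have h : ¬∃ i, f i = z := by simpa using hz
      simp only [dif_neg h]
  rcases hKf with rfl | ⟨z, hz, hzf, rfl⟩
  · rw [card_map] at hK
    obtain ⟨m, hm⟩ := hK
    constructor
    · rintro ⟨s, s1, s2, s3⟩
      obtain ⟨t, t1, _⟩ := hext s
      obtain ⟨n, hn⟩ := hpar s s1 univ
      rw [abs_le] at s2
      refine ⟨t, ?_, ?_, ?_⟩
      · simpa [t1] using s1
      · simp only [sum_map, t1]; omega
      · rw [hpair]; simpa only [t1] using s3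
    · rintro ⟨t, t1, t2, t3⟩
      rw [sum_map] at t2
      exact ⟨fun i => t (f i), fun i => t1 (f i) (by simp), by rw [t2]; simp, by rwa [hpair] at t3⟩
  · have hd : Disjoint {z} (univ.map f) := by simpa using hz
    rw [card_union_of_disjoint hd, card_map, card_singleton] at hK
    obtain ⟨m, hm⟩ := hK
    have hq : ∀ t : V → ℤ, H.pairSum ({z} ∪ univ.map f) ({z} ∪ univ.map f) t t =
        G.pairSum univ univ (fun i => t (f i)) fun i => t (f i) := by
      intro t
      rw [pairSum_union_self hd, hpair, pairSum_eq_zero (K := {z}) (L := {z}) (by simp),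
        pairSum_eq_zero (K := {z}) (L := univ.map f) (by simpa using hzf)]
      ring
    constructor
    · rintro ⟨s, s1, s2, s3⟩
      obtain ⟨t, t1, t2⟩ := hext s
      obtain ⟨n, hn⟩ := hpar s s1 univ
      rw [abs_le] at s2
      refine ⟨t, fun i hi => ?_, ?_, ?_⟩
      · rcases mem_union.1 hi with hi | hi
        · rw [mem_singleton.1 hi, t2 z hz]; omega
        · obtain ⟨j, _, rfl⟩ := mem_map.1 hi
          rw [t1]; exact s1 j
      · rw [sum_union hd, sum_singleton, sum_map, t2 z hz]; simp [t1]
      · rw [hq]; simpa only [t1] using s3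
    · rintro ⟨t, t1, t2, t3⟩
      rw [sum_union hd, sum_singleton, sum_map] at t2
      refine ⟨fun i => t (f i), fun i => t1 (f i) (by simp), ?_, by rwa [hq] at t3⟩
      rw [abs_le]
      beta_reduce
      rcases t1 z (by simp) with h | h <;> omega

end SimpleGraph

/-! ### Reading an instance from its encoding -/

theorem List.getElem?_flatMap_of_length_eq {α β : Type*} (f : α → List β) (c : ℕ)
    (hf : ∀ x, (f x).length = c) (l : List α) (i j : ℕ) (hj : j < c) :
    (l.flatMap f)[i * c + j]? = l[i]?.bind fun x => (f x)[j]? := by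
  induction l generalizing i with
  | nil => simp
  | cons a l ih =>
    rw [List.flatMap_cons]
    rcases i with _ | i
    · rw [List.getElem?_append_left (by rw [hf]; omega)]
      simp
    · rw [List.getElem?_append_right (by rw [hf, Nat.add_one_mul]; omega), hf, Nat.add_one_mul,
        show i * c + c + j - c = i * c + j by omega, ih]
      simp

theorem List.flatMap_filter_eq {α β : Type*} (p : α → Bool) (f : α → List β) (l : List α) :
    (l.filter p).flatMap f = l.flatMap fun x => if p x then f x else [] := by
  induction l with
  | nil => rfl
  | cons a l ih => by_cases h : p a = true <;> simp [h, ih]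

theorem List.sum_range_any_getElem? {α : Type*} (p : α → Bool) (l : List α) :
    ∑ i ∈ Finset.range l.length, (if (l[i]?).any p then 1 else 0) = l.countP p := by
  induction l with
  | nil => simp
  | cons a l ih =>
    rw [List.length_cons, Finset.sum_range_succ', List.countP_cons]
    simp only [List.getElem?_cons_succ, ih]
    simp

/-- The number with the given binary digits, least significant digit first. -/
def ofBits (l : List Bool) : ℕ := l.foldr (fun b n => b.toNat + 2 * n) 0

theorem ofBits_encodeNat (k : ℕ) : ofBits (Computability.encodeNat k) = k := by
  have h : ∀ p : PosNum, ofBits (Computability.encodePosNum p) = (p : ℕ) := by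
    intro p
    induction p with
    | one => rfl
    | bit0 p ih =>
      rw [Computability.encodePosNum, ofBits, List.foldr_cons, PosNum.cast_bit0, ← ih]
      simp [ofBits]; omega
    | bit1 p ih =>
      rw [Computability.encodePosNum, ofBits, List.foldr_cons, PosNum.cast_bit1, ← ih]
      simp [ofBits]; omega
  rw [Computability.encodeNat]
  conv_rhs => rw [← Num.to_of_nat k]
  rcases (k : Num) with _ | p
  · rfl
  · exact h p

theorem length_encodeNat_le (k : ℕ) : (Computability.encodeNat k).length ≤ k := by
  have h : ∀ p : PosNum, (Computability.encodePosNum p).length ≤ (p : ℕ) := by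
    intro p
    induction p with
    | one => simp [Computability.encodePosNum]
    | bit0 p ih =>
      have := PosNum.cast_pos (α := ℕ) p
      rw [Computability.encodePosNum, List.length_cons, PosNum.cast_bit0]
      omega
    | bit1 p ih =>
      rw [Computability.encodePosNum, List.length_cons, PosNum.cast_bit1]
      omega
  rw [Computability.encodeNat]
  conv_rhs => rw [← Num.to_of_nat k]
  rcases (k : Num) with _ | p
  · rfl
  · exact h p

/-! ### The kernel as a graph on natural numbers -/

namespace FinGraph

open Classical

/-- The graph as a graph on the natural numbers. -/
def natGraph (G : FinGraph) : SimpleGraph ℕ := G.graph.map Fin.valEmbedding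

/-- The number of vertices, made even by an additional vertex if necessary. -/
def evenOrder (G : FinGraph) : ℕ := G.n + G.n % 2

theorem natGraph_adj (G : FinGraph) (i j : Fin G.n) :
    G.natGraph.Adj i j ↔ G.graph.Adj i j :=
  SimpleGraph.map_adj_apply (f := Fin.valEmbedding)

theorem lt_of_natGraph_adj {G : FinGraph} {i j : ℕ} (h : G.natGraph.Adj i j) :
    i < G.n ∧ j < G.n := by
  obtain ⟨u, v, -, rfl, rfl⟩ := (SimpleGraph.map_adj ..).1 h
  exact ⟨u.2, v.2⟩

theorem length_encode (G : FinGraph) : G.encode.length = G.n * (G.n + 1) := by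
  simp [encode, List.length_flatMap]

theorem countP_encode (G : FinGraph) : G.encode.countP (fun a => decide (a = none)) = G.n := by
  rw [encode, List.countP_flatMap]
  simp [Function.comp_def, List.countP_append, List.countP_map]

/-- The range `j ≤ G.n` includes the additional vertex: column `G.n` consists of row separators and
row `G.n` begins after the end of the string, so it reads as isolated without a case distinction. -/
theorem encode_getElem? (G : FinGraph) {i j : ℕ} (hj : j ≤ G.n) :
    G.encode[i * (G.n + 1) + j]? = some (some true) ↔ G.natGraph.Adj i j := by
  rw [encode, List.getElem?_flatMap_of_length_eq _ (G.n + 1) (by simp) _ _ _ (by omega)]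
  rcases Nat.lt_or_ge i G.n with hi | hi
  · rw [List.getElem?_eq_getElem (by simpa using hi), Option.bind_some, List.getElem_finRange]
    rcases Nat.lt_or_ge j G.n with hj' | hj'
    · rw [List.getElem?_append_left (by simpa using hj')]
      simp only [List.getElem?_map]
      rw [List.getElem?_eq_getElem (by simpa using hj')]
      simpa using (G.natGraph_adj ⟨i, hi⟩ ⟨j, hj'⟩).symm
    · rw [List.getElem?_append_right (by simpa using hj')]
      have h1 : ¬G.natGraph.Adj i j := fun h => by have := lt_of_natGraph_adj h; omega
      simp [show j - G.n = 0 by omega, h1]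
  · have h1 : ¬G.natGraph.Adj i j := fun h => by have := lt_of_natGraph_adj h; omega
    rw [List.getElem?_eq_none (by simpa using hi)]
    simp [h1]

/-- The vertices of the even order. -/
abbrev verts (G : FinGraph) : Finset ℕ := Finset.range G.evenOrder

theorem even_card_verts (G : FinGraph) : Even G.verts.card := by
  rw [Finset.card_range, evenOrder, Nat.even_iff]; omega

theorem hasBisection_iff_verts (G : FinGraph) (k : ℕ) :
    HasBisectionATLB G.graph k ↔ G.natGraph.HasSigning G.verts (4 * k) := by
  have hmap : Finset.univ.map (Fin.valEmbedding (n := G.n)) = Finset.range G.n := by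
    ext i
    simp only [Finset.mem_map, Finset.mem_univ, true_and, Finset.mem_range]
    exact ⟨fun ⟨j, hj⟩ => hj ▸ j.2, fun h => ⟨⟨i, h⟩, rfl⟩⟩
  refine SimpleGraph.hasBisectionATLB_iff_hasSigning G.graph G.natGraph Fin.valEmbedding
    G.natGraph_adj _ G.even_card_verts ?_ k
  rcases Nat.mod_two_eq_zero_or_one G.n with h | h
  · left; rw [hmap, verts, evenOrder, h, add_zero]
  · right
    refine ⟨G.n, by simp [hmap], fun i hi => ?_, ?_⟩
    · exact absurd (lt_of_natGraph_adj hi).1 (lt_irrefl _)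
    · rw [hmap, verts, evenOrder, h, Finset.range_add_one, Finset.insert_eq]

/-- The vertices kept by the kernelization. -/
noncomputable abbrev kept (G : FinGraph) : Finset ℕ := G.natGraph.trim G.verts

/-- The list of the kept vertices. -/
noncomputable def keptList (G : FinGraph) : List ℕ :=
  (List.range G.evenOrder).filter fun i => decide (i ∈ G.kept)

theorem mem_keptList {G : FinGraph} {i : ℕ} : i ∈ G.keptList ↔ i ∈ G.kept := by
  simp only [keptList, List.mem_filter, List.mem_range, decide_eq_true_eq, and_iff_right_iff_imp]
  exact fun h => Finset.mem_range.1 (SimpleGraph.trim_subset h)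

theorem nodup_keptList (G : FinGraph) : G.keptList.Nodup := List.nodup_range.filter _

theorem length_keptList (G : FinGraph) : G.keptList.length = G.kept.card := by
  rw [← List.toFinset_card_of_nodup G.nodup_keptList]
  congr 1
  ext i
  simp [mem_keptList]

/-- The graph induced on the kept vertices. -/
noncomputable def trimmed (G : FinGraph) : FinGraph where
  n := G.keptList.length
  graph := G.natGraph.comap fun i : Fin _ => G.keptList.get i

theorem trimmed_encode (G : FinGraph) : G.trimmed.encode = G.keptList.flatMap fun i =>
    (G.keptList.map fun j => some (decide (G.natGraph.Adj i j))) ++ [none] := by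
  have h : ∀ {β : Type} (f : ℕ → List β), G.keptList.flatMap f =
      (List.finRange G.keptList.length).flatMap fun i => f (G.keptList.get i) := by
    intro β f
    conv_lhs => rw [← List.map_get_finRange G.keptList, List.flatMap_map]
  have h' : ∀ {β : Type} (f : ℕ → β), G.keptList.map f =
      (List.finRange G.keptList.length).map fun i => f (G.keptList.get i) := by
    intro β f
    conv_lhs => rw [← List.map_get_finRange G.keptList, List.map_map]
    rfl
  rw [h, encode]
  simp only [h']
  rfl

theorem hasBisection_trimmed_iff (G : FinGraph) (k : ℕ) :
    HasBisectionATLB G.trimmed.graph k ↔ HasBisectionATLB G.graph k := by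
  rw [hasBisection_iff_verts G, ← SimpleGraph.hasSigning_trim_iff G.even_card_verts]
  refine SimpleGraph.hasBisectionATLB_iff_hasSigning G.trimmed.graph G.natGraph
    ⟨G.keptList.get, G.nodup_keptList.injective_get⟩ (fun i j => Iff.rfl) _
    (SimpleGraph.even_card_trim G.even_card_verts) (Or.inl ?_) k
  ext i
  rw [← mem_keptList, List.mem_iff_get]
  simp only [Finset.mem_map, Finset.mem_univ, true_and]
  rfl

/-- The number of ordered adjacent pairs of kept vertices. -/
noncomputable def keptPairs (G : FinGraph) : ℕ :=
  ((G.kept ×ˢ G.kept).filter fun p => G.natGraph.Adj p.1 p.2).card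

theorem two_mul_numEdges (G : FinGraph) : 2 * G.numEdges =
    ∑ i : Fin G.n, ∑ j : Fin G.n, if G.graph.Adj i j then 1 else 0 := by
  have h1 := G.graph.sum_degrees_eq_twice_card_edges
  rw [← Set.ncard_coe_finset, SimpleGraph.coe_edgeFinset] at h1
  rw [numEdges, ← h1]
  refine Finset.sum_congr rfl fun i _ => ?_
  rw [← SimpleGraph.card_neighborFinset_eq_degree, SimpleGraph.neighborFinset_eq_filter,
    Finset.card_filter]

theorem two_mul_numEdges_trimmed (G : FinGraph) : 2 * G.trimmed.numEdges = G.keptPairs := by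
  have hs : ∀ f : ℕ → ℕ, ∑ i : Fin G.keptList.length, f (G.keptList.get i) =
      ∑ i ∈ G.kept, f i := by
    intro f
    have h : G.kept = Finset.univ.map ⟨G.keptList.get, G.nodup_keptList.injective_get⟩ := by
      ext i
      rw [← mem_keptList, List.mem_iff_get]
      simp only [Finset.mem_map, Finset.mem_univ, true_and]
      rfl
    rw [h, Finset.sum_map]
    rfl
  rw [two_mul_numEdges, keptPairs, Finset.card_filter, Finset.sum_product, ← hs]
  refine Finset.sum_congr rfl fun i _ => ?_
  rw [← hs]
  rfl

theorem keptPairs_le_length_encode (G : FinGraph) : G.keptPairs ≤ G.encode.length := by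
  have h : ((G.kept ×ˢ G.kept).filter fun p => G.natGraph.Adj p.1 p.2) ⊆
      Finset.range G.n ×ˢ Finset.range G.n := by
    rintro ⟨i, j⟩ hp
    have := lt_of_natGraph_adj (Finset.mem_filter.1 hp).2
    simpa using this
  refine (Finset.card_le_card h).trans ?_
  rw [Finset.card_product, Finset.card_range, length_encode]
  exact Nat.mul_le_mul_left _ (by omega)

theorem card_kept_le (G : FinGraph) : G.kept.card ≤ G.n + 1 := by
  refine (Finset.card_le_card SimpleGraph.trim_subset).trans ?_
  rw [Finset.card_range, evenOrder]; omega

/-- The kernel is too large for a no-instance. -/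
def TooLarge (G : FinGraph) (k : ℕ) : Prop :=
  4 * k * (k + 1) < G.kept.card ∨ 64 * k ^ 3 < G.keptPairs

theorem hasBisection_of_tooLarge {G : FinGraph} {k : ℕ} (h : G.TooLarge k) :
    HasBisectionATLB G.graph k := by
  by_contra hcon
  rw [hasBisection_iff_verts] at hcon
  have := SimpleGraph.card_trim_le G.even_card_verts hcon
  rcases h with h | h
  · exact absurd this.1 (not_le.2 h)
  · exact absurd this.2 (not_le.2 h)

/-- The kernelization. -/
noncomputable def kernel (x : FinGraph × ℕ) : FinGraph × ℕ :=
  if x.1.TooLarge x.2 then (⟨0, ⊥⟩, 0) else (x.1.trimmed, x.2)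

end FinGraph

/-! ### The program of the kernelization -/

namespace BisecProg

open StackProg Function Classical

/-- The registers. -/
abbrev Reg := Fin 32

/-- The encoding of an instance. -/
noncomputable def input (G : FinGraph) (k : ℕ) : List Sym :=
  (Computability.encodeNat k).map Sum.inl ++ G.encode.map Sum.inr

theorem length_input (G : FinGraph) (k : ℕ) :
    (input G k).length = (Computability.encodeNat k).length + G.encode.length := by
  simp [input]

theorem input_getElem?_left (G : FinGraph) (k : ℕ) {i : ℕ}
    (hi : i < (Computability.encodeNat k).length) :
    (input G k)[i]? = some (Sum.inl (Computability.encodeNat k)[i]) := by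
  rw [input, List.getElem?_append_left (by simpa using hi)]
  simp [hi]

theorem input_getElem?_right (G : FinGraph) (k i : ℕ) :
    (input G k)[(Computability.encodeNat k).length + i]? = G.encode[i]?.map Sum.inr := by
  rw [input, List.getElem?_append_right (by simp)]
  simp

/-- The test whether a symbol is a given one. -/
def isSym (a : Sym) (b : Sym) : Bool := decide (b = a)

/-- The registers 0, 2, 3 hold the length of the parameter, the number of vertices (including the
isolated one that makes it even), and the length of the rows of the adjacency matrix. -/
structure Ready (G : FinGraph) (k : ℕ) (env : Reg → ℕ) : Prop where
  bits : env 0 = (Computability.encodeNat k).length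
  order : env 2 = G.evenOrder
  stride : env 3 = G.n + 1

variable {G : FinGraph} {k : ℕ} {env : Reg → ℕ}

theorem Ready.update (h : Ready G k env) {x : Reg} (hx : 3 < x) (v : ℕ) :
    Ready G k (update env x v) := by
  have h0 : (0 : Reg) ≠ x := by rintro rfl; exact absurd hx (by decide)
  have h2 : (2 : Reg) ≠ x := by rintro rfl; exact absurd hx (by decide)
  have h3 : (3 : Reg) ≠ x := by rintro rfl; exact absurd hx (by decide)
  exact ⟨by simpa [h0] using h.bits, by simpa [h2] using h.order, by simpa [h3] using h.stride⟩

open Exp in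
/-- Multiplication, by means of the auxiliary register `x`. -/
def mulE (x : Reg) (e f : Exp Reg) : Exp Reg := sum x e f

theorem eval_mulE {w : List Sym} {x : Reg} {e f : Exp Reg} {a : ℕ}
    (hf : ∀ i, f.eval w (update env x i) = a) : (mulE x e f).eval w env = e.eval w env * a := by
  simp [mulE, Exp.eval, hf]

/-- The truth value of `e < f`. -/
def ltE (e f : Exp Reg) : Exp Reg := .sub (.const 1) (.sub (.const 1) (.sub f e))

theorem eval_ltE {w : List Sym} {e f : Exp Reg} :
    (ltE e f).eval w env = if e.eval w env < f.eval w env then 1 else 0 := by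
  simp only [ltE, Exp.eval]
  split_ifs <;> omega

/-- The distance of two numbers. -/
def distE (e f : Exp Reg) : Exp Reg := .add (.sub e f) (.sub f e)

/-- The truth value of `e = f`. -/
def eqE (e f : Exp Reg) : Exp Reg := .sub (.const 1) (distE e f)

theorem eval_eqE {w : List Sym} {e f : Exp Reg} :
    (eqE e f).eval w env = if e.eval w env = f.eval w env then 1 else 0 := by
  simp only [eqE, distE, Exp.eval]
  split_ifs <;> omega

/-- The entry of the adjacency matrix at the vertices in the registers `i` and `j`. -/
def adjE (i j : Reg) : Exp Reg :=
  .inp (isSym (Sum.inr (some true))) (.add (.var 0) (.add (mulE 31 (.var i) (.var 3)) (.var j)))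

/-- The row separator makes the stride `G.n + 1`, and the bits of the parameter precede the matrix.
Even order exceeds `G.n` by at most 1, so `encode_getElem?` covers all vertices. -/
theorem eval_adjE (h : Ready G k env) {i j : Reg} (hj : env j < G.evenOrder) :
    (adjE i j).eval (input G k) env = if G.natGraph.Adj (env i) (env j) then 1 else 0 := by
  have hj' : env j ≤ G.n := by rw [FinGraph.evenOrder] at hj; omega
  have h1 : (mulE 31 (.var i) (.var 3)).eval (input G k) env = env i * (G.n + 1) := by
    rw [eval_mulE (a := G.n + 1)]
    · rfl
    · exact fun v => (h.update (by decide) v).stride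
  simp only [adjE, Exp.eval, h1, h.bits, input_getElem?_right, ← FinGraph.encode_getElem? G hj']
  congr 1
  rw [Option.any_map, eq_iff_iff]
  rcases G.encode[env i * (G.n + 1) + env j]? with _ | _ | _ | _ <;> simp [isSym]

/-- The truth value of the vertices in the registers `i` and `j` being twins. -/
def twinE (i j : Reg) : Exp Reg :=
  .sub (.const 1) (.sum 30 (.var 2) (distE (adjE i 30) (adjE j 30)))

theorem eval_twinE (h : Ready G k env) {i j : Reg} (hi : i ≠ 30) (hj : j ≠ 30) :
    (twinE i j).eval (input G k) env =
      if ∀ l ∈ G.verts, G.natGraph.Adj (env i) l ↔ G.natGraph.Adj (env j) l then 1 else 0 := by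
  have h1 : ∀ l ∈ Finset.range G.evenOrder,
      (distE (adjE i 30) (adjE j 30)).eval (input G k) (update env 30 l) =
      if G.natGraph.Adj (env i) l ↔ G.natGraph.Adj (env j) l then 0 else 1 := by
    intro l hl
    have hl' : (Function.update env 30 l) 30 < G.evenOrder := by simpa using hl
    simp only [distE, Exp.eval, eval_adjE (h.update (x := 30) (by decide) l) hl', update_self,
      update_of_ne hi, update_of_ne hj]
    by_cases h2 : G.natGraph.Adj (env i) l <;> by_cases h3 : G.natGraph.Adj (env j) l <;>
      simp [h2, h3]
  simp only [twinE, Exp.eval, h.order]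
  rw [Finset.sum_congr rfl h1]
  split_ifs with h2
  · rw [Finset.sum_eq_zero fun l hl => if_pos (h2 l hl), Nat.sub_zero]
  · push Not at h2
    obtain ⟨l, hl, h2⟩ := h2
    have h3 : ¬(G.natGraph.Adj (env i) l ↔ G.natGraph.Adj (env j) l) := by tauto
    have h4 : 1 ≤ ∑ l ∈ Finset.range G.evenOrder,
        if G.natGraph.Adj (env i) l ↔ G.natGraph.Adj (env j) l then 0 else 1 := by
      refine le_trans ?_ (Finset.single_le_sum (fun _ _ => Nat.zero_le _) hl)
      rw [if_neg h3]
    omega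

/-- The truth value of the vertex in the register `j` being kept. -/
def keepE (j : Reg) : Exp Reg :=
  ltE (.sum 29 (.var j) (twinE 29 j)) (.sub (.var 2) (.sum 29 (.var 2) (twinE 29 j)))

theorem eval_keepE (h : Ready G k env) {j : Reg} (hj29 : j ≠ 29) (hj30 : j ≠ 30)
    (hj : env j < G.evenOrder) :
    (keepE j).eval (input G k) env = if env j ∈ G.kept then 1 else 0 := by
  have h1 : ∀ i, (twinE 29 j).eval (input G k) (update env 29 i) =
      if ∀ l ∈ G.verts, G.natGraph.Adj i l ↔ G.natGraph.Adj (env j) l then 1 else 0 := by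
    intro i
    rw [eval_twinE (h.update (x := 29) (by decide) i) (by decide) hj30]
    simp only [update_self, update_of_ne hj29]
  simp only [keepE, eval_ltE, Exp.eval, h1, h.order, ← Finset.card_filter]
  have h2 : (Finset.range G.evenOrder).filter (fun i => ∀ l ∈ G.verts,
      G.natGraph.Adj i l ↔ G.natGraph.Adj (env j) l) = G.natGraph.twins G.verts (env j) := rfl
  have h3 : (Finset.range (env j)).filter (fun i => ∀ l ∈ G.verts,
      G.natGraph.Adj i l ↔ G.natGraph.Adj (env j) l) =
      (G.natGraph.twins G.verts (env j)).filter fun i => i < env j := by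
    ext i
    simp only [SimpleGraph.twins, Finset.mem_filter, Finset.mem_range]
    constructor
    · rintro ⟨h1, h2⟩; exact ⟨⟨by omega, h2⟩, h1⟩
    · rintro ⟨⟨_, h2⟩, h1⟩; exact ⟨h1, h2⟩
  have h4 := Finset.card_sdiff_of_subset (SimpleGraph.twins_subset (H := G.natGraph)
    (K := G.verts) (env j))
  rw [Finset.card_range] at h4
  have h5 : env j ∈ G.kept ↔ ((G.natGraph.twins G.verts (env j)).filter fun i => i < env j).card <
      (G.verts \ G.natGraph.twins G.verts (env j)).card := by
    simp [SimpleGraph.trim, hj]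
  rw [h2, h3, ← h4]
  simp only [h5]

/-- The sum of an expression over all kept vertices, by means of the registers `x` and `y`. -/
def sumKept (x y : Reg) (e : Exp Reg) : Exp Reg := .sum x (.var 2) (mulE y (keepE x) e)

/-- The factor `keepE x` serves as the number of repetitions of `e`, so `e` matters only at kept
vertices. -/
theorem eval_sumKept (h : Ready G k env) {x y : Reg} {e : Exp Reg} {f : ℕ → ℕ} (hx : 3 < x)
    (hx29 : x ≠ 29) (hx30 : x ≠ 30)
    (he : ∀ i ∈ G.kept, ∀ v, e.eval (input G k) (update (update env x i) y v) = f i) :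
    (sumKept x y e).eval (input G k) env = ∑ i ∈ G.kept, f i := by
  simp only [sumKept, Exp.eval, h.order]
  have hsub : (Finset.range G.evenOrder).filter (fun i => i ∈ G.kept) = G.kept := by
    ext i
    simp only [Finset.mem_filter, and_iff_right_iff_imp]
    exact fun hi => SimpleGraph.trim_subset hi
  conv_rhs => rw [← hsub, Finset.sum_filter]
  refine Finset.sum_congr rfl fun i hi => ?_
  have hk : (keepE x).eval (input G k) (update env x i) = if i ∈ G.kept then 1 else 0 := by
    rw [eval_keepE (h.update hx i) hx29 hx30 (by simpa using hi), update_self]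
  simp only [mulE, Exp.eval, hk]
  split_ifs with hik
  · simp [he i hik]
  · simp

/-- The number of kept vertices. -/
def cntE : Exp Reg := sumKept 28 26 (.const 1)

theorem eval_cntE (h : Ready G k env) : cntE.eval (input G k) env = G.kept.card := by
  rw [cntE, eval_sumKept h (f := fun _ => 1) (by decide) (by decide) (by decide)
    (fun _ _ _ => rfl)]
  simp

/-- The sum of an expression over all ordered adjacent pairs of kept vertices. -/
def sumPairs (e : Exp Reg) : Exp Reg :=
  sumKept 28 26 (sumKept 27 26 (mulE 25 (adjE 28 27) e))

/-- Registers from 25 on serve as bound variables. The summand may therefore be evaluated in any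
state that agrees below 25 and holds the pair in 28 and 27. -/
theorem eval_sumPairs (h : Ready G k env) {e : Exp Reg} {f : ℕ → ℕ → ℕ}
    (he : ∀ i ∈ G.kept, ∀ j ∈ G.kept, ∀ env' : Reg → ℕ, env' 28 = i → env' 27 = j →
      (∀ x < 25, env' x = env x) → e.eval (input G k) env' = f i j) :
    (sumPairs e).eval (input G k) env =
      ∑ i ∈ G.kept, ∑ j ∈ G.kept, if G.natGraph.Adj i j then f i j else 0 := by
  have hlt : ∀ j ∈ G.kept, j < G.evenOrder := fun j hj =>
    Finset.mem_range.1 (SimpleGraph.trim_subset hj)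
  refine eval_sumKept h (by decide) (by decide) (by decide) fun i hi v => ?_
  have h1 := (h.update (x := 28) (by decide) i).update (x := 26) (by decide) v
  refine eval_sumKept h1 (by decide) (by decide) (by decide) fun j hj v' => ?_
  have h2 := (h1.update (x := 27) (by decide) j).update (x := 26) (by decide) v'
  have h3 : (adjE 28 27).eval (input G k)
      (update (update (update (update env 28 i) 26 v) 27 j) 26 v') =
      if G.natGraph.Adj i j then 1 else 0 := by
    rw [eval_adjE h2 (by simpa using hlt j hj)]
    simp
  rw [eval_mulE (a := f i j), h3]
  · split_ifs <;> simp
  · intro v''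
    refine he i hi j hj _ (by simp) (by simp) fun x hx => ?_
    have : x ≠ 25 ∧ x ≠ 26 ∧ x ≠ 27 ∧ x ≠ 28 := by revert x; decide
    simp [this]

end BisecProg

/-! ### The effect of loops on registers and output -/

namespace StackProg

open Function

variable {V B : Type} [DecidableEq V] {w : List Sym}

/-- The loop acts on `x` by iterating `g`; the final value of the loop variable `y` is of no
interest. -/
theorem Prog.run_loop_assign {x y : V} {e f : Exp V} {env : V → ℕ} {o : List B}
    {g : ℕ → ℕ → ℕ} (hxy : x ≠ y)
    (hf : ∀ i < e.eval w env, ∀ a, f.eval w (update (update env x a) y i) = g i a) :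
    ∃ v, (loop y e (assign x f) : Prog V B).run w (env, o) =
      (update (update env x (iterDown g (e.eval w env) (env x))) y v, o) := by
  have key : ∀ n ≤ e.eval w env, ∀ a v, ∃ v',
      iterDown (fun i s => (assign x f : Prog V B).run w (update s.1 y i, s.2)) n
        (update (update env x a) y v, o) = (update (update env x (iterDown g n a)) y v', o) := by
    intro n
    induction n with
    | zero => exact fun _ a v => ⟨v, rfl⟩
    | succ n ih =>
      intro hn a v
      obtain ⟨v', h⟩ := ih (by omega) (g n a) n
      refine ⟨v', ?_⟩
      rw [iterDown, iterDown, ← h]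
      congr 1
      simp only [run, update_idem, hf n (by omega)]
      rw [update_comm hxy.symm n (g n a) (update env x a), update_idem]
  obtain ⟨v, h⟩ := key _ le_rfl (env x) (env y)
  refine ⟨v, ?_⟩
  rw [← h, update_eq_self, update_eq_self]
  rfl

/-- Indices decrease and each pass writes in front of the earlier output, so the pieces end up in
increasing order. -/
theorem Prog.run_loop_emit {x : V} {e : Exp V} {P : Prog V B} (I : (V → ℕ) → Prop)
    {g : ℕ → List B} {env : V → ℕ} {o : List B} (hI : I env)
    (hP : ∀ i < e.eval w env, ∀ env o, I env →
      ∃ env', P.run w (update env x i, o) = (env', g i ++ o) ∧ I env') :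
    ∃ env', (loop x e P).run w (env, o) =
      (env', (List.range (e.eval w env)).flatMap g ++ o) ∧ I env' := by
  have key : ∀ n ≤ e.eval w env, ∀ env o, I env → ∃ env',
      iterDown (fun i s => P.run w (update s.1 x i, s.2)) n (env, o) =
        (env', (List.range n).flatMap g ++ o) ∧ I env' := by
    intro n
    induction n with
    | zero => exact fun _ env o h => ⟨env, rfl, h⟩
    | succ n ih =>
      intro hn env o h
      obtain ⟨env', h1, h2⟩ := hP n (by omega) env o h
      obtain ⟨env'', h3, h4⟩ := ih (by omega) env' (g n ++ o) h2
      refine ⟨env'', ?_, h4⟩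
      rw [iterDown, h1, h3, List.range_succ, List.flatMap_append]
      simp
  exact key _ le_rfl env o hI

theorem _root_.List.flatMap_range_getElem? {α : Type*} (l : List α) :
    (List.range l.length).flatMap (fun i => l[i]?.toList) = l := by
  induction l with
  | nil => rfl
  | cons a l ih =>
    rw [List.length_cons, List.range_succ_eq_map, List.flatMap_cons, List.flatMap_map]
    simpa using ih

theorem iterDown_one_sub (n : ℕ) {a : ℕ} (ha : a ≤ 1) :
    iterDown (fun _ a => 1 - a) n a = (n + a) % 2 := by
  induction n generalizing a with
  | zero => simp only [iterDown]; omega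
  | succ n ih => rw [iterDown, ih (by omega)]; omega

theorem iterDown_mul (d : ℕ → ℕ) (n a : ℕ) :
    iterDown (fun i a => a * d i) n a = a * ∏ i ∈ Finset.range n, d i := by
  induction n generalizing a with
  | zero => simp [iterDown]
  | succ n ih => rw [iterDown, ih, Finset.prod_range_succ]; ring

/-- Horner's rule from the most significant digit. Capping at every step is the same as capping at
the end, since doubling and adding a digit cannot bring a capped value below `c` again. -/
theorem iterDown_bits (l : List Bool) (c : ℕ) :
    iterDown (fun i a => min (2 * a + if l[i]? = some true then 1 else 0) c) l.length 0 =
      min (ofBits l) c := by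
  have key : ∀ n ≤ l.length, iterDown (fun i a => min (2 * a +
      if l[i]? = some true then 1 else 0) c) n (min (ofBits (l.drop n)) c) = min (ofBits l) c := by
    intro n
    induction n with
    | zero => intro _; rfl
    | succ n ih =>
      intro hn
      rw [iterDown, ← ih (by omega)]
      congr 1
      rw [List.drop_eq_getElem_cons (by omega : n < l.length),
        List.getElem?_eq_getElem (by omega)]
      simp only [ofBits, List.foldr_cons]
      cases l[n] <;> simp <;> omega
  simpa [ofBits] using key _ le_rfl

end StackProg

/-! ### Reading the input, measuring the kernel, and writing it -/

namespace BisecProg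

open StackProg StackProg.Prog Function Classical

variable {B : Type} {G : FinGraph} {k : ℕ} {env : Reg → ℕ}

/-- The minimum of two expressions. -/
def minE (e f : Exp Reg) : Exp Reg := .sub e (.sub e f)

theorem eval_minE {w : List Sym} {e f : Exp Reg} :
    (minE e f).eval w env = min (e.eval w env) (f.eval w env) := by
  simp only [minE, Exp.eval]; omega

/-- Sets the registers 0 to 3. -/
def readSizes (B : Type) : Prog Reg B :=
  .seq (.assign 0 (.sum 31 .len (.inp Sum.isLeft (.var 31)))) <|
  .seq (.assign 1 (.sum 31 .len (.inp (isSym (Sum.inr none)) (.var 31)))) <|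
  .seq (.loop 31 (.var 1) (.assign 11 (.sub (.const 1) (.var 11)))) <|
  .seq (.assign 2 (.add (.var 1) (.var 11))) (.assign 3 (.add (.var 1) (.const 1)))

/-- Sets the register 4 to the parameter, capped at the length of the input plus 1. -/
def readParam (B : Type) : Prog Reg B :=
  .seq (.assign 5 (.add .len (.const 1))) <|
  .loop 31 (.var 0) (.assign 4 (minE
    (.add (.add (.var 4) (.var 4)) (.inp (isSym (Sum.inl true)) (.var 31))) (.var 5)))

/-- Sets the registers 6 and 7 to the numbers of kept vertices and of their adjacent pairs. -/
def measure (B : Type) : Prog Reg B :=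
  .seq (.assign 6 cntE) (.assign 7 (sumPairs (.const 1)))

/-- Sets the registers 0 to 7. -/
def preamble (B : Type) : Prog Reg B := .seq (readSizes B) (.seq (readParam B) (measure B))

theorem readSizes_run : ∃ env, (readSizes B).run (input G k) (fun _ => 0, []) = (env, []) ∧
    Ready G k env ∧ env 4 = 0 := by
  have h0 : (Exp.sum 31 .len (.inp Sum.isLeft (.var 31)) : Exp Reg).eval (input G k)
      (fun _ => 0) = (Computability.encodeNat k).length := by
    simp only [Exp.eval, update_self, List.sum_range_any_getElem?]
    simp [input, List.countP_map, Function.comp_def]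
  have h1 : ∀ env : Reg → ℕ, (Exp.sum 31 .len (.inp (isSym (Sum.inr none)) (.var 31)) :
      Exp Reg).eval (input G k) env = G.n := by
    intro env
    simp only [Exp.eval, update_self, List.sum_range_any_getElem?]
    rw [input, List.countP_append, List.countP_map, List.countP_map,
      ← FinGraph.countP_encode G]
    simp [Function.comp_def, isSym]
  simp only [readSizes, run, h0, h1]
  obtain ⟨v, h⟩ := run_loop_assign (B := B) (w := input G k) (x := (11 : Reg)) (y := 31)
    (e := .var 1) (f := .sub (.const 1) (.var 11)) (g := fun _ a => 1 - a)
    (env := update (update (fun _ => 0) 0 (Computability.encodeNat k).length) 1 G.n)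
    (o := []) (by decide) (fun i _ a => by simp [Exp.eval])
  simp only [run] at h
  rw [h]
  refine ⟨_, rfl, ⟨?_, ?_, ?_⟩, ?_⟩
  · simp
  · simp [Exp.eval, iterDown_one_sub, FinGraph.evenOrder]
  · simp [Exp.eval]
  · simp

theorem readParam_run (h : Ready G k env) (h4 : env 4 = 0) :
    ∃ env', (readParam B).run (input G k) (env, []) = (env', []) ∧ Ready G k env' ∧
      env' 4 = min k ((input G k).length + 1) := by
  obtain ⟨v, h'⟩ := run_loop_assign (B := B) (w := input G k) (x := (4 : Reg)) (y := 31)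
    (e := .var 0) (f := minE (.add (.add (.var 4) (.var 4))
      (.inp (isSym (Sum.inl true)) (.var 31))) (.var 5))
    (g := fun i a => min (2 * a + if (Computability.encodeNat k)[i]? = some true then 1 else 0)
      ((input G k).length + 1))
    (env := update env 5 ((input G k).length + 1)) (o := []) (by decide) (fun i hi a => by
      have hi' : i < (Computability.encodeNat k).length := by
        simpa [Exp.eval, h.bits] using hi
      simp [Exp.eval, eval_minE, input_getElem?_left G k hi', isSym, two_mul, hi'])
  refine ⟨_, h', ((h.update (by decide) _).update (by decide) _).update (by decide) _, ?_⟩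
  have : (update env 5 ((input G k).length + 1)) 0 = (Computability.encodeNat k).length := by
    simp [h.bits]
  simp only [Exp.eval, this]
  simp [h4, iterDown_bits, ofBits_encodeNat]

/-- The state after the preamble. -/
structure Measured (G : FinGraph) (k : ℕ) (env : Reg → ℕ) : Prop extends Ready G k env where
  param : env 4 = min k ((input G k).length + 1)
  card : env 6 = G.kept.card
  pairs : env 7 = G.keptPairs

theorem preamble_run : ∃ env, (preamble B).run (input G k) (fun _ => 0, []) = (env, []) ∧
    Measured G k env := by
  obtain ⟨env1, h1, h2, h3⟩ := readSizes_run (B := B) (G := G) (k := k)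
  obtain ⟨env2, h4, h5, h6⟩ := readParam_run (B := B) h2 h3
  have h7 : (sumPairs (.const 1)).eval (input G k) (update env2 6 G.kept.card) =
      G.keptPairs := by
    rw [eval_sumPairs (h5.update (by decide) _) (f := fun _ _ => 1)
      (fun _ _ _ _ _ _ _ _ => rfl), FinGraph.keptPairs, Finset.card_filter,
      Finset.sum_product]
  simp only [preamble, run, h1, h4, measure, eval_cntE h5, h7]
  exact ⟨_, rfl, (h5.update (by decide) _).update (by decide) _, by simp [h6], by simp, by simp⟩

/-- The test whether there are too many kept vertices or edges. -/
def bigE : Exp Reg :=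
  .add (ltE (mulE 31 (.const 4) (mulE 30 (.var 4) (.add (.var 4) (.const 1)))) (.var 6))
    (ltE (mulE 31 (.const 64) (mulE 30 (.var 4) (mulE 29 (.var 4) (.var 4)))) (.var 7))

/-- The binary parameter may be exponentially large, so a unary register holds it only up to the
input length plus 1. Beyond that cap neither bound can be exceeded, as the numbers of kept vertices
and of adjacent pairs are at most the cap. -/
theorem eval_bigE (h : Measured G k env) :
    bigE.eval (input G k) env ≠ 0 ↔ G.TooLarge k := by
  have h1 : bigE.eval (input G k) env =
      (if 4 * (env 4 * (env 4 + 1)) < env 6 then 1 else 0) +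
      (if 64 * (env 4 * (env 4 * env 4)) < env 7 then 1 else 0) := by
    simp [bigE, eval_ltE, mulE, Exp.eval]
  have h2 : bigE.eval (input G k) env ≠ 0 ↔ 4 * (env 4 * (env 4 + 1)) < env 6 ∨
      64 * (env 4 * (env 4 * env 4)) < env 7 := by
    rw [h1]
    split_ifs <;> simp [*]
  rw [h2, h.param, h.card, h.pairs, FinGraph.TooLarge]
  have h3 := G.card_kept_le
  have h4 := G.keptPairs_le_length_encode
  have h5 := length_input G k
  have h6 := G.length_encode
  set L := (input G k).length
  rcases le_total k (L + 1) with hk | hk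
  · rw [min_eq_left hk]
    ring_nf
  · rw [min_eq_right hk]
    have h7 : 4 * ((L + 1) * (L + 1 + 1)) ≤ 4 * k * (k + 1) := by
      rw [← mul_assoc]; gcongr
    have h8 : 64 * ((L + 1) * ((L + 1) * (L + 1))) ≤ 64 * k ^ 3 := by
      rw [pow_three]; gcongr
    have h9 : G.n ≤ L := by nlinarith
    have h10 : L + 1 ≤ 4 * ((L + 1) * (L + 1 + 1)) := by nlinarith
    have h11 : L + 1 ≤ 64 * ((L + 1) * ((L + 1) * (L + 1))) := by
      nlinarith [Nat.zero_le ((L + 1) * ((L + 1) * (L + 1))), Nat.zero_le (L * L),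
        Nat.zero_le (L * L * L)]
    omega

/-- Writes the kept vertices as a graph, followed by the parameter. -/
def writeKept : Prog Reg Sym :=
  -- The output is a stack, so it is written back to front: each separator before its row, the
  -- parameter after the graph.
  .seq (.loop 28 (.var 2) (.ite (keepE 28) (.seq (.emit (Sum.inr none))
    (.loop 27 (.var 2) (.ite (keepE 27)
      (.ite (adjE 28 27) (.emit (Sum.inr (some true))) (.emit (Sum.inr (some false))))
      .skip))) .skip))
  (.loop 31 (.var 0) (.ite (.inp (isSym (Sum.inl true)) (.var 31))
    (.emit (Sum.inl true)) (.emit (Sum.inl false))))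

theorem writeRow_run (h : Ready G k env) (o : List Sym) :
    ∃ env', (.loop 27 (.var 2) (.ite (keepE 27)
      (.ite (adjE 28 27) (.emit (Sum.inr (some true))) (.emit (Sum.inr (some false))))
      .skip) : Prog Reg Sym).run (input G k) (env, o) = (env', (G.keptList.map fun j =>
        Sum.inr (some (decide (G.natGraph.Adj (env 28) j)))) ++ o) ∧ Ready G k env' := by
  obtain ⟨env', h1, h2, -⟩ := run_loop_emit (w := input G k) (x := 27) (e := .var 2)
    (P := (.ite (keepE 27)
      (.ite (adjE 28 27) (.emit (Sum.inr (some true))) (.emit (Sum.inr (some false))))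
      .skip : Prog Reg Sym)) (o := o)
    (I := fun env' => Ready G k env' ∧ env' 28 = env 28)
    (g := fun j => if decide (j ∈ G.kept) then
      [Sum.inr (some (decide (G.natGraph.Adj (env 28) j)))] else []) ⟨h, rfl⟩ (by
    intro j hj env' o h'
    have hj' : update env' 27 j 27 < G.evenOrder := by
      simpa [Exp.eval, h.order] using hj
    have h1 := h'.1.update (x := 27) (by decide) j
    refine ⟨update env' 27 j, ?_, h1, by simpa using h'.2⟩
    simp only [run, eval_keepE h1 (by decide) (by decide) hj', eval_adjE h1 hj', update_self]
    rw [update_of_ne (by decide), h'.2]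
    by_cases hk : j ∈ G.kept <;> by_cases ha : G.natGraph.Adj (env 28) j <;> simp [hk, ha])
  refine ⟨env', ?_, h2⟩
  rw [h1, ← List.flatMap_filter_eq]
  simp only [Exp.eval, h.order]
  rw [← FinGraph.keptList, ← List.map_eq_flatMap]

theorem writeKept_run (h : Ready G k env) :
    ((writeKept.run (input G k) (env, [])).2) = input G.trimmed k := by
  obtain ⟨env', h1, h2⟩ := run_loop_emit (w := input G k) (x := 28) (e := .var 2)
    (P := (.ite (keepE 28) (.seq (.emit (Sum.inr none))
    (.loop 27 (.var 2) (.ite (keepE 27)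
      (.ite (adjE 28 27) (.emit (Sum.inr (some true))) (.emit (Sum.inr (some false))))
      .skip))) .skip : Prog Reg Sym)) (o := []) (I := Ready G k)
    (g := fun i => if decide (i ∈ G.kept) then (G.keptList.map fun j =>
        Sum.inr (some (decide (G.natGraph.Adj i j)))) ++ [Sum.inr none] else []) h (by
    intro i hi env' o h'
    have hi' : update env' 28 i 28 < G.evenOrder := by
      simpa [Exp.eval, h.order] using hi
    have h1 := h'.update (x := 28) (by decide) i
    rw [run, eval_keepE h1 (by decide) (by decide) hi']
    by_cases hk : i ∈ G.kept
    · obtain ⟨env'', h2, h3⟩ := writeRow_run h1 (Sum.inr none :: o)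
      refine ⟨env'', ?_, h3⟩
      rw [update_self, if_pos hk, if_pos one_ne_zero, run, run, h2]
      simp [hk]
    · exact ⟨_, by simp [hk, run], h1⟩)
  obtain ⟨env'', h3, -⟩ := run_loop_emit (w := input G k) (x := 31) (e := .var 0)
    (P := (.ite (.inp (isSym (Sum.inl true)) (.var 31))
    (.emit (Sum.inl true)) (.emit (Sum.inl false)) : Prog Reg Sym)) (I := fun _ => True)
    (env := env') (o := (G.trimmed.encode.map Sum.inr))
    (g := fun i => ((Computability.encodeNat k)[i]?).toList.map Sum.inl) trivial (by
    intro i hi env' o _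
    have hi' : i < (Computability.encodeNat k).length := by
      simpa [Exp.eval, h2.bits] using hi
    refine ⟨update env' 31 i, ?_, trivial⟩
    simp only [run, Exp.eval, update_self, input_getElem?_left G k hi',
      List.getElem?_eq_getElem hi']
    cases (Computability.encodeNat k)[i] <;> simp [isSym])
  have h4 : (List.range (Exp.eval (input G k) (.var 2) env)).flatMap (fun i =>
      if decide (i ∈ G.kept) then (G.keptList.map fun j =>
        (Sum.inr (some (decide (G.natGraph.Adj i j))) : Sym)) ++ [Sum.inr none] else []) ++ [] =
      G.trimmed.encode.map Sum.inr := by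
    rw [← List.flatMap_filter_eq]
    simp only [Exp.eval, h.order]
    rw [← FinGraph.keptList, FinGraph.trimmed_encode, List.map_flatMap]
    simp [Function.comp_def]
  rw [writeKept, run, h1, h4, h3]
  simp only [Exp.eval, h2.bits, input]
  congr 1
  rw [← List.map_flatMap]
  rw [List.flatMap_range_getElem?]

/-- The program of the kernelization. -/
def kernelProg : Prog Reg Sym := .seq (preamble Sym) (.ite bigE .skip writeKept)

theorem kernelProg_run : (kernelProg.run (input G k) (fun _ => 0, [])).2 =
    input (FinGraph.kernel (G, k)).1 (FinGraph.kernel (G, k)).2 := by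
  obtain ⟨env, h1, h2⟩ := preamble_run (B := Sym) (G := G) (k := k)
  rw [kernelProg, run, h1, run, FinGraph.kernel]
  simp only [eval_bigE h2]
  split_ifs
  · simp [run, input, FinGraph.encode, Computability.encodeNat, Computability.encodeNum]
  · exact writeKept_run h2.toReady

theorem preamble_polyTime (B : Type) : (preamble B).PolyTime := by
  refine .seq (.seq (.assign _ _) (.seq (.assign _ _) (.seq (Tame.polyTime ?_)
    (.seq (.assign _ _) (.assign _ _))))) (.seq (.seq (.assign _ _) (Tame.polyTime ?_))
    (.seq (.assign _ _) (.assign _ _)))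
  · exact .loop _ _ (.assign _ fun w M env h1 _ _ => by simp only [Exp.eval]; omega)
  -- The cap in register 5 is what prevents repeated doubling from growing exponentially.
  · exact .loop _ _ (.assign _ fun w M env h1 _ h => by
      rw [eval_minE]; exact (min_le_right _ _).trans (h 5))

theorem writeKept_tame : writeKept.Tame :=
  .seq (.loop _ _ (.ite _ (.seq (.emit _) (.loop _ _ (.ite _ (.ite _ (.emit _) (.emit _)) .skip)))
    .skip)) (.loop _ _ (.ite _ (.emit _) (.emit _)))

theorem kernelProg_polyTime : kernelProg.PolyTime :=
  .seq (preamble_polyTime _) (Tame.ite _ .skip writeKept_tame).polyTime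

theorem computable_kernel : Nonempty (Turing.TM2ComputableInPolyTime
    maxBisecATLB.encodePair maxBisecATLB.encodePair FinGraph.kernel) := by
  obtain ⟨p, hp⟩ := kernelProg_polyTime
  obtain ⟨q, key⟩ : ∃ q : Polynomial ℕ, ∀ (G : FinGraph) (k : ℕ),
      Nonempty (Turing.TM2OutputsInTime kernelProg.computer.tm
        ((input G k).map kernelProg.computer.inputAlphabet.symm)
        (some ((input (FinGraph.kernel (G, k)).1 (FinGraph.kernel (G, k)).2).map
          kernelProg.computer.outputAlphabet.symm)) (q.eval (input G k).length)) := by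
    -- The term with 32 pays for emptying the 32 registers, and `2 * X` for emptying the input.
    refine ⟨p.comp (Polynomial.X + 1) + 32 * (2 * p.comp (Polynomial.X + 1) + 1) +
        2 * Polynomial.X + 3, fun G k => ?_⟩
    obtain ⟨h1, h2⟩ := hp (input G k) ((input G k).length + 1) (fun _ => 0, []) (by omega)
      (by omega) (fun _ => Nat.zero_le _)
    rw [← kernelProg_run]
    exact h2.outputsInTime_map h1 (by simp)
  exact ⟨⟨kernelProg.computer, q, fun x => (key x.1 x.2).some⟩⟩

end BisecProg

/-! ### Loops that multiply: time bounded by the final product -/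

namespace StackProg.Prog

open Function

variable {V B : Type} [DecidableEq V]

/-- Factorials and products of codes do not obey `Tame`. All factors being positive, though, a bound
of the final product bounds the intermediate ones; the invariant is that the current value times the
remaining factors is at most `M`. -/
theorem exists_polynomial_loop_mul (B : Type) (x y : V) (hxy : x ≠ y) (e f : Exp V) :
    ∃ q : Polynomial ℕ, ∀ (w : List Sym) (M : ℕ) (env : V → ℕ) (o : List B) (d : ℕ → ℕ),
      w.length ≤ M → (∀ z, env z ≤ M) → e.eval w env ≤ M →
      (∀ i < e.eval w env, ∀ a, f.eval w (update (update env x a) y i) = a * d i) →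
      (∀ i, 1 ≤ d i) → env x * ∏ i ∈ Finset.range (e.eval w env), d i ≤ M →
      (∀ z, ((loop y e (assign x f)).run w (env, o)).1 z ≤ M) ∧
        (loop y e (assign x f)).Within w (env, o) (q.eval M) := by
  obtain ⟨r, hr⟩ := e.exists_polynomial B
  obtain ⟨r', hr'⟩ := f.exists_polynomial B
  refine ⟨r + Polynomial.X * (r' + 11 * Polynomial.X + 8) + 2,
    fun w M env o d hw h he hf hd hM => ?_⟩
  have hone : ∀ i, 1 ≤ ∏ j ∈ Finset.range i, d j := fun i =>
    Finset.one_le_prod' fun j _ => hd j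
  have := Within.loop (w := w) (s := (env, o)) (x := y) (e := e) (P := assign x f) (M := M)
    (T' := r'.eval M + 4 * M + 3)
    (I := fun i s => (∃ a v, s.1 = update (update env x a) y v) ∧ (∀ z, s.1 z ≤ M) ∧
      s.1 x * ∏ j ∈ Finset.range i, d j ≤ M) (hr w M env hw h).2
    ⟨⟨env x, env y, by simp⟩, h, hM⟩ (by
      rintro i hi ⟨s, o'⟩ ⟨⟨a, v, rfl⟩, h1, h2⟩
      have hi' : i ≤ M := by simp only at hi; omega
      simp only [update_idem, run]
      have h3 : ∀ z, update (update env x a) y i z ≤ M := by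
        have := forall_update_le h1 hi' y
        simpa only [update_idem] using this
      have h4 : a * d i * ∏ j ∈ Finset.range i, d j ≤ M := by
        have : a * d i * ∏ j ∈ Finset.range i, d j = a * ∏ j ∈ Finset.range (i + 1), d j := by
          rw [Finset.prod_range_succ]; ring
        rw [this]
        simpa [hxy] using h2
      have h5 : a * d i ≤ M := le_trans (Nat.le_mul_of_pos_right _ (hone i)) h4
      have h6 := hf i hi a
      refine ⟨h1 y, (Within.assign (hr' w M _ hw h3).2).mono ?_, ⟨a * d i, i, ?_⟩, ?_, ?_⟩
      · have := h3 x
        simp only [h6]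
        omega
      · rw [h6, update_comm hxy.symm i (a * d i) (update env x a), update_idem]
      · rw [h6]
        exact forall_update_le h3 h5 x
      · rw [h6, update_self]
        exact h4)
  refine ⟨this.2.2.1, this.1.mono ?_⟩
  have := Nat.mul_le_mul he (show r'.eval M + 4 * M + 3 + 2 * M + 5 * e.eval w env + 5 ≤
    r'.eval M + 11 * M + 8 by omega)
  have := (hr w M env hw h).1
  simp
  omega

end StackProg.Prog

/-! ### Coding subsets by numbers -/

/-- Pairwise coprime numbers. -/
def code (n r : ℕ) : ℕ := (r + 1) * n.factorial + 1

/-- As in Gödel's β-function: the difference of the two indices divides `n.factorial`. -/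
theorem coprime_code {n r t : ℕ} (hr : r < n) (ht : t < n) (h : r ≠ t) :
    Nat.Coprime (code n r) (code n t) := by
  wlog hlt : r < t generalizing r t
  · exact (this ht hr h.symm (by omega)).symm
  · exact Nat.coprime_mul_succ (Nat.dvd_factorial (by omega) (by omega))

/-- The number of elements of `K` less than `i`. -/
def rank (K : Finset ℕ) (i : ℕ) : ℕ := (K.filter fun j => j < i).card

theorem rank_lt_card {K : Finset ℕ} {i : ℕ} (hi : i ∈ K) : rank K i < K.card :=
  Finset.card_lt_card (Finset.filter_ssubset.2 ⟨i, hi, lt_irrefl i⟩)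

theorem rank_injOn (K : Finset ℕ) : Set.InjOn (rank K) K := by
  have key : ∀ i ∈ K, ∀ j ∈ K, i < j → rank K i < rank K j := by
    intro i hi j _ hij
    refine Finset.card_lt_card ⟨fun l => ?_, fun h => ?_⟩
    · simp only [Finset.mem_filter]
      exact fun h => ⟨h.1, h.2.trans hij⟩
    · exact lt_irrefl i (Finset.mem_filter.1 (h (Finset.mem_filter.2 ⟨hi, hij⟩))).2
  intro i hi j hj hij
  rcases lt_trichotomy i j with h | h | h
  · exact absurd hij (key i hi j hj h).ne
  · exact h
  · exact absurd hij (key j hj i hi h).ne'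

/-- Every subset of `K` is the set of all `i` for which the code of `i` divides a certain number. -/
theorem exists_code_dvd_iff (K : Finset ℕ) (b : ℕ → Prop) :
    ∃ s ≤ ∏ r ∈ Finset.range K.card, code K.card r,
      ∀ i ∈ K, code K.card (rank K i) ∣ s ↔ b i := by
  classical
  -- The codes of the selected elements are multiplied. An unselected code is coprime to this
  -- product and greater than 1, so it does not divide it.
  refine ⟨∏ i ∈ K.filter b, code K.card (rank K i), ?_, fun i hi => ⟨fun h => ?_, fun h =>
    Finset.dvd_prod_of_mem _ (Finset.mem_filter.2 ⟨hi, h⟩)⟩⟩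
  · rw [← Finset.prod_image (f := code K.card) ((rank_injOn K).mono fun i hi =>
      (Finset.mem_filter.1 hi).1)]
    refine Finset.prod_le_prod_of_subset_of_one_le' ?_ fun r _ _ => Nat.le_add_left 1 _
    intro r hr
    obtain ⟨i, hi, rfl⟩ := Finset.mem_image.1 hr
    exact Finset.mem_range.2 (rank_lt_card (Finset.mem_filter.1 hi).1)
  · by_contra hb
    have hcop : Nat.Coprime (code K.card (rank K i))
        (∏ i ∈ K.filter b, code K.card (rank K i)) := by
      refine Nat.Coprime.prod_right fun j hj => ?_
      obtain ⟨hj, hbj⟩ := Finset.mem_filter.1 hj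
      refine coprime_code (rank_lt_card hi) (rank_lt_card hj) fun h => hb ?_
      rwa [rank_injOn K hi hj h]
    have h1 := Nat.Coprime.eq_one_of_dvd hcop h
    have h2 : 0 < (rank K i + 1) * K.card.factorial := by positivity
    rw [code] at h1
    omega

theorem SimpleGraph.sum_signing (H : SimpleGraph ℕ) [DecidableRel H.Adj] {K : Finset ℕ}
    {b : ℕ → Prop} [DecidablePred b] {t : ℕ → ℤ} (h : ∀ i ∈ K, t i = if b i then 1 else -1) :
    ∑ i ∈ K, t i = ((2 * ∑ i ∈ K, (if b i then 1 else 0) : ℕ) : ℤ) - (K.card : ℤ) ∧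
    -H.pairSum K K t t = ((2 * ∑ i ∈ K, ∑ j ∈ K, if H.Adj i j then
      (if b i ↔ b j then 0 else 1) else 0 : ℕ) : ℤ) -
      ((∑ i ∈ K, ∑ j ∈ K, if H.Adj i j then 1 else 0 : ℕ) : ℤ) := by
  constructor
  · rw [Finset.card_eq_sum_ones]
    push_cast
    rw [Finset.mul_sum, ← Finset.sum_sub_distrib]
    refine Finset.sum_congr rfl fun i hi => ?_
    rw [h i hi]
    split_ifs <;> rfl
  · push_cast
    rw [pairSum, Finset.mul_sum, ← Finset.sum_neg_distrib, ← Finset.sum_sub_distrib]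
    refine Finset.sum_congr rfl fun i hi => ?_
    rw [Finset.mul_sum, ← Finset.sum_neg_distrib, ← Finset.sum_sub_distrib]
    refine Finset.sum_congr rfl fun j hj => ?_
    rw [h i hi, h j hj]
    by_cases h1 : b i <;> by_cases h2 : b j <;> by_cases h3 : H.Adj i j <;> simp [h1, h2, h3]

open Classical in
/-- Balanced signings correspond to balanced subsets cutting many pairs. -/
theorem SimpleGraph.hasSigning_iff_exists_code (H : SimpleGraph ℕ) (K : Finset ℕ) (c : ℕ) :
    H.HasSigning K c ↔ ∃ s ≤ ∏ r ∈ Finset.range K.card, code K.card r,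
      2 * ∑ i ∈ K, (if code K.card (rank K i) ∣ s then 1 else 0) = K.card ∧
      (∑ i ∈ K, ∑ j ∈ K, if H.Adj i j then 1 else 0) + c ≤
        2 * ∑ i ∈ K, ∑ j ∈ K, if H.Adj i j then
          (if (code K.card (rank K i) ∣ s ↔ code K.card (rank K j) ∣ s) then 0 else 1) else 0 := by
  constructor
  · rintro ⟨t, h1, h2, h3⟩
    obtain ⟨s, hs, h⟩ := exists_code_dvd_iff K fun i => t i = 1
    obtain ⟨h4, h5⟩ := H.sum_signing (b := fun i => code K.card (rank K i) ∣ s) (t := t)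
      fun i hi => by
        have := h i hi
        rcases h1 i hi with h' | h' <;> simp [this, h']
    refine ⟨s, hs, ?_, ?_⟩ <;> omega
  · rintro ⟨s, -, h1, h2⟩
    obtain ⟨h4, h5⟩ := H.sum_signing (K := K) (b := fun i => code K.card (rank K i) ∣ s)
      fun i _ => rfl
    refine ⟨fun i => if code K.card (rank K i) ∣ s then 1 else -1, fun i _ => ?_,
      by rw [h4]; omega, by rw [h5]; omega⟩
    by_cases h : code K.card (rank K i) ∣ s <;> simp [h]

/-! ### The program of the decision procedure -/

namespace BisecProg

open StackProg StackProg.Prog Function Classical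

variable {B : Type} {G : FinGraph} {k : ℕ} {env : Reg → ℕ}

theorem Ready.of_agree (h : Ready G k env) {env' : Reg → ℕ} (h' : ∀ x < 25, env' x = env x) :
    Ready G k env' :=
  ⟨by rw [h' 0 (by decide), h.bits], by rw [h' 2 (by decide), h.order],
    by rw [h' 3 (by decide), h.stride]⟩

/-- The number of kept vertices before the vertex in the register `x`. -/
def rankE (x : Reg) : Exp Reg := .sum 24 (.var x) (keepE 24)

theorem eval_rankE (h : Ready G k env) {x : Reg} (hx : env x ≤ G.evenOrder) :
    (rankE x).eval (input G k) env = rank G.kept (env x) := by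
  simp only [rankE, Exp.eval, rank]
  have h1 : ∀ i ∈ Finset.range (env x), (keepE 24).eval (input G k) (update env 24 i) =
      if i ∈ G.kept then 1 else 0 := fun i hi => by
    have := Finset.mem_range.1 hi
    rw [eval_keepE (h.update (by decide) i) (by decide) (by decide) (by simp; omega), update_self]
  rw [Finset.sum_congr rfl h1, ← Finset.card_filter]
  congr 1
  ext i
  simp [and_comm]

/-- The code of the number `e`; the register 8 holds the factorial. -/
def codeE (e : Exp Reg) : Exp Reg := .add (mulE 31 (.add e (.const 1)) (.var 8)) (.const 1)

theorem eval_codeE {w : List Sym} {e : Exp Reg} {n : ℕ} (h8 : env 8 = n.factorial) :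
    (codeE e).eval w env = code n (e.eval w env) := by
  have : (mulE 31 (.add e (.const 1)) (.var 8)).eval w env = (e.eval w env + 1) * n.factorial :=
    eval_mulE fun i => by simp [Exp.eval, h8]
  simp only [codeE, Exp.eval, this, code]

/-- Whether the code of the vertex in the register `x` divides the number in the register 12. -/
def bitE (x : Reg) : Exp Reg := ltE (.const 0)
  (.sum 23 (.add (.var 12) (.const 1)) (eqE (mulE 22 (.var 23) (codeE (rankE x))) (.var 12)))

theorem eval_bitE (h : Ready G k env) {x : Reg} (hx22 : x ≠ 22) (hx23 : x ≠ 23)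
    (hx : env x ≤ G.evenOrder) (h8 : env 8 = G.kept.card.factorial) :
    (bitE x).eval (input G k) env =
      if code G.kept.card (rank G.kept (env x)) ∣ env 12 then 1 else 0 := by
  have h1 : ∀ i v, (codeE (rankE x)).eval (input G k) (update (update env 23 i) 22 v) =
      code G.kept.card (rank G.kept (env x)) := fun i v => by
    have := (h.update (x := 23) (by decide) i).update (x := 22) (by decide) v
    rw [eval_codeE (n := G.kept.card) (by simpa using h8), eval_rankE this]
    · simp [hx22, hx23]
    · simpa [hx22, hx23] using hx
  have h2 : ∀ i, (eqE (mulE 22 (.var 23) (codeE (rankE x))) (.var 12)).eval (input G k)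
      (update env 23 i) = if i * code G.kept.card (rank G.kept (env x)) = env 12 then 1 else 0 :=
    fun i => by
      rw [eval_eqE, eval_mulE fun v => h1 i v]
      simp [Exp.eval]
  simp only [bitE, eval_ltE, Exp.eval, h2, Finset.sum_ite, Finset.sum_const_zero, add_zero,
    Finset.sum_const, smul_eq_mul, mul_one, Finset.card_pos]
  refine if_congr ⟨?_, ?_⟩ rfl rfl
  · rintro ⟨i, hi⟩
    exact Dvd.intro_left i (Finset.mem_filter.1 hi).2
  · rintro ⟨i, hi⟩
    refine ⟨i, Finset.mem_filter.2 ⟨Finset.mem_range.2 ?_, by rw [hi, mul_comm]⟩⟩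
    -- The quotient is at most the number itself since codes are positive, so searching up to
    -- register 12 is enough.
    have : i * 1 ≤ i * code G.kept.card (rank G.kept (env x)) :=
      Nat.mul_le_mul_left i (Nat.le_add_left 1 _)
    rw [hi, mul_comm]
    omega

/-- Whether the number in the register 12 codes a bisection that is large enough. -/
def testE : Exp Reg := .sub (.add
  (eqE (mulE 31 (.const 2) (sumKept 21 20 (bitE 21))) (.var 6))
  (ltE (.add (.var 7) (mulE 31 (.const 4) (.var 4)))
    (.add (mulE 31 (.const 2) (sumPairs (distE (bitE 28) (bitE 27)))) (.const 1)))) (.const 1)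

/-- For truth values, `a + b - 1` is the conjunction; the comparison `≤` is expressed by `<` after
adding 1 on the right. -/
theorem eval_testE (h : Measured G k env) (h8 : env 8 = G.kept.card.factorial) :
    testE.eval (input G k) env = if
      2 * ∑ i ∈ G.kept, (if code G.kept.card (rank G.kept i) ∣ env 12 then 1 else 0) =
        G.kept.card ∧
      G.keptPairs + 4 * env 4 ≤
        2 * ∑ i ∈ G.kept, ∑ j ∈ G.kept, if G.natGraph.Adj i j then
          (if (code G.kept.card (rank G.kept i) ∣ env 12 ↔
            code G.kept.card (rank G.kept j) ∣ env 12) then 0 else 1) else 0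
      then 1 else 0 := by
  have hlt : ∀ j ∈ G.kept, j ≤ G.evenOrder := fun j hj =>
    (Finset.mem_range.1 (SimpleGraph.trim_subset hj)).le
  have h1 : ∀ v, (sumKept 21 20 (bitE 21)).eval (input G k) (update env 31 v) =
      ∑ i ∈ G.kept, (if code G.kept.card (rank G.kept i) ∣ env 12 then 1 else 0) := fun v => by
    refine eval_sumKept (h.toReady.update (by decide) v) (by decide) (by decide) (by decide)
      fun i hi v' => ?_
    rw [eval_bitE (((h.toReady.update (by decide) v).update (by decide) i).update (by decide) v')
      (by decide) (by decide) (by simpa using hlt i hi) (by simpa using h8)]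
    simp
  have h2 : ∀ v, (sumPairs (distE (bitE 28) (bitE 27))).eval (input G k) (update env 31 v) =
      ∑ i ∈ G.kept, ∑ j ∈ G.kept, if G.natGraph.Adj i j then
          (if (code G.kept.card (rank G.kept i) ∣ env 12 ↔
            code G.kept.card (rank G.kept j) ∣ env 12) then 0 else 1) else 0 := fun v => by
    refine eval_sumPairs (h.toReady.update (by decide) v) fun i hi j hj env' hi' hj' he => ?_
    have he' : ∀ x < 25, env' x = env x := fun x hx => by
      rw [he x hx, update_of_ne (by rintro rfl; exact absurd hx (by decide))]
    have hr := h.toReady.of_agree he'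
    simp only [distE, Exp.eval]
    rw [eval_bitE hr (by decide) (by decide) (by rw [hi']; exact hlt i hi)
        (by rw [he' 8 (by decide), h8]),
      eval_bitE hr (by decide) (by decide) (by rw [hj']; exact hlt j hj)
        (by rw [he' 8 (by decide), h8]), he' 12 (by decide), hi', hj']
    by_cases h3 : code G.kept.card (rank G.kept i) ∣ env 12 <;>
      by_cases h4 : code G.kept.card (rank G.kept j) ∣ env 12 <;> simp [h3, h4]
  have h3 : ∀ a, (mulE 31 (.const a) (.var 4)).eval (input G k) env = a * env 4 := fun a =>
    eval_mulE fun v => by simp [Exp.eval]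
  simp only [testE, Exp.eval, eval_eqE, eval_ltE, eval_mulE h1, eval_mulE h2, h3, h.card, h.pairs,
    Nat.lt_succ_iff]
  split_ifs <;> first | rfl | omega

/-- Searches for a number that codes a bisection that is large enough. -/
def search (B : Type) : Prog Reg B :=
  .seq (.assign 8 (.const 1)) <|
  .seq (.loop 31 (.var 6) (.assign 8 (mulE 30 (.var 8) (.add (.var 31) (.const 1))))) <|
  .seq (.assign 9 (.const 1)) <|
  .seq (.loop 31 (.var 6) (.assign 9 (mulE 30 (.var 9) (codeE (.var 31))))) <|
  .assign 10 (.sum 12 (.add (.var 9) (.const 1)) testE)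

theorem Measured.update (h : Measured G k env) {x : Reg} (hx : 7 < x) (v : ℕ) :
    Measured G k (update env x v) := by
  have h4 : (4 : Reg) ≠ x := by rintro rfl; exact absurd hx (by decide)
  have h6 : (6 : Reg) ≠ x := by rintro rfl; exact absurd hx (by decide)
  have h7 : (7 : Reg) ≠ x := by rintro rfl; exact absurd hx (by decide)
  exact ⟨h.toReady.update (lt_trans (by decide) hx) v, by simpa [h4] using h.param,
    by simpa [h6] using h.card, by simpa [h7] using h.pairs⟩

theorem eval_factorial_step {w : List Sym} (i a : ℕ) :
    (mulE 30 (.var 8) (.add (.var 31) (.const 1)) : Exp Reg).eval w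
      (update (update env 8 a) 31 i) = a * (i + 1) := by
  rw [eval_mulE (a := i + 1) fun v => by simp [Exp.eval]]
  simp [Exp.eval]

theorem eval_code_step {w : List Sym} {n : ℕ} (h8 : env 8 = n.factorial) (i a : ℕ) :
    (mulE 30 (.var 9) (codeE (.var 31)) : Exp Reg).eval w
      (update (update env 9 a) 31 i) = a * code n i := by
  rw [eval_mulE (a := code n i) fun v => by
    rw [eval_codeE (n := n) (by simpa using h8)]; simp [Exp.eval]]
  simp [Exp.eval]

end BisecProg

/-! ### Correctness and running time of the exhaustive search -/

namespace BisecProg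

open StackProg StackProg.Prog Function Classical

variable {B : Type} {G : FinGraph} {k : ℕ} {env : Reg → ℕ}

/-- Capping the parameter is harmless: the cut pairs are at most `G.keptPairs`, which is less than
the cap, so a capped parameter makes both sides false. -/
theorem hasBisection_iff_exists_code (G : FinGraph) (k : ℕ) : HasBisectionATLB G.graph k ↔
    ∃ s ≤ ∏ r ∈ Finset.range G.kept.card, code G.kept.card r,
      2 * ∑ i ∈ G.kept, (if code G.kept.card (rank G.kept i) ∣ s then 1 else 0) = G.kept.card ∧
      G.keptPairs + 4 * min k ((input G k).length + 1) ≤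
        2 * ∑ i ∈ G.kept, ∑ j ∈ G.kept, if G.natGraph.Adj i j then
          (if (code G.kept.card (rank G.kept i) ∣ s ↔
            code G.kept.card (rank G.kept j) ∣ s) then 0 else 1) else 0 := by
  have hc : ((4 * k : ℕ) : ℤ) = 4 * (k : ℤ) := by push_cast; rfl
  have hp : G.keptPairs = ∑ i ∈ G.kept, ∑ j ∈ G.kept, if G.natGraph.Adj i j then 1 else 0 := by
    rw [FinGraph.keptPairs, Finset.card_filter, Finset.sum_product]
  rw [FinGraph.hasBisection_iff_verts, ← SimpleGraph.hasSigning_trim_iff G.even_card_verts, ← hc,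
    SimpleGraph.hasSigning_iff_exists_code, ← FinGraph.kept]
  refine exists_congr fun s => and_congr_right fun _ => and_congr_right fun _ => ?_
  rw [← hp]
  have h1 : ∑ i ∈ G.kept, ∑ j ∈ G.kept, (if G.natGraph.Adj i j then
      (if (code G.kept.card (rank G.kept i) ∣ s ↔
        code G.kept.card (rank G.kept j) ∣ s) then 0 else 1) else 0) ≤ G.keptPairs := by
    rw [hp]
    refine Finset.sum_le_sum fun i _ => Finset.sum_le_sum fun j _ => ?_
    split_ifs <;> omega
  have h2 := G.keptPairs_le_length_encode
  have h3 := length_input G k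
  omega

theorem search_run (h : Measured G k env) (o : List B) : ∃ env',
    (search B).run (input G k) (env, o) = (env', o) ∧
      (env' 10 ≠ 0 ↔ HasBisectionATLB G.graph k) := by
  obtain ⟨v, h1⟩ := run_loop_assign (B := B) (w := input G k) (x := (8 : Reg)) (y := 31)
    (e := .var 6) (f := mulE 30 (.var 8) (.add (.var 31) (.const 1)))
    (g := fun i a => a * (i + 1)) (env := update env 8 1) (o := o) (by decide)
    fun i _ a => by rw [update_idem, eval_factorial_step]
  have h6 : (Exp.var 6 : Exp Reg).eval (input G k) (update env 8 1) = G.kept.card := by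
    simp [Exp.eval, h.card]
  rw [h6, iterDown_mul, update_self, one_mul, Finset.prod_range_add_one_eq_factorial,
    update_idem] at h1
  set env1 := update (update env 8 G.kept.card.factorial) 31 v with henv1
  have hm1 : Measured G k env1 := (h.update (by decide) _).update (by decide) _
  have h81 : env1 8 = G.kept.card.factorial := by simp [henv1]
  obtain ⟨v', h2⟩ := run_loop_assign (B := B) (w := input G k) (x := (9 : Reg)) (y := 31)
    (e := .var 6) (f := mulE 30 (.var 9) (codeE (.var 31)))
    (g := fun i a => a * code G.kept.card i) (env := update env1 9 1) (o := o) (by decide)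
    fun i _ a => by rw [update_idem, eval_code_step h81]
  have h6' : (Exp.var 6 : Exp Reg).eval (input G k) (update env1 9 1) = G.kept.card := by
    simp [Exp.eval, hm1.card]
  rw [h6', iterDown_mul, update_self, one_mul, update_idem] at h2
  set env2 := update (update env1 9 (∏ r ∈ Finset.range G.kept.card, code G.kept.card r)) 31 v'
    with henv2
  have hm2 : Measured G k env2 := (hm1.update (by decide) _).update (by decide) _
  have h82 : env2 8 = G.kept.card.factorial := by simp [henv2, h81]
  have h92 : env2 9 = ∏ r ∈ Finset.range G.kept.card, code G.kept.card r := by simp [henv2]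
  refine ⟨update env2 10 ((Exp.sum 12 (.add (.var 9) (.const 1)) testE).eval (input G k) env2),
    ?_, ?_⟩
  · change (assign 10 (.sum 12 (.add (.var 9) (.const 1)) testE) : Prog Reg B).run (input G k)
      ((loop 31 (.var 6) (assign 9 (mulE 30 (.var 9) (codeE (.var 31))))).run (input G k)
        (update ((loop 31 (.var 6) (assign 8 (mulE 30 (.var 8) (.add (.var 31) (.const 1))))).run
          (input G k) (update env 8 1, o)).1 9 1, ((loop 31 (.var 6) (assign 8 (mulE 30 (.var 8)
          (.add (.var 31) (.const 1)))) : Prog Reg B).run (input G k) (update env 8 1, o)).2)) = _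
    rw [h1]
    dsimp only
    rw [h2]
    rfl
  · rw [hasBisection_iff_exists_code, update_self, ← Nat.pos_iff_ne_zero]
    simp only [Exp.eval]
    rw [Finset.sum_congr rfl fun s _ => eval_testE (hm2.update (x := 12) (by decide) s)
      (by simpa using h82)]
    simp only [update_self, h92, Finset.sum_ite, Finset.sum_const_zero, add_zero,
      Finset.sum_const, smul_eq_mul, mul_one, Finset.card_pos, update_of_ne (show
        (4 : Reg) ≠ 12 by decide), hm2.param]
    simp only [Finset.Nonempty, Finset.mem_filter, Finset.mem_range, Nat.lt_succ_iff]

/-- The product of the codes bounds the search range, so once it and the factorial are admitted as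
bounds, everything is polynomial in `M`. -/
theorem search_within (B : Type) : ∃ q : Polynomial ℕ, ∀ (w : List Sym) (M : ℕ) (env : Reg → ℕ)
    (o : List B), 1 ≤ M → w.length ≤ M → (∀ x, env x ≤ M) → (env 6).factorial ≤ M →
    ∏ r ∈ Finset.range (env 6), code (env 6) r ≤ M →
    (∀ x, ((search B).run w (env, o)).1 x ≤ q.eval M) ∧
      (search B).Within w (env, o) (q.eval M) := by
  have hone : ∀ x : Reg, (assign x (.const 1) : Prog Reg B).Tame := fun x =>
    .assign x fun w M env h _ _ => h
  obtain ⟨p1, hp1⟩ := hone 8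
  obtain ⟨p2, hp2⟩ := exists_polynomial_loop_mul B (8 : Reg) 31 (by decide) (.var 6)
    (mulE 30 (.var 8) (.add (.var 31) (.const 1)))
  obtain ⟨p3, hp3⟩ := hone 9
  obtain ⟨p4, hp4⟩ := exists_polynomial_loop_mul B (9 : Reg) 31 (by decide) (.var 6)
    (mulE 30 (.var 9) (codeE (.var 31)))
  obtain ⟨p5, hp5⟩ := PolyTime.assign (B := B) (10 : Reg)
    (.sum 12 (.add (.var 9) (.const 1)) testE)
  refine ⟨p1 + (p2 + (p3 + (p4 + p5))), fun w M env o h1 hw h hF hS => ?_⟩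
  obtain ⟨a1, b1⟩ := hp1 w M (env, o) h1 hw h
  obtain ⟨a2, b2⟩ := hp2 w M (update env 8 1) o (fun i => i + 1) hw a1 (a1 6)
    (fun i _ a => by rw [update_idem, eval_factorial_step]) (fun i => by omega)
    (by simpa [Exp.eval, Finset.prod_range_add_one_eq_factorial] using hF)
  obtain ⟨v, hr⟩ := run_loop_assign (B := B) (w := w) (x := (8 : Reg)) (y := 31)
    (e := .var 6) (f := mulE 30 (.var 8) (.add (.var 31) (.const 1)))
    (g := fun i a => a * (i + 1)) (env := update env 8 1) (o := o) (by decide)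
    fun i _ a => by rw [update_idem, eval_factorial_step]
  have h6 : (Exp.var 6 : Exp Reg).eval w (update env 8 1) = env 6 := by simp [Exp.eval]
  rw [h6, iterDown_mul, update_self, one_mul, Finset.prod_range_add_one_eq_factorial,
    update_idem] at hr
  obtain ⟨a3, b3⟩ := hp3 w M _ h1 hw a2
  obtain ⟨a4, b4⟩ := hp4 w M _ _ (code (env 6)) hw a3 (a3 6) (fun i _ a => by
      rw [run, hr]
      simp only [update_idem]
      exact eval_code_step (by simp) i a)
    (fun i => Nat.le_add_left 1 _) (by
      rw [run, hr]
      simpa [Exp.eval] using hS)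
  obtain ⟨a5, b5⟩ := hp5 w M _ h1 hw a4
  refine ⟨fun x => (a5 x).trans ?_, (b1.seq (b2.seq (b3.seq (b4.seq b5)))).mono ?_⟩
  · simp; omega
  · simp

/-- The program of the decision procedure. -/
def decideProg : Prog Reg Bool := .seq (preamble Bool) (.ite bigE (.emit true)
  (.seq (search Bool) (.ite (.var 10) (.emit true) (.emit false))))

theorem decideProg_run : (decideProg.run (input G k) (fun _ => 0, [])).2 =
    [decide (HasBisectionATLB G.graph k)] := by
  obtain ⟨env, h1, h2⟩ := preamble_run (B := Bool) (G := G) (k := k)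
  obtain ⟨env', h3, h4⟩ := search_run (B := Bool) h2 []
  rw [decideProg, run, h1, run]
  simp only [eval_bigE h2]
  split_ifs with h
  · simp [run, FinGraph.hasBisection_of_tooLarge h]
  · rw [run, h3, run]
    simp only [Exp.eval, h4]
    split_ifs with h' <;> simp [run, h']

/-- A bound of the registers of the search for at most `n` kept vertices. -/
def searchBound (n : ℕ) : ℕ := (n * n ^ n + 1) ^ n + n ^ n

theorem factorial_le_searchBound {m n : ℕ} (h : m ≤ n) : m.factorial ≤ searchBound n :=
  ((Nat.factorial_le h).trans (Nat.factorial_le_pow n)).trans (Nat.le_add_left _ _)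

theorem prod_code_le_searchBound {m n : ℕ} (h : m ≤ n) :
    ∏ r ∈ Finset.range m, code m r ≤ searchBound n := by
  have h1 : ∀ r ∈ Finset.range m, code m r ≤ n * n ^ n + 1 := fun r hr => by
    have := Finset.mem_range.1 hr
    exact Nat.add_le_add_right (Nat.mul_le_mul (by omega)
      ((Nat.factorial_le h).trans (Nat.factorial_le_pow n))) 1
  calc _ ≤ (n * n ^ n + 1) ^ (Finset.range m).card := Finset.prod_le_pow_card _ _ _ h1
    _ ≤ (n * n ^ n + 1) ^ n := Nat.pow_le_pow_right (by omega) (by simpa using h)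
    _ ≤ _ := Nat.le_add_right _ _

/-- The search runs only if the kernel is not too large. Then at most `4 * k * (k + 1)` vertices are
kept, and `searchBound` covers the factorial and the product of the codes. -/
theorem decideProg_within : ∃ q : Polynomial ℕ, ∀ (G : FinGraph) (k : ℕ),
    (∀ x, (decideProg.run (input G k) (fun _ => 0, [])).1 x ≤
      q.eval ((input G k).length + 1 + searchBound (4 * k * (k + 1)))) ∧
    decideProg.Within (input G k) (fun _ => 0, [])
      (q.eval ((input G k).length + 1 + searchBound (4 * k * (k + 1)))) := by
  obtain ⟨p1, hp1⟩ := preamble_polyTime Bool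
  obtain ⟨p2, hp2⟩ := bigE.exists_polynomial Bool
  obtain ⟨p3, hp3⟩ := search_within Bool
  obtain ⟨p4, hp4⟩ := (Tame.ite (.var 10) (.emit true) (.emit false) :
    (Prog.ite (.var 10) (.emit true) (.emit false) : Prog Reg Bool).Tame)
  set X1 : Polynomial ℕ := Polynomial.X + p1
  set X2 : Polynomial ℕ := X1 + p3.comp X1
  refine ⟨X2 + p1 + 3 * p2.comp X1 + 3 + 1 + p3.comp X1 + p4.comp X2, fun G k => ?_⟩
  set M := (input G k).length + 1 + searchBound (4 * k * (k + 1)) with hM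
  obtain ⟨a1, b1⟩ := hp1 (input G k) M (fun _ => 0, []) (by omega) (by omega)
    (fun _ => Nat.zero_le _)
  obtain ⟨env, hrun, hme⟩ := preamble_run (B := Bool) (G := G) (k := k)
  rw [hrun] at a1
  simp only at a1
  set M1 := M + p1.eval M with hM1
  have a1' : ∀ x, env x ≤ M1 := fun x => (a1 x).trans (by omega)
  obtain ⟨c1, c2⟩ := hp2 (input G k) M1 env (by omega) a1'
  set M2 := M1 + p3.eval M1 with hM2
  have key : ¬G.TooLarge k → (∀ x, (((search Bool).seq (.ite (.var 10) (.emit true)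
      (.emit false))).run (input G k) (env, [])).1 x ≤ M2) ∧
      ((search Bool).seq (.ite (.var 10) (.emit true) (.emit false))).Within (input G k) (env, [])
        (p3.eval M1 + p4.eval M2) := by
    intro h
    have hn : env 6 ≤ 4 * k * (k + 1) := by
      rw [hme.card]
      exact not_lt.1 fun h' => h (Or.inl h')
    obtain ⟨a3, b3⟩ := hp3 (input G k) M1 env [] (by omega) (by omega) a1'
      ((factorial_le_searchBound hn).trans (by omega))
      ((prod_code_le_searchBound hn).trans (by omega))
    obtain ⟨a4, b4⟩ := hp4 (input G k) M2 _ (by omega) (by omega)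
      (fun x => (a3 x).trans (by omega))
    exact ⟨a4, b3.seq b4⟩
  have hite := Within.ite (B := Bool) (T' := 1 + p3.eval M1 + p4.eval M2) (s := (env, [])) c2
    (P := .emit true) (fun _ => Within.emit.mono (by omega))
    (Q := (search Bool).seq (.ite (.var 10) (.emit true) (.emit false))) (fun h =>
      (key fun h' => (eval_bigE hme).2 h' h).2.mono (by omega))
  refine ⟨fun x => ?_, ?_⟩
  · have : (decideProg.run (input G k) (fun _ => 0, [])).1 x ≤ M2 := by
      rw [decideProg, run, hrun, run]
      simp only [eval_bigE hme]
      split_ifs with h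
      · exact (a1' x).trans (by omega)
      · exact (key h).1 x
    refine this.trans ?_
    simp only [X2, X1, Polynomial.eval_add, Polynomial.eval_mul, Polynomial.eval_comp,
      Polynomial.eval_X, Polynomial.eval_ofNat, Polynomial.eval_one, ← hM1, ← hM2]
    omega
  · refine (b1.seq (by rw [hrun]; exact hite)).mono ?_
    simp only [X2, X1, Polynomial.eval_add, Polynomial.eval_mul, Polynomial.eval_comp,
      Polynomial.eval_X, Polynomial.eval_ofNat, Polynomial.eval_one, ← hM1, ← hM2]
    omega

end BisecProg

/-! ### Computability of the bounds, and conclusion -/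

theorem Polynomial.primrec_eval (p : Polynomial ℕ) : Primrec fun n => p.eval n := by
  induction p using Polynomial.induction_on' with
  | add p q hp hq => exact (Primrec.nat_add.comp hp hq).of_eq fun n => by simp
  | monomial m a =>
    refine (Primrec.nat_mul.comp (Primrec.const a) ((Primrec₂.unpaired'.1 Nat.Primrec.pow).comp
      Primrec.id (Primrec.const m))).of_eq fun n => by simp

theorem BisecProg.primrec_searchBound : Primrec BisecProg.searchBound := by
  have hp : Primrec₂ fun a b : ℕ => a ^ b := Primrec₂.unpaired'.1 Nat.Primrec.pow
  have h1 : Primrec fun n : ℕ => n ^ n := hp.comp .id .id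
  exact Primrec.nat_add.comp (hp.comp (Primrec.succ.comp (Primrec.nat_mul.comp .id h1)) .id) h1

/-- The sum `a + b` is at most twice the larger term, and `x + y ≤ (x + 1) * (y + 1)`. This
separates the parameter from the instance in the running time. -/
theorem Polynomial.eval_add_le (p : Polynomial ℕ) (a b : ℕ) :
    p.eval (a + b) ≤ (p.eval (2 * a) + 1) * (p.eval (2 * b) + 1) := by
  have h : p.eval (a + b) ≤ p.eval (2 * a) + p.eval (2 * b) := by
    rcases le_total a b with h | h
    · exact (p.eval_nat_mono (show a + b ≤ 2 * b by omega)).trans (Nat.le_add_left _ _)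
    · exact (p.eval_nat_mono (show a + b ≤ 2 * a by omega)).trans (Nat.le_add_right _ _)
  nlinarith

theorem FinGraph.n_kernel_le (G : FinGraph) (k : ℕ) :
    (kernel (G, k)).1.n ≤ 4 * k * (k + 1) := by
  rw [kernel]
  split_ifs with h
  · exact Nat.zero_le _
  · exact G.length_keptList.le.trans (not_lt.1 fun h' => h (Or.inl h'))

theorem FinGraph.numEdges_kernel_le (G : FinGraph) (k : ℕ) :
    (kernel (G, k)).1.numEdges ≤ 32 * k ^ 3 := by
  rw [kernel]
  split_ifs with h
  · simp [numEdges]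
  · have h1 : G.keptPairs ≤ 64 * k ^ 3 := not_lt.1 fun h' => h (Or.inr h')
    have h2 := G.two_mul_numEdges_trimmed
    dsimp only
    omega

theorem hasBisectionATLB_bot_zero : HasBisectionATLB (⊥ : SimpleGraph (Fin 0)) 0 :=
  ⟨∅, ∅, ⟨by simp, by ext i; exact i.elim0, by simp, by simp⟩, by simp⟩

theorem FinGraph.hasBisection_kernel_iff (G : FinGraph) (k : ℕ) :
    HasBisectionATLB (kernel (G, k)).1.graph (kernel (G, k)).2 ↔ HasBisectionATLB G.graph k := by
  by_cases h : G.TooLarge k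
  · have hk : kernel (G, k) = (⟨0, ⊥⟩, 0) := if_pos h
    rw [hk]
    exact iff_of_true hasBisectionATLB_bot_zero (hasBisection_of_tooLarge h)
  · have hk : kernel (G, k) = (G.trimmed, k) := if_neg h
    rw [hk]
    exact G.hasBisection_trimmed_iff k

theorem FinGraph.snd_kernel_le (G : FinGraph) (k : ℕ) : (kernel (G, k)).2 ≤ k := by
  rw [kernel]
  split_ifs
  exacts [Nat.zero_le _, le_rfl]

theorem FinGraph.length_encode_kernel_le (G : FinGraph) (k : ℕ) :
    (kernel (G, k)).1.encode.length ≤ 4 * k * (k + 1) * (4 * k * (k + 1) + 1) := by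
  rw [length_encode]
  have := G.n_kernel_le k
  gcongr

theorem FinGraph.isKernelization_kernel : maxBisecATLB.IsKernelization FinGraph.kernel where
  polyTime := BisecProg.computable_kernel
  yes_iff G k := (FinGraph.hasBisection_kernel_iff G k).symm
  bounded := ⟨_, _, fun G k => ⟨FinGraph.snd_kernel_le G k, FinGraph.length_encode_kernel_le G k⟩⟩

open Classical in
theorem BisecProg.exists_outputsInTime : ∃ r : Polynomial ℕ, ∀ (G : FinGraph) (k : ℕ),
    Nonempty (Turing.TM2OutputsInTime decideProg.computer.tm
      ((input G k).map decideProg.computer.inputAlphabet.symm)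
      (some ([decide (HasBisectionATLB G.graph k)].map decideProg.computer.outputAlphabet.symm))
      ((r.eval (2 * (k + 1 + searchBound (4 * k * (k + 1)))) + 1) *
        (r.comp (2 * Polynomial.X) + 1).eval G.encode.length)) := by
  obtain ⟨q, hq⟩ := decideProg_within
  refine ⟨q + 32 * (2 * q + 1) + 2 * Polynomial.X + 3, fun G k => ?_⟩
  set r : Polynomial ℕ := q + 32 * (2 * q + 1) + 2 * Polynomial.X + 3 with hr
  obtain ⟨h1, h2⟩ := hq G k
  -- The bits of the parameter also belong to the input; their number is charged to the factor that
  -- depends on `k`.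
  have h3 : (input G k).length ≤ k + G.encode.length := by
    rw [length_input]
    exact Nat.add_le_add_right (length_encodeNat_le k) _
  rw [← decideProg_run]
  refine h2.outputsInTime_map h1 ?_
  have h5 := r.eval_add_le (k + 1 + searchBound (4 * k * (k + 1))) G.encode.length
  have h6 := r.eval_nat_mono (show (input G k).length + 1 + searchBound (4 * k * (k + 1)) ≤
    k + 1 + searchBound (4 * k * (k + 1)) + G.encode.length by omega)
  simp only [Polynomial.eval_add, Polynomial.eval_comp, Polynomial.eval_mul,
    Polynomial.eval_X, Polynomial.eval_ofNat, Polynomial.eval_one]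
  refine le_trans ?_ (h6.trans h5)
  simp only [hr, Polynomial.eval_add, Polynomial.eval_mul,
    Polynomial.eval_X, Polynomial.eval_ofNat, Polynomial.eval_one, Fintype.card_fin]
  omega

theorem fixedParameterTractable_maxBisecATLB : maxBisecATLB.FixedParameterTractable := by
  obtain ⟨r, h⟩ := BisecProg.exists_outputsInTime
  refine ⟨fun k => r.eval (2 * (k + 1 + BisecProg.searchBound (4 * k * (k + 1)))) + 1,
    r.comp (2 * Polynomial.X) + 1, BisecProg.decideProg.computer, ?_, h⟩
  have h1 : Primrec fun k : ℕ => 4 * k * (k + 1) := Primrec.nat_mul.comp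
    (Primrec.nat_mul.comp (.const 4) .id) Primrec.succ
  have h2 : Primrec fun k : ℕ => 2 * (k + 1 + BisecProg.searchBound (4 * k * (k + 1))) :=
    Primrec.nat_mul.comp (.const 2)
      (Primrec.nat_add.comp Primrec.succ (BisecProg.primrec_searchBound.comp h1))
  exact (Primrec.succ.comp (r.primrec_eval.comp h2)).to_comp

theorem mainTheorem1 :
    (∃ φ : FinGraph × ℕ → FinGraph × ℕ,
      ParamProblem.IsKernelization maxBisecATLB φ ∧
      ∃ C : ℕ, ∀ (G : FinGraph) (k : ℕ),
        (φ (G, k)).1.n ≤ 4 * k * (k + 1) ∧ (φ (G, k)).1.numEdges ≤ C * k ^ 3) ∧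
    ParamProblem.FixedParameterTractable maxBisecATLB :=
  ⟨⟨FinGraph.kernel, FinGraph.isKernelization_kernel, 32, fun G k =>
    ⟨G.n_kernel_le k, G.numEdges_kernel_le k⟩⟩, fixedParameterTractable_maxBisecATLB⟩
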